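/- Let $d\ge 1$ and let $\sigma$ be the normalised rotation-invariant Lebesgue measure on the unit sphere $\partial\mathbb B^d$ of $\mathbb C^d$. Order the multi-indices $\alpha\in\mathbb N_0^d$ by the short lexicographical order $\prec$: first by length $|\alpha|=\alpha_1+\dots+\alpha_d$ and, for equal length, lexicographically with $e_1\prec\dots\prec e_d$ (at the first coordinate where they differ, the multi-index with the larger entry comes first). Write $\mathrm{prec}(\alpha)$ for the immediate predecessor of $\alpha\neq0$, $\alpha(n)=(0,\dots,0,n)$ for the last multi-index of length $n$, and $\mathbb C[z]_\alpha=\mathrm{span}\{z^\beta:\beta\preceq\alpha\}$. For a finite positive measure $\mu$ on $\partial\mathbb B^d$ let $K(\alpha,\beta)=\int\zeta^\alpha\overline{\zeta}^{\beta}\,d\mu(\zeta)$ and $D_\alpha=\det[K(\alpha',\beta')]_{0\preceq\alpha',\beta'\preceq\alpha}$. The measure $\mu$ is *non-trivial* if all the matrices $[K(\alpha',\beta')]_{0\preceq\alpha',\beta'\preceq\alpha}$ are invertible. Let $(\Phi_\alpha)$ and $(\varphi_\alpha)$, $\varphi_\alpha=\sum_{\beta\preceq\alpha}a_{\alpha,\beta}z^\beta$,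 be the monic orthogonal and the orthonormal polynomials obtained in $L^2(\mu)$ by the Gram–Schmidt algorithm from the monomials in the order $\prec$. Let $\varphi^\#_\alpha$ be the polynomial whose coefficient vector is the first column of $G^{-1}$, where $[K(\alpha',\beta')]_{0\preceq\alpha',\beta'\preceq\alpha}=G^*G$ with $G$ lower triangular with positive diagonal. The *Verblunsky coefficients* $\gamma_{\alpha,\beta}$ ($\alpha\prec\beta$; put $\gamma_{\alpha,\alpha}=0$) are the Schur parameters of the positive kernel $K$: with $I=\{\delta:\alpha\prec\delta\prec\beta\}$ and $d_{\alpha,\beta}=\sqrt{1-|\gamma_{\alpha,\beta}|^2}$ they are determined recursively by $$K(\alpha,\beta)=K(\alpha,I)K(I,I)^{-1}K(I,\beta)+\sqrt{K(\alpha,\alpha)}\Big(\prod_{\delta\in I}d_{\alpha,\delta}\Big)\gamma_{\alpha,\beta}\Big(\prod_{\delta\in I}d_{\delta,\beta}\Big)\sqrt{K(\beta,\beta)} .$$ The *Christoffel function* is $\lambda_\infty(z;d\mu)=\lim_{n\to\infty}\lambda_n(z;d\mu)$, where $\lambda_n(z;d\mu)=\big(\sum_{\alpha\preceq\alpha(n)}|\varphi_\alpha(z)|^2\big)^{-1}$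 (and $\lambda_n(z;0)=0$ for the zero measure). Let $d\mu=w\,d\sigma+d\mu_s$ be the Lebesgue decomposition of $\mu$ with respect to $\sigma$, and $d\mu_{ac}=w\,d\sigma$. For $f\in H^\infty(\mathbb B^d)$ and $\sigma$-almost every $\zeta\in\partial\mathbb B^d$, $f(\zeta)$ denotes the $K$-limit of $f$ at $\zeta$. By convention $\exp(-\infty)=0$. **Theorem.** Let $\mu$ be a non-trivial probability measure on $\partial\mathbb B^d$. For each $n$ the problem of minimising $\int|q|^2\,d\mu$ over $q\in\mathbb C[z]_{\alpha(n)}$ with $q(0)=1$ has a unique solution $P_n$. The following limits exist and are equal: (i) $\lim_n\|\Phi_{\alpha(n)}\|_{L^2(\mu)}^2$; (ii) $\lim_n a_{\alpha(n),\alpha(n)}^{-2}$; (iii) $\lim_n D_{\alpha(n)}/D_{\mathrm{prec}(\alpha(n))}$; (iv) $\lim_n K(\alpha(n),\alpha(n))\prod_{0\preceq\beta\preceq\mathrm{prec}(\alpha(n))}(1-|\gamma_{\beta,\alpha(n)}|^2)$. The following product and limits exist and are equal: (v) $\prod_{\alpha\in\mathbb N_0^d}(1-|\gamma_{0,\alpha}|^2)$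 (the value $0$ being allowed); (vi) $\lim_n|\varphi^\#_{\alpha(n)}(0)|^{-2}$; (vii) $\lim_n\big(\sum_{0\preceq\alpha\preceq\alpha(n)}|\varphi_\alpha(0)|^2\big)^{-1}$; (viii) $\lambda_\infty(0;d\mu)$, which is also $\inf\{\int|q|^2d\mu:q\in\mathbb C[z_1,\dots,z_d],\ q(0)=1\}$. When $d>1$ the two lists are distinct quantities: there is a non-trivial probability measure on $\partial\mathbb B^d$ for which the common value of (i)–(iv) differs from that of (v)–(viii). If $\mu_s$ is discrete (a countable sum of point masses), then (v) is also equal to (viii)$'$ $\lambda_\infty(0;d\mu_{ac})$, which is also $\inf\{\int|q|^2d\mu_{ac}:q\in\mathbb C[z_1,\dots,z_d],\ q(0)=1\}$; (ix) $\lim_n\int|P_n|^2\,d\mu_{ac}$, and the same holds if the $P_n$ are replaced by any solutions, which exist, of the minimisation problems with $\mu_{ac}$ in place of $\mu$. If in addition there is $f\in H^\infty(\mathbb B^d)$ with $f(0)=1$ and $$\int_{\partial\mathbb B^d}|f(\zeta)|^2w(\zeta)\,d\sigma(\zeta)\le\exp\Big(\int_{\partial\mathbb B^d}\log w(\zeta)\,d\sigma(\zeta)\Big),$$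 then (v) is also equal to (x) $\exp\big(\int_{\partial\mathbb B^d}\log w(\zeta)\,d\sigma(\zeta)\big)$. -/

import Mathlib

open MeasureTheory Filter Topology
open scoped ENNReal ComplexConjugate

noncomputable section

/-! ### Multi-indices with the short lexicographical order -/

/-- Multi-indices in `ℕ₀^d`.  A wrapper around exponent vectors, so that it can carry the
short lexicographical order instead of the componentwise one. -/
@[ext]
structure MultiIndex (d : ℕ) where
  exp : Fin d →₀ ℕ

namespace MultiIndex

variable {d : ℕ}

instance : Zero (MultiIndex d) := ⟨⟨0⟩⟩

/-- The length `|α| = α₁ + ⋯ + α_d`. -/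
def length (α : MultiIndex d) : ℕ := ∑ i, α.exp i

/-- The key by which multi-indices are compared: first the length, then the coordinates from
left to right, a larger coordinate coming first (so that `e₁ ≺ e₂ ≺ ⋯ ≺ e_d`). -/
def key (α : MultiIndex d) : ℕ ×ₗ Lex (Fin d → ℕᵒᵈ) :=
  toLex (α.length, toLex fun i => OrderDual.toDual (α.exp i))

theorem key_injective : Function.Injective (key : MultiIndex d → _) := by
  intro α β h
  have h2 : (fun i => OrderDual.toDual (α.exp i)) = fun i => OrderDual.toDual (β.exp i) :=
    toLex.injective (Prod.ext_iff.1 (toLex.injective h)).2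
  ext i
  exact OrderDual.toDual.injective (congrFun h2 i)

/-- The short lexicographical order. -/
instance : LinearOrder (MultiIndex d) := LinearOrder.lift' key key_injective

theorem lt_iff {α β : MultiIndex d} :
    α < β ↔ α.length < β.length ∨
      (α.length = β.length ∧ ∃ i, (∀ j < i, α.exp j = β.exp j) ∧ β.exp i < α.exp i) := by
  change key α < key β ↔ _
  rw [Prod.Lex.lt_iff]
  rfl

theorem length_le_of_le {α β : MultiIndex d} (h : α ≤ β) : α.length ≤ β.length := by
  rcases h.lt_or_eq with h | rfl
  · rcases lt_iff.1 h with h | h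
    · exact h.le
    · exact h.1.le
  · exact le_rfl

theorem finite_length_le (n : ℕ) : {α : MultiIndex d | α.length ≤ n}.Finite := by
  have h : Set.Finite {f : Fin d → ℕ | f ≤ fun _ => n} := Set.finite_Iic _
  refine Set.Finite.of_finite_image (f := fun α : MultiIndex d => (α.exp : Fin d → ℕ))
    (h.subset ?_) ?_
  · rintro _ ⟨α, hα, rfl⟩ i
    exact (Finset.single_le_sum (f := fun i => α.exp i) (fun _ _ => Nat.zero_le _)
      (Finset.mem_univ i)).trans hα
  · intro α _ β _ h
    ext i
    exact congrFun h i

instance : LocallyFiniteOrder (MultiIndex d) :=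
  LocallyFiniteOrder.ofFiniteIcc fun _ b =>
    (finite_length_le b.length).subset fun _ hx => length_le_of_le hx.2

theorem length_zero : (0 : MultiIndex d).length = 0 := Finset.sum_eq_zero fun _ _ => rfl

instance : OrderBot (MultiIndex d) where
  bot := 0
  bot_le α := by
    by_contra h
    rcases lt_iff.1 (not_le.1 h) with h | ⟨h, i, _, hi⟩
    · rw [length_zero] at h
      exact absurd h (Nat.not_lt_zero _)
    · rw [length_zero] at h
      have h0 : α.exp i = 0 := Finset.sum_eq_zero_iff.1 h i (Finset.mem_univ i)
      rw [h0] at hi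
      exact absurd hi (Nat.not_lt_zero _)

theorem bot_eq_zero : (⊥ : MultiIndex d) = 0 := rfl

instance : WellFoundedLT (MultiIndex d) :=
  StrictMono.wellFoundedLT (f := fun α : MultiIndex d => (Finset.Iio α).card)
    fun _ _ h => Finset.card_lt_card (Finset.Iio_ssubset_Iio h)

/-- The immediate predecessor of `α` (for `α ≠ 0`; by convention `prec 0 = 0`). -/
def prec (α : MultiIndex d) : MultiIndex d :=
  if h : (Finset.Iio α).Nonempty then (Finset.Iio α).max' h else α

/-- `α(n) = (0, …, 0, n)`, the last multi-index of length `n`. -/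
def last (d n : ℕ) : MultiIndex d :=
  ⟨Finsupp.equivFunOnFinite.symm fun i => if i.val + 1 = d then n else 0⟩

end MultiIndex

/-! ### Verblunsky coefficients and Cholesky factors of kernels on a linear order -/

section Kernels

variable {ι : Type*} [LinearOrder ι]

/-- The Verblunsky coefficients `γ_{k,j}` (`k ≺ j`) of a positive kernel `K`, by recursion on the
window between `k` and `j`.  With `I = {p | k ≺ p ≺ j}` and `d_{p,q} = √(1 - |γ_{p,q}|²)`, the
family is determined by the structure formula
`K(k,j) = K(k,I) K(I,I)⁻¹ K(I,j) + √K(k,k) (∏_{p ∈ I} d_{k,p}) γ_{k,j} (∏_{p ∈ I} d_{p,j}) √K(j,j)`: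
given the other entries of the window, the entries `K(k,j)` which keep the window positive
form a disc, of which the first summand is the centre, and `γ_{k,j}` is the parameter of the actual
entry in that disc.
If the windows of `K` are invertible then all divisions are by positive numbers.
By convention `γ_{k,j} = 0` unless `k ≺ j`. -/
def verblunsky [LocallyFiniteOrder ι] (K : ι → ι → ℂ) (k j : ι) : ℂ :=
  if k < j then
    (K k j - ∑ p : Finset.Ioo k j, ∑ q : Finset.Ioo k j,
        K k p * (Matrix.of fun p q : Finset.Ioo k j => K p q)⁻¹ p q * K q j) /
      ((√(K k k).re * (∏ p : Finset.Ioo k j, √(1 - ‖verblunsky K k p‖ ^ 2)) *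
        (∏ p : Finset.Ioo k j, √(1 - ‖verblunsky K p j‖ ^ 2)) * √(K j j).re : ℝ) : ℂ)
  else 0
termination_by (Finset.Ioo k j).card
decreasing_by
  · have hp := Finset.mem_Ioo.1 p.2
    exact Finset.card_lt_card (Finset.ssubset_iff_of_subset
      (Finset.Ioo_subset_Ioo le_rfl hp.2.le) |>.2 ⟨p, p.2, by simp⟩)
  · have hp := Finset.mem_Ioo.1 p.2
    exact Finset.card_lt_card (Finset.ssubset_iff_of_subset
      (Finset.Ioo_subset_Ioo hp.1.le le_rfl) |>.2 ⟨p, p.2, by simp⟩)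

/-- `A = G* G` with `G` lower triangular with positive diagonal. -/
def IsLowerCholesky [Fintype ι] (A G : Matrix ι ι ℂ) : Prop :=
  (∀ i j, i < j → G i j = 0) ∧ (∀ i, 0 < (G i i).re ∧ (G i i).im = 0) ∧ G.conjTranspose * G = A

open Classical in
/-- The lower-triangular Cholesky factor of a positive definite matrix. -/
def lowerCholesky [Fintype ι] (A : Matrix ι ι ℂ) : Matrix ι ι ℂ :=
  if h : ∃ G, IsLowerCholesky A G then h.choose else 0

end Kernels

/-! ### The unit sphere, moments and orthogonal polynomials -/

/-- The unit sphere `∂𝔹^d` of `ℂ^d` with the Euclidean norm. -/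
abbrev CSphere (d : ℕ) : Type := Metric.sphere (0 : EuclideanSpace ℂ (Fin d)) 1

/-- The normalised rotation-invariant Lebesgue measure on `∂𝔹^d`. -/
def sphereMeasure (d : ℕ) : Measure (CSphere d) :=
  ((volume : Measure (EuclideanSpace ℂ (Fin d))).toSphere Set.univ)⁻¹ •
    (volume : Measure (EuclideanSpace ℂ (Fin d))).toSphere

/-- The value of a polynomial at a point of `ℂ^d`. -/
def polyEval {d : ℕ} (z : EuclideanSpace ℂ (Fin d)) (p : MvPolynomial (Fin d) ℂ) : ℂ :=
  MvPolynomial.eval (fun i => z i) p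

/-- The monomial `z^α`. -/
def zmonomial {d : ℕ} (α : MultiIndex d) : MvPolynomial (Fin d) ℂ :=
  MvPolynomial.monomial α.exp 1

section Measures

variable {d : ℕ} (μ : Measure (CSphere d))

/-- `⟨p, q⟩_μ = ∫ p(ζ) conj(q(ζ)) dμ(ζ)`. -/
def polyInner (p q : MvPolynomial (Fin d) ℂ) : ℂ :=
  ∫ ζ : CSphere d, polyEval ζ p * conj (polyEval ζ q) ∂μ

/-- `‖p‖_μ² = ∫ |p(ζ)|² dμ(ζ)`. -/
def polyNormSq (p : MvPolynomial (Fin d) ℂ) : ℝ :=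
  ∫ ζ : CSphere d, ‖polyEval ζ p‖ ^ 2 ∂μ

/-- The moment kernel `K(α, β) = ∫ ζ^α conj(ζ)^β dμ(ζ)`. -/
def momentKernel (α β : MultiIndex d) : ℂ :=
  ∫ ζ : CSphere d, (∏ i, (ζ : EuclideanSpace ℂ (Fin d)) i ^ α.exp i) *
    ∏ i, conj ((ζ : EuclideanSpace ℂ (Fin d)) i) ^ β.exp i ∂μ

/-- The moment matrix `[K(α', β')]_{0 ⪯ α', β' ⪯ α}`. -/
def momentMatrix (α : MultiIndex d) : Matrix (Finset.Iic α) (Finset.Iic α) ℂ :=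
  Matrix.of fun β γ => momentKernel μ β γ

/-- `μ` is non-trivial: all its moment matrices are invertible. -/
def IsNontrivialMeasure : Prop := ∀ α : MultiIndex d, IsUnit (momentMatrix μ α)

/-- The moment matrix determinants `D_α`. -/
def momentDet (α : MultiIndex d) : ℂ := (momentMatrix μ α).det

/-- The Verblunsky coefficients `γ_{α,β}` of `μ`. -/
def verblunskyCoeff (α β : MultiIndex d) : ℂ := verblunsky (momentKernel μ) α β

/-- The monic orthogonal polynomials `Φ_α`: the Gram--Schmidt algorithm without normalisation on
the monomials in the short lexicographical order. -/
def monicPoly (α : MultiIndex d) : MvPolynomial (Fin d) ℂ :=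
  zmonomial α - ∑ β : Finset.Iio α,
    MvPolynomial.C (polyInner μ (zmonomial α) (monicPoly β) /
      polyInner μ (monicPoly β) (monicPoly β)) * monicPoly β
termination_by (Finset.Iio α).card
decreasing_by
  all_goals exact Finset.card_lt_card (Finset.Iio_ssubset_Iio (Finset.mem_Iio.1 β.2))

/-- The orthonormal polynomials `φ_α = Φ_α / ‖Φ_α‖_μ`. -/
def orthoPoly (α : MultiIndex d) : MvPolynomial (Fin d) ℂ :=
  MvPolynomial.C (((√(polyNormSq μ (monicPoly μ α)))⁻¹ : ℝ) : ℂ) * monicPoly μ α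

/-- The coefficient `a_{α,β}` of `z^β` in `φ_α`. -/
def orthoCoeff (α β : MultiIndex d) : ℂ := (orthoPoly μ α).coeff β.exp

/-- The sharp polynomials `φ_α^#`: the coefficient vector is the first column of `G⁻¹`, where
`G` is the lower-triangular Cholesky factor of `[K(α', β')]_{0 ⪯ α', β' ⪯ α}`. -/
def sharpPoly (α : MultiIndex d) : MvPolynomial (Fin d) ℂ :=
  ∑ β : Finset.Iic α, MvPolynomial.C
    ((lowerCholesky (momentMatrix μ α))⁻¹ β ⟨⊥, Finset.mem_Iic.2 bot_le⟩) * zmonomial β.1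

/-- The Christoffel approximate `λ_n(z; dμ) = (∑_{0 ⪯ α ⪯ α(n)} |φ_α(z)|²)⁻¹`.
(For the zero measure all `φ_α`, and hence the approximates, are `0`.) -/
def christoffelApprox (n : ℕ) (z : EuclideanSpace ℂ (Fin d)) : ℝ :=
  (∑ α ∈ Finset.Iic (MultiIndex.last d n), ‖polyEval z (orthoPoly μ α)‖ ^ 2)⁻¹

/-- The Christoffel function `λ_∞(z; dμ) = lim_n λ_n(z; dμ)`. -/
def christoffelFunction (z : EuclideanSpace ℂ (Fin d)) : ℝ :=
  limUnder atTop fun n => christoffelApprox μ n z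

/-- The values `∫ |q|² dμ` for polynomials `q` with `q(z) = 1`. -/
def christoffelValues (z : EuclideanSpace ℂ (Fin d)) : Set ℝ :=
  {x | ∃ q : MvPolynomial (Fin d) ℂ, polyEval z q = 1 ∧ polyNormSq μ q = x}

/-- `ℂ[z₁, …, z_d]_α = span {z^β}_{0 ⪯ β ⪯ α}`. -/
def polysUpTo (α : MultiIndex d) : Submodule ℂ (MvPolynomial (Fin d) ℂ) :=
  Submodule.span ℂ (zmonomial '' Set.Iic α)

/-- `P` solves the problem of minimising `∫ |q|² dμ` over `q ∈ ℂ[z₁, …, z_d]_{α(n)}` with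
`q(z) = 1`. -/
def IsChristoffelMinimizer (n : ℕ) (z : EuclideanSpace ℂ (Fin d))
    (P : MvPolynomial (Fin d) ℂ) : Prop :=
  P ∈ polysUpTo (MultiIndex.last d n) ∧ polyEval z P = 1 ∧
    ∀ q ∈ polysUpTo (MultiIndex.last d n), polyEval z q = 1 → polyNormSq μ P ≤ polyNormSq μ q

/-- The singular part `μ_s` of `μ` with respect to `σ`. -/
def singPart : Measure (CSphere d) := μ.singularPart (sphereMeasure d)

/-- The density `w` of the absolutely continuous part of `μ` with respect to `σ`. -/
def density (ζ : CSphere d) : ℝ := (μ.rnDeriv (sphereMeasure d) ζ).toReal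

/-- The absolutely continuous part `dμ_ac = w dσ`. -/
def acPart : Measure (CSphere d) :=
  (sphereMeasure d).withDensity fun ζ => ENNReal.ofReal (density μ ζ)

/-- A discrete measure: one carried by a countable set, i.e. a countable sum of point masses. -/
def IsDiscreteMeasure (ν : Measure (CSphere d)) : Prop :=
  ∃ S : Set (CSphere d), S.Countable ∧ ν Sᶜ = 0

open Classical in
/-- `exp (∫ log w dσ)` for a non-negative `w ∈ L¹(σ)`.  As `log w ≤ w`, the integral exists in
`[-∞, ∞)`; when it is `-∞` the exponential is `0`. -/
def szegoEntropy (w : CSphere d → ℝ) : ℝ :=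
  if (∀ᵐ ζ ∂sphereMeasure d, 0 < w ζ) ∧
      Integrable (fun ζ => Real.log (w ζ)) (sphereMeasure d) then
    Real.exp (∫ ζ, Real.log (w ζ) ∂sphereMeasure d)
  else 0

end Measures

/-! ### Bounded holomorphic functions on the ball and their boundary values -/

section Hardy

variable {d : ℕ}

/-- `f ∈ H^∞(𝔹^d)`. -/
def IsHInfinity (f : EuclideanSpace ℂ (Fin d) → ℂ) : Prop :=
  DifferentiableOn ℂ f (Metric.ball 0 1) ∧ ∃ C : ℝ, ∀ z ∈ Metric.ball 0 1, ‖f z‖ ≤ C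

/-- The Korányi approach region `{z ∈ 𝔹^d : |1 - ⟨z, ζ⟩| < (a / 2) (1 - ‖z‖²)}`. -/
def koranyiRegion (a : ℝ) (ζ : CSphere d) : Set (EuclideanSpace ℂ (Fin d)) :=
  {z | ‖z‖ < 1 ∧ ‖1 - inner ℂ (ζ : EuclideanSpace ℂ (Fin d)) z‖ < a / 2 * (1 - ‖z‖ ^ 2)}

/-- `f` has `K`-limit `L` at `ζ`. -/
def IsKLimit (f : EuclideanSpace ℂ (Fin d) → ℂ) (ζ : CSphere d) (L : ℂ) : Prop :=
  ∀ a : ℝ, 1 < a → Tendsto f (𝓝[koranyiRegion a ζ] (ζ : EuclideanSpace ℂ (Fin d))) (𝓝 L)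

open Classical in
/-- The boundary value `f(ζ)`, the `K`-limit of `f` at `ζ`.  For `f ∈ H^∞(𝔹^d)` it exists for
`σ`-almost every `ζ`; on the remaining null set, where the boundary value is immaterial, the
convention is `limsup_{r → 1} |f(rζ)|`. -/
def boundaryValue (f : EuclideanSpace ℂ (Fin d) → ℂ) (ζ : CSphere d) : ℂ :=
  if h : ∃ L, IsKLimit f ζ L then h.choose
  else ((limsup (fun r : ℝ => ‖f (r • (ζ : EuclideanSpace ℂ (Fin d)))‖) (𝓝[<] 1) : ℝ) : ℂ)

end Hardy

end

/-!
Everything takes place in `L²(μ)`, where the monomials are linearly independent because the moment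
matrices are invertible. For a finite set `s` of multi-indices let the residual of a vector be its
component orthogonal to the monomials with index in `s` (`spanResidual`). The centre of the disc in
the recursion for the Verblunsky coefficients is an inner product of projections, so `γ_{α,β}` is
the normalised inner product of the residuals of `z^α` and `z^β` with respect to the monomials
strictly between them (`norm_residual_Ioo_and_verblunsky`). Adding one vector to the span therefore
multiplies a squared distance by `1 - |γ|²`, and the squared distance of a monomial to the span of
an adjacent interval of monomials is a product of such factors (`norm_sq_residual_Ico`,
`norm_sq_residual_Ioc`).

Applied to `z^{α(n)}` and its predecessors this expresses `‖Φ_{α(n)}‖²` as a product. It is also a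
quotient of moment determinants, since Gram--Schmidt diagonalises the moment matrix. The sequence
decreases because `z_d Φ_{α(n)}` is a competitor for `Φ_{α(n+1)}` and `|z_d| ≤ 1`
(`exists_limit_monic`).

Applied to the constant `1` and its successors it expresses the value of the extremal problem at
the origin as `∏ (1 - |γ_{0,α}|²)`. The Christoffel--Darboux kernel solves that problem, with value
`(∑ |φ_α(0)|²)⁻¹` (`exists_reproducing`, `inv_christoffelSum_zero`). This sum is the corner entry of
the inverse moment matrix, which is `|φ^#(0)|²` as the Cholesky factor is triangular
(`norm_sq_sharpPoly_zero`). As every polynomial lies in one of the finite-dimensional spaces, the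
values decrease to the infimum over all polynomials (`tendsto_christoffelApprox`,
`hasProd_verblunsky`).

A point mass at `ξ` may be discarded: multiplying a competitor by a normalised
`1 - ((1 + ⟨z, ξ⟩) / 2)^m` keeps the value at the origin, kills the mass at `ξ`, and changes nothing
else in the limit. Finitely many masses are treated by products, countably many by dominated
convergence (`sInf_christoffelValues_acPart`). The absolutely continuous part is either zero or
non-trivial, because the zero set of a polynomial is a null set of the sphere
(`ae_polyEval_ne_zero`).

The geometric mean `exp (∫ log w dσ)` bounds the extremal value from below: on each circle
`e^{iθ} ζ` the mean of `log |q|²` is at least `log |q(0)|²`, and `log x ≤ x - 1` does the rest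
(`szegoEntropy_le`). Conversely the dilates of `f ∈ H^∞` are uniform limits of polynomials on the
sphere, and Fatou's lemma along the radii bounds the extremal value by `∫ |f|² w dσ`
(`ofReal_sInf_christoffelValues_le_lintegral`).

For the surface measure itself the extremal value at the origin is `1`, whereas
`‖Φ_{α(n)}‖² ≤ ∫ |z_d|^{2n} dσ → 0` when `d > 1`, so that the two limits differ.
-/

open scoped Pointwise

noncomputable section

/-! ### Residuals of vectors and Verblunsky coefficients of Gram kernels -/

section Residual

variable {ι H : Type*} [NormedAddCommGroup H] [InnerProductSpace ℂ H]

local notation "⟪" x ", " y "⟫" => inner ℂ x y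

instance finiteDimensional_span_image_finset (v : ι → H) (s : Finset ι) :
    FiniteDimensional ℂ (Submodule.span ℂ (v '' (s : Set ι))) :=
  FiniteDimensional.span_of_finite ℂ (s.finite_toSet.image v)

/-- The component of `x` orthogonal to the vectors `v i`, `i ∈ s`. -/
def spanResidual (v : ι → H) (s : Finset ι) (x : H) : H :=
  x - (Submodule.span ℂ (v '' (s : Set ι))).starProjection x

theorem sub_residual_mem (v : ι → H) (s : Finset ι) (x : H) :
    x - spanResidual v s x ∈ Submodule.span ℂ (v '' (s : Set ι)) := by
  simp only [spanResidual, sub_sub_cancel]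
  exact Submodule.starProjection_apply_mem _ _

theorem inner_residual_of_mem_span {v : ι → H} {s : Finset ι} {y : H} (x : H)
    (hy : y ∈ Submodule.span ℂ (v '' (s : Set ι))) : ⟪y, spanResidual v s x⟫ = 0 := by
  rw [← inner_conj_symm, spanResidual, Submodule.starProjection_inner_eq_zero _ _ hy, map_zero]

theorem inner_residual {v : ι → H} {s : Finset ι} {i : ι} (x : H) (hi : i ∈ s) :
    ⟪v i, spanResidual v s x⟫ = 0 :=
  inner_residual_of_mem_span x (Submodule.subset_span ⟨i, hi, rfl⟩)

theorem inner_eq_zero_of_mem_span {v : ι → H} {s : Set ι} {x y : H}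
    (h : ∀ i ∈ s, ⟪v i, x⟫ = 0) (hy : y ∈ Submodule.span ℂ (v '' s)) : ⟪y, x⟫ = 0 := by
  induction hy using Submodule.span_induction with
  | mem y hy => obtain ⟨i, hi, rfl⟩ := hy; exact h i hi
  | zero => exact inner_zero_left _
  | add a b _ _ ha hb => rw [inner_add_left, ha, hb, add_zero]
  | smul c a _ ha => rw [inner_smul_left, ha, mul_zero]

/-- The residual is characterised by lying in `x + span` and being orthogonal to the span. -/
theorem eq_spanResidual {v : ι → H} {s : Finset ι} {x r : H}
    (hmem : x - r ∈ Submodule.span ℂ (v '' (s : Set ι))) (h : ∀ i ∈ s, ⟪v i, r⟫ = 0) :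
    r = spanResidual v s x := by
  rw [spanResidual, Submodule.eq_starProjection_of_mem_of_inner_eq_zero hmem, sub_sub_cancel]
  intro w hw
  rw [sub_sub_cancel, ← inner_conj_symm, inner_eq_zero_of_mem_span h hw, map_zero]

theorem residual_ne_zero {v : ι → H} (hv : LinearIndependent ℂ v) {s : Finset ι} {j : ι}
    (hj : j ∉ s) : spanResidual v s (v j) ≠ 0 := by
  intro h
  have := sub_residual_mem v s (v j)
  rw [h, sub_zero] at this
  exact hv.notMem_span_image (by exact_mod_cast hj) this

variable [DecidableEq ι]

/-- One step of the Gram--Schmidt algorithm. -/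
theorem residual_insert {v : ι → H} {s : Finset ι} {j : ι} (hj : spanResidual v s (v j) ≠ 0)
    (x : H) :
    spanResidual v (insert j s) x = spanResidual v s x -
      (⟪spanResidual v s (v j), spanResidual v s x⟫ / (‖spanResidual v s (v j)‖ ^ 2 : ℝ)) •
        spanResidual v s (v j) := by
  have hsub : Submodule.span ℂ (v '' (s : Set ι)) ≤
      Submodule.span ℂ (v '' ((insert j s : Finset ι) : Set ι)) :=
    Submodule.span_mono (Set.image_mono (by simp))
  have hjmem : spanResidual v s (v j) ∈
      Submodule.span ℂ (v '' ((insert j s : Finset ι) : Set ι)) := by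
    have h1 := hsub (sub_residual_mem v s (v j))
    have h2 : v j ∈ Submodule.span ℂ (v '' ((insert j s : Finset ι) : Set ι)) :=
      Submodule.subset_span ⟨j, by simp, rfl⟩
    simpa using Submodule.sub_mem _ h2 h1
  symm
  apply eq_spanResidual
  · rw [sub_sub_eq_add_sub, add_sub_right_comm]
    exact Submodule.add_mem _ (hsub (sub_residual_mem v s x)) (Submodule.smul_mem _ _ hjmem)
  · intro i hi
    rcases Finset.mem_insert.1 hi with rfl | hi
    · have key : ∀ y, ⟪v i, spanResidual v s y⟫ = ⟪spanResidual v s (v i), spanResidual v s y⟫ := by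
        intro y
        have := inner_residual_of_mem_span y (sub_residual_mem v s (v i))
        rwa [inner_sub_left, sub_eq_zero] at this
      rw [inner_sub_right, inner_smul_right, key, key, inner_self_eq_norm_sq_to_K]
      have : (‖spanResidual v s (v i)‖ : ℂ) ≠ 0 := by simpa using hj
      simp only [Complex.ofReal_pow, Complex.coe_algebraMap]
      field_simp
      simp
    · rw [inner_sub_right, inner_smul_right, inner_residual _ hi, inner_residual _ hi]
      simp

theorem norm_sq_residual_insert {v : ι → H} {s : Finset ι} {j : ι}
    (hj : spanResidual v s (v j) ≠ 0) {x : H} (hx : spanResidual v s x ≠ 0) :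
    ‖spanResidual v (insert j s) x‖ ^ 2 = ‖spanResidual v s x‖ ^ 2 *
      (1 - ‖⟪spanResidual v s (v j), spanResidual v s x⟫ /
        ((‖spanResidual v s x‖ * ‖spanResidual v s (v j)‖ : ℝ) : ℂ)‖ ^ 2) := by
  have h := residual_insert hj x
  set a := spanResidual v s x
  set b := spanResidual v s (v j)
  have hb : ‖b‖ ≠ 0 := norm_ne_zero_iff.2 hj
  have ha : ‖a‖ ≠ 0 := norm_ne_zero_iff.2 hx
  rw [h, @norm_sub_sq ℂ, inner_smul_right, norm_smul, ← inner_conj_symm a b]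
  have : ⟪b, a⟫ / ((‖b‖ ^ 2 : ℝ) : ℂ) * conj ⟪b, a⟫ = ((‖⟪b, a⟫‖ ^ 2 / ‖b‖ ^ 2 : ℝ) : ℂ) := by
    rw [div_mul_eq_mul_div, Complex.mul_conj, Complex.normSq_eq_norm_sq]
    push_cast; rfl
  rw [this]
  simp only [RCLike.re_to_complex, Complex.ofReal_re, norm_div, Complex.norm_real, norm_mul,
    norm_pow, norm_norm]
  field_simp
  ring

end Residual

section Verblunsky

variable {ι H : Type*} [LinearOrder ι] [NormedAddCommGroup H] [InnerProductSpace ℂ H]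

local notation "⟪" x ", " y "⟫" => inner ℂ x y

/-- The Gram kernel of a family of vectors. -/
def gramKernel (v : ι → H) (i j : ι) : ℂ := ⟪v j, v i⟫

theorem isUnit_gramKernel {v : ι → H} (hv : LinearIndependent ℂ v) (s : Finset ι) :
    IsUnit (Matrix.of fun p q : s => gramKernel v p q) := by
  rw [← Matrix.vecMul_injective_iff_isUnit]
  refine (injective_iff_map_eq_zero (Matrix.vecMulLinear _)).2 fun c hc => ?_
  have hc' : ∀ q : s, ⟪v q, ∑ p : s, c p • v p⟫ = 0 := by
    intro q
    have := congrFun hc q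
    simpa [Matrix.vecMul, dotProduct, gramKernel, inner_sum, inner_smul_right] using this
  have h0 : ∑ p : s, c p • v p = 0 := by
    rw [← inner_self_eq_zero (𝕜 := ℂ)]
    rw [sum_inner]
    exact Finset.sum_eq_zero fun q _ => by rw [inner_smul_left, hc', mul_zero]
  exact funext (Fintype.linearIndependent_iff.1 (hv.comp _ Subtype.val_injective) c h0)

/-- The centre of the disc of admissible entries is an inner product of projections, so that
its difference with the actual entry is an inner product of residuals. -/
theorem gramKernel_sub_sum {v : ι → H} (hv : LinearIndependent ℂ v) (s : Finset ι) (k j : ι) :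
    gramKernel v k j - ∑ p : s, ∑ q : s, gramKernel v k p *
      (Matrix.of fun p q : s => gramKernel v p q)⁻¹ p q * gramKernel v q j =
      ⟪spanResidual v s (v j), spanResidual v s (v k)⟫ := by
  set A := Matrix.of fun p q : s => gramKernel v p q with hA
  have hunit : IsUnit A.det := (Matrix.isUnit_iff_isUnit_det _).1 (isUnit_gramKernel hv s)
  set c : s → ℂ := Matrix.vecMul (fun p : s => gramKernel v k p) A⁻¹ with hc
  have hcA : ∀ q : s, ∑ p : s, c p * gramKernel v p q = gramKernel v k q := by
    intro q
    have h : Matrix.vecMul c A = fun p : s => gramKernel v k p := by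
      rw [hc, Matrix.vecMul_vecMul, Matrix.nonsing_inv_mul _ hunit, Matrix.vecMul_one]
    exact congrFun h q
  have hr : v k - ∑ p : s, c p • v p = spanResidual v s (v k) := by
    apply eq_spanResidual
    · rw [sub_sub_cancel]
      exact Submodule.sum_mem _ fun p _ => Submodule.smul_mem _ _
        (Submodule.subset_span ⟨p, p.2, rfl⟩)
    · intro q hq
      rw [inner_sub_right, inner_sum, sub_eq_zero]
      simp_rw [inner_smul_right]
      exact (hcA ⟨q, hq⟩).symm
  have h1 : ⟪spanResidual v s (v j), spanResidual v s (v k)⟫ = ⟪v j, spanResidual v s (v k)⟫ := by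
    have := inner_residual_of_mem_span (v k) (sub_residual_mem v s (v j))
    rw [inner_sub_left, sub_eq_zero] at this
    exact this.symm
  rw [h1, ← hr, inner_sub_right, inner_sum]
  simp_rw [inner_smul_right]
  congr 1
  rw [Finset.sum_comm]
  refine Finset.sum_congr rfl fun q _ => ?_
  rw [← Finset.sum_mul]
  rfl

variable [LocallyFiniteOrder ι]

/-- The Verblunsky coefficient `γ_{k,j}` is the normalised inner product of the residuals of `v j`
and `v k` with respect to the vectors strictly between them, and the norms of these residuals are
the products in the recursion. For the norms, the vector of the window farthest from the endpoint is
adjoined to the others, which brings in the coefficient of a shorter window. -/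
theorem norm_residual_Ioo_and_verblunsky {v : ι → H} (hv : LinearIndependent ℂ v) :
    ∀ (n : ℕ) (k j : ι), k < j → (Finset.Ioo k j).card = n →
    ‖spanResidual v (Finset.Ioo k j) (v k)‖ =
      ‖v k‖ * ∏ p ∈ Finset.Ioo k j, √(1 - ‖verblunsky (gramKernel v) k p‖ ^ 2) ∧
    ‖spanResidual v (Finset.Ioo k j) (v j)‖ =
      ‖v j‖ * ∏ p ∈ Finset.Ioo k j, √(1 - ‖verblunsky (gramKernel v) p j‖ ^ 2) ∧
    verblunsky (gramKernel v) k j =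
      ⟪spanResidual v (Finset.Ioo k j) (v j), spanResidual v (Finset.Ioo k j) (v k)⟫ /
      ((‖spanResidual v (Finset.Ioo k j) (v k)‖ *
        ‖spanResidual v (Finset.Ioo k j) (v j)‖ : ℝ) : ℂ) := by
  intro n
  induction n using Nat.strong_induction_on with
  | _ n ih =>
  intro k j hkj hn
  have hres : ∀ {s : Finset ι} {i}, i ∉ s → spanResidual v s (v i) ≠ 0 := residual_ne_zero hv
  have hk : ‖spanResidual v (Finset.Ioo k j) (v k)‖ =
      ‖v k‖ * ∏ p ∈ Finset.Ioo k j, √(1 - ‖verblunsky (gramKernel v) k p‖ ^ 2) := by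
    rcases (Finset.Ioo k j).eq_empty_or_nonempty with he | hne
    · simp [he, spanResidual]
    · set m := (Finset.Ioo k j).max' hne
      have hm := Finset.mem_Ioo.1 ((Finset.Ioo k j).max'_mem hne)
      have hins : Finset.Ioo k j = insert m (Finset.Ioo k m) := by
        ext x
        simp only [Finset.mem_insert, Finset.mem_Ioo]
        constructor
        · intro hx
          rcases ((Finset.Ioo k j).le_max' x (Finset.mem_Ioo.2 hx)).lt_or_eq with h | h
          · exact Or.inr ⟨hx.1, h⟩
          · exact Or.inl h
        · rintro (rfl | hx)
          · exact hm
          · exact ⟨hx.1, hx.2.trans hm.2⟩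
      have hcard : (Finset.Ioo k m).card < n := by
        rw [← hn, hins, Finset.card_insert_of_notMem (by simp)]; exact Nat.lt_succ_self _
      obtain ⟨h1, -, h3⟩ := ih _ hcard k m hm.1 rfl
      rw [hins, Finset.prod_insert (by simp), ← Real.sqrt_sq (norm_nonneg (spanResidual _ _ _)),
        norm_sq_residual_insert (hres (by simp)) (hres (by simp)), ← h3,
        Real.sqrt_mul (sq_nonneg _), Real.sqrt_sq (norm_nonneg _), h1]
      ring
  have hj : ‖spanResidual v (Finset.Ioo k j) (v j)‖ =
      ‖v j‖ * ∏ p ∈ Finset.Ioo k j, √(1 - ‖verblunsky (gramKernel v) p j‖ ^ 2) := by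
    rcases (Finset.Ioo k j).eq_empty_or_nonempty with he | hne
    · simp [he, spanResidual]
    · set m := (Finset.Ioo k j).min' hne
      have hm := Finset.mem_Ioo.1 ((Finset.Ioo k j).min'_mem hne)
      have hins : Finset.Ioo k j = insert m (Finset.Ioo m j) := by
        ext x
        simp only [Finset.mem_insert, Finset.mem_Ioo]
        constructor
        · intro hx
          rcases ((Finset.Ioo k j).min'_le x (Finset.mem_Ioo.2 hx)).lt_or_eq with h | h
          · exact Or.inr ⟨h, hx.2⟩
          · exact Or.inl h.symm
        · rintro (rfl | hx)
          · exact hm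
          · exact ⟨hm.1.trans hx.1, hx.2⟩
      have hcard : (Finset.Ioo m j).card < n := by
        rw [← hn, hins, Finset.card_insert_of_notMem (by simp)]; exact Nat.lt_succ_self _
      obtain ⟨-, h2, h3⟩ := ih _ hcard m j hm.2 rfl
      have hsymm : ‖⟪spanResidual v (Finset.Ioo m j) (v m), spanResidual v (Finset.Ioo m j) (v j)⟫ /
          ((‖spanResidual v (Finset.Ioo m j) (v j)‖ *
            ‖spanResidual v (Finset.Ioo m j) (v m)‖ : ℝ) : ℂ)‖ =
          ‖verblunsky (gramKernel v) m j‖ := by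
        rw [h3, norm_div, norm_div, norm_inner_symm, mul_comm]
      rw [hins, Finset.prod_insert (by simp), ← Real.sqrt_sq (norm_nonneg (spanResidual _ _ _)),
        norm_sq_residual_insert (hres (by simp)) (hres (by simp)), hsymm,
        Real.sqrt_mul (sq_nonneg _), Real.sqrt_sq (norm_nonneg _), h2]
      ring
  refine ⟨hk, hj, ?_⟩
  have hnorm : ∀ i, √(gramKernel v i i).re = ‖v i‖ := by
    intro i
    rw [gramKernel, inner_self_eq_norm_sq_to_K]
    simp only [Complex.coe_algebraMap, ← Complex.ofReal_pow, Complex.ofReal_re]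
    exact Real.sqrt_sq (norm_nonneg _)
  rw [verblunsky, if_pos hkj, gramKernel_sub_sum hv, hk, hj, hnorm, hnorm,
    Finset.prod_coe_sort (Finset.Ioo k j) fun p => √(1 - ‖verblunsky (gramKernel v) k p‖ ^ 2),
    Finset.prod_coe_sort (Finset.Ioo k j) fun p => √(1 - ‖verblunsky (gramKernel v) p j‖ ^ 2)]
  congr 2
  ring

theorem norm_sq_residual_Ioc_Ico {v : ι → H} (hv : LinearIndependent ℂ v) {k j : ι} (hkj : k < j) :
    ‖spanResidual v (Finset.Ioc k j) (v k)‖ ^ 2 = ‖spanResidual v (Finset.Ioo k j) (v k)‖ ^ 2 *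
      (1 - ‖verblunsky (gramKernel v) k j‖ ^ 2) ∧
    ‖spanResidual v (Finset.Ico k j) (v j)‖ ^ 2 = ‖spanResidual v (Finset.Ioo k j) (v j)‖ ^ 2 *
      (1 - ‖verblunsky (gramKernel v) k j‖ ^ 2) := by
  obtain ⟨-, -, h⟩ := norm_residual_Ioo_and_verblunsky hv _ k j hkj rfl
  rw [← Finset.Ioo_insert_right hkj, ← Finset.Ioo_insert_left hkj,
    norm_sq_residual_insert (residual_ne_zero hv (by simp)) (residual_ne_zero hv (by simp)),
    norm_sq_residual_insert (residual_ne_zero hv (by simp)) (residual_ne_zero hv (by simp)), h]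
  refine ⟨rfl, ?_⟩
  rw [norm_div, norm_div, norm_inner_symm, mul_comm ‖spanResidual v (Finset.Ioo k j) (v k)‖]

/-- Verblunsky coefficients of linearly independent vectors lie in the open unit disc. -/
theorem norm_verblunsky_lt_one {v : ι → H} (hv : LinearIndependent ℂ v) (k j : ι) :
    0 < 1 - ‖verblunsky (gramKernel v) k j‖ ^ 2 := by
  by_cases hkj : k < j
  · have h := (norm_sq_residual_Ioc_Ico hv hkj).1
    have h1 : 0 < ‖spanResidual v (Finset.Ioc k j) (v k)‖ ^ 2 :=
      pow_pos (norm_pos_iff.2 (residual_ne_zero hv (by simp))) 2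
    rw [h] at h1
    exact pos_of_mul_pos_right h1 (sq_nonneg _)
  · rw [verblunsky, if_neg hkj]; simp

/-- The squared distance of `v k` to the span of the following vectors, up to `v j`. -/
theorem norm_sq_residual_Ioc {v : ι → H} (hv : LinearIndependent ℂ v) {k j : ι} (hkj : k ≤ j) :
    ‖spanResidual v (Finset.Ioc k j) (v k)‖ ^ 2 =
      ‖v k‖ ^ 2 * ∏ p ∈ Finset.Ioc k j, (1 - ‖verblunsky (gramKernel v) k p‖ ^ 2) := by
  rcases hkj.eq_or_lt with rfl | hkj
  · simp [spanResidual]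
  rw [(norm_sq_residual_Ioc_Ico hv hkj).1, (norm_residual_Ioo_and_verblunsky hv _ k j hkj rfl).1,
    ← Finset.Ioo_insert_right hkj, Finset.prod_insert (by simp), mul_pow, ← Finset.prod_pow]
  rw [Finset.prod_congr rfl fun p _ => Real.sq_sqrt (norm_verblunsky_lt_one hv k p).le]
  ring

/-- The squared distance of `v j` to the span of the preceding vectors, from `v k` on. -/
theorem norm_sq_residual_Ico {v : ι → H} (hv : LinearIndependent ℂ v) {k j : ι} (hkj : k ≤ j) :
    ‖spanResidual v (Finset.Ico k j) (v j)‖ ^ 2 =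
      ‖v j‖ ^ 2 * ∏ p ∈ Finset.Ico k j, (1 - ‖verblunsky (gramKernel v) p j‖ ^ 2) := by
  rcases hkj.eq_or_lt with rfl | hkj
  · simp [spanResidual]
  rw [(norm_sq_residual_Ioc_Ico hv hkj).2, (norm_residual_Ioo_and_verblunsky hv _ k j hkj rfl).2.1,
    ← Finset.Ioo_insert_left hkj, Finset.prod_insert (by simp), mul_pow, ← Finset.prod_pow]
  rw [Finset.prod_congr rfl fun p _ => Real.sq_sqrt (norm_verblunsky_lt_one hv p j).le]
  ring

end Verblunsky

/-! ### Polynomials as vectors in `L²` -/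

section PolyL2

variable {d : ℕ}

/-- The coordinate functions on the sphere. -/
def sphereCoord (d : ℕ) (i : Fin d) : C(CSphere d, ℂ) :=
  ⟨fun ζ => (ζ : EuclideanSpace ℂ (Fin d)) i, by fun_prop⟩

/-- The restriction of a polynomial to the sphere. -/
def polyRestrict (d : ℕ) : MvPolynomial (Fin d) ℂ →ₐ[ℂ] C(CSphere d, ℂ) :=
  MvPolynomial.aeval (sphereCoord d)

theorem polyRestrict_apply (p : MvPolynomial (Fin d) ℂ) (ζ : CSphere d) :
    polyRestrict d p ζ = polyEval (ζ : EuclideanSpace ℂ (Fin d)) p := by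
  induction p using MvPolynomial.induction_on with
  | C a => simp [polyRestrict, polyEval]
  | add p q hp hq => rw [map_add, ContinuousMap.add_apply, hp, hq]; simp [polyEval]
  | mul_X p i hp => rw [map_mul, ContinuousMap.mul_apply, hp]; simp [polyRestrict, polyEval,
      sphereCoord]

theorem continuous_polyEval_sphere (p : MvPolynomial (Fin d) ℂ) :
    Continuous fun ζ : CSphere d => polyEval (ζ : EuclideanSpace ℂ (Fin d)) p := by
  simp_rw [← polyRestrict_apply]
  exact (polyRestrict d p).continuous

/-- Evaluation of polynomials at a point, as a linear form. -/
def polyEvalₗ (z : EuclideanSpace ℂ (Fin d)) : MvPolynomial (Fin d) ℂ →ₗ[ℂ] ℂ :=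
  (MvPolynomial.aeval (R := ℂ) fun i => z i).toLinearMap

theorem polyEvalₗ_apply (z : EuclideanSpace ℂ (Fin d)) (p : MvPolynomial (Fin d) ℂ) :
    polyEvalₗ z p = polyEval z p := by
  simp [polyEvalₗ, polyEval, MvPolynomial.aeval_eq_eval]

theorem polyEval_sum (z : EuclideanSpace ℂ (Fin d)) {κ : Type*} (s : Finset κ)
    (p : κ → MvPolynomial (Fin d) ℂ) : polyEval z (∑ i ∈ s, p i) = ∑ i ∈ s, polyEval z (p i) := by
  simp [polyEval, map_sum]

theorem polyEval_C_mul (z : EuclideanSpace ℂ (Fin d)) (a : ℂ) (p : MvPolynomial (Fin d) ℂ) :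
    polyEval z (MvPolynomial.C a * p) = a * polyEval z p := by
  simp [polyEval]

theorem polyEval_zmonomial (z : EuclideanSpace ℂ (Fin d)) (α : MultiIndex d) :
    polyEval z (zmonomial α) = ∏ i, z i ^ α.exp i := by
  simp [polyEval, zmonomial, MvPolynomial.eval_monomial, Finsupp.prod_fintype]

theorem zmonomial_zero : zmonomial (0 : MultiIndex d) = 1 := rfl

theorem MultiIndex.exp_eq_zero_iff {α : MultiIndex d} : α.exp = 0 ↔ α = 0 :=
  ⟨fun h => MultiIndex.ext h, fun h => h ▸ rfl⟩

theorem polyEval_zero_zmonomial {α : MultiIndex d} (hα : α ≠ 0) :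
    polyEval 0 (zmonomial α) = 0 := by
  rw [polyEval_zmonomial]
  obtain ⟨i, hi⟩ : ∃ i, α.exp i ≠ 0 := by
    by_contra! h
    exact hα (MultiIndex.exp_eq_zero_iff.1 (Finsupp.ext h))
  exact Finset.prod_eq_zero (Finset.mem_univ i) (by simp [hi])

variable (ν : Measure (CSphere d)) [IsFiniteMeasure ν]

/-- The class in `L²(ν)` of a polynomial. -/
def polyL2 : MvPolynomial (Fin d) ℂ →ₗ[ℂ] Lp ℂ 2 ν :=
  (ContinuousMap.toLp 2 ν ℂ).toLinearMap ∘ₗ (polyRestrict d).toLinearMap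

/-- The class in `L²(ν)` of a monomial. -/
def monoL2 (α : MultiIndex d) : Lp ℂ 2 ν := polyL2 ν (zmonomial α)

local notation "⟪" x ", " y "⟫" => inner ℂ x y

theorem inner_polyL2 (p q : MvPolynomial (Fin d) ℂ) :
    ⟪polyL2 ν q, polyL2 ν p⟫ = polyInner ν p q := by
  simp only [polyL2, LinearMap.comp_apply, ContinuousLinearMap.coe_coe, AlgHom.toLinearMap_apply]
  rw [ContinuousMap.inner_toLp]
  simp only [polyRestrict_apply, polyInner]

theorem inner_self_eq_ofReal {H : Type*} [NormedAddCommGroup H] [InnerProductSpace ℂ H] (x : H) :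
    ⟪x, x⟫ = ((‖x‖ ^ 2 : ℝ) : ℂ) := by
  rw [inner_self_eq_norm_sq_to_K]; push_cast; rfl

theorem norm_sq_polyL2 (p : MvPolynomial (Fin d) ℂ) : ‖polyL2 ν p‖ ^ 2 = polyNormSq ν p := by
  have h := inner_polyL2 ν p p
  rw [inner_self_eq_ofReal] at h
  have h2 : polyInner ν p p = (polyNormSq ν p : ℂ) := by
    rw [polyInner, polyNormSq, ← integral_complex_ofReal]
    congr 1
    ext ζ
    rw [Complex.mul_conj, Complex.normSq_eq_norm_sq]
  rw [h2] at h
  exact Complex.ofReal_injective h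

theorem momentKernel_eq_gramKernel : momentKernel ν = gramKernel (monoL2 ν) := by
  ext α β
  rw [gramKernel, monoL2, monoL2, inner_polyL2, polyInner, momentKernel]
  congr 1
  ext ζ
  rw [polyEval_zmonomial, polyEval_zmonomial, map_prod]
  simp_rw [map_pow]

theorem norm_sq_monoL2_zero [IsProbabilityMeasure ν] : ‖monoL2 ν 0‖ ^ 2 = 1 := by
  rw [monoL2, norm_sq_polyL2, polyNormSq, zmonomial_zero]
  simp [polyEval]

variable {ν}

theorem linearIndependent_monoL2 (h : IsNontrivialMeasure ν) :
    LinearIndependent ℂ (monoL2 ν) := by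
  rw [linearIndependent_iff']
  intro s g hg i hi
  set α := s.sup id
  have hs : ∀ j ∈ s, j ≤ α := fun j hj => Finset.le_sup (f := id) hj
  classical
  set c : Finset.Iic α → ℂ := fun j => if (j : MultiIndex d) ∈ s then g j else 0
  have hsum : ∑ j : Finset.Iic α, c j • monoL2 ν j = 0 := by
    rw [Finset.sum_coe_sort (Finset.Iic α)
      (fun j => (if (j : MultiIndex d) ∈ s then g j else 0) • monoL2 ν j), ← hg]
    simp_rw [ite_smul, zero_smul]
    rw [← Finset.sum_filter]
    congr 1
    ext j
    simp only [Finset.mem_filter, Finset.mem_Iic, and_iff_right_iff_imp]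
    exact hs j
  have hvec : Matrix.vecMul c (momentMatrix ν α) = 0 := by
    ext q
    have := congrArg (fun x => ⟪monoL2 ν q, x⟫) hsum
    simp only [inner_sum, inner_smul_right, inner_zero_right] at this
    simpa [Matrix.vecMul, dotProduct, momentMatrix, momentKernel_eq_gramKernel, gramKernel]
      using this
  have hc : c = 0 := by
    apply Matrix.vecMul_injective_iff_isUnit.2 (h α)
    simpa using hvec
  simpa [c, hi] using congrFun hc ⟨i, Finset.mem_Iic.2 (hs i hi)⟩

theorem isNontrivialMeasure_of_linearIndependent (h : LinearIndependent ℂ (monoL2 ν)) :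
    IsNontrivialMeasure ν := by
  intro α
  rw [momentMatrix, momentKernel_eq_gramKernel]
  exact isUnit_gramKernel h _

theorem linearIndependent_zmonomial : LinearIndependent ℂ (zmonomial (d := d)) := by
  have h := (MvPolynomial.basisMonomials (Fin d) ℂ).linearIndependent.comp
    (MultiIndex.exp (d := d)) (fun _ _ h => MultiIndex.ext h)
  exact h

/-- If polynomials are determined by their classes in `L²(ν)`, then `ν` is non-trivial. -/
theorem isNontrivialMeasure_of_forall_ae_eq_zero
    (h : ∀ p : MvPolynomial (Fin d) ℂ,
      (∀ᵐ ζ : CSphere d ∂ν, polyEval (ζ : EuclideanSpace ℂ (Fin d)) p = 0) → p = 0) :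
    IsNontrivialMeasure ν := by
  apply isNontrivialMeasure_of_linearIndependent
  refine linearIndependent_zmonomial.map' (polyL2 ν) (LinearMap.ker_eq_bot'.2 fun p hp => h p ?_)
  have h1 : polyNormSq ν p = 0 := by rw [← norm_sq_polyL2, hp]; simp
  rw [polyNormSq, integral_eq_zero_iff_of_nonneg (fun _ => by positivity)] at h1
  · filter_upwards [h1] with ζ hζ
    simpa using hζ
  · exact ((continuous_polyEval_sphere p).norm.pow 2).integrable_of_hasCompactSupport
      (HasCompactSupport.of_compactSpace _)

/-! ### Orthogonal polynomials -/

theorem C_mul_eq_smul (a : ℂ) (p : MvPolynomial (Fin d) ℂ) : MvPolynomial.C a * p = a • p :=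
  (MvPolynomial.smul_eq_C_mul p a).symm

theorem polyL2_monicPoly_eq_gramSchmidt (α : MultiIndex d) :
    polyL2 ν (monicPoly ν α) = InnerProductSpace.gramSchmidt ℂ (monoL2 ν) α := by
  induction α using WellFoundedLT.induction with
  | ind α ih =>
  rw [monicPoly, InnerProductSpace.gramSchmidt_def, map_sub, map_sum]
  congr 1
  rw [← Finset.sum_coe_sort (Finset.Iio α)]
  refine Finset.sum_congr rfl fun β _ => ?_
  rw [C_mul_eq_smul, map_smul, ← inner_polyL2, ← inner_polyL2,
    ih β (Finset.mem_Iio.1 β.2), Submodule.starProjection_singleton, monoL2,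
    inner_self_eq_norm_sq_to_K]
  simp

theorem polyL2_monicPoly (α : MultiIndex d) :
    polyL2 ν (monicPoly ν α) = spanResidual (monoL2 ν) (Finset.Iio α) (monoL2 ν α) := by
  rw [polyL2_monicPoly_eq_gramSchmidt]
  apply eq_spanResidual
  · rw [Finset.coe_Iio, ← InnerProductSpace.span_gramSchmidt_Iio ℂ,
      InnerProductSpace.gramSchmidt_def, sub_sub_cancel]
    refine Submodule.sum_mem _ fun β hβ => ?_
    rw [Submodule.starProjection_singleton]
    exact Submodule.smul_mem _ _ (Submodule.subset_span ⟨β, Finset.mem_Iio.1 hβ, rfl⟩)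
  · intro β hβ
    rw [← inner_conj_symm, InnerProductSpace.gramSchmidt_inv_triangular _ _ (Finset.mem_Iio.1 hβ),
      map_zero]

theorem inner_polyL2_monicPoly_of_ne {α β : MultiIndex d} (h : α ≠ β) :
    ⟪polyL2 ν (monicPoly ν α), polyL2 ν (monicPoly ν β)⟫ = 0 := by
  rw [polyL2_monicPoly_eq_gramSchmidt, polyL2_monicPoly_eq_gramSchmidt]
  exact InnerProductSpace.gramSchmidt_orthogonal _ _ h

variable (ν) in
omit [IsFiniteMeasure ν] in
theorem monicPoly_sub_zmonomial_mem (α : MultiIndex d) :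
    monicPoly ν α - zmonomial α ∈ Submodule.span ℂ (zmonomial '' Set.Iio α) := by
  induction α using WellFoundedLT.induction with
  | ind α ih =>
  rw [monicPoly, sub_sub_cancel_left]
  refine Submodule.neg_mem _ (Submodule.sum_mem _ fun β _ => ?_)
  have hβ := Finset.mem_Iio.1 β.2
  rw [C_mul_eq_smul]
  refine Submodule.smul_mem _ _ ?_
  rw [← sub_add_cancel (monicPoly ν β) (zmonomial β)]
  exact Submodule.add_mem _ (Submodule.span_mono (Set.image_mono (Set.Iio_subset_Iio hβ.le))
    (ih β hβ)) (Submodule.subset_span ⟨β, hβ, rfl⟩)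

theorem coeff_zmonomial (α β : MultiIndex d) :
    (zmonomial α).coeff β.exp = if α = β then 1 else 0 := by
  classical
  rw [zmonomial, MvPolynomial.coeff_monomial]
  exact if_congr ⟨fun h => MultiIndex.ext h, fun h => h ▸ rfl⟩ rfl rfl

theorem coeff_eq_zero_of_mem_span {s : Set (MultiIndex d)} {p : MvPolynomial (Fin d) ℂ}
    (hp : p ∈ Submodule.span ℂ (zmonomial '' s)) {β : MultiIndex d} (hβ : β ∉ s) :
    p.coeff β.exp = 0 := by
  induction hp using Submodule.span_induction with
  | mem p hp =>
    obtain ⟨α, hα, rfl⟩ := hp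
    rw [coeff_zmonomial, if_neg]
    rintro rfl
    exact hβ hα
  | zero => simp
  | add p q _ _ hp hq => simp [hp, hq]
  | smul c p _ hp => simp [hp]

variable (ν) in
omit [IsFiniteMeasure ν] in
theorem coeff_monicPoly_of_le {α β : MultiIndex d} (h : α ≤ β) :
    (monicPoly ν α).coeff β.exp = if α = β then 1 else 0 := by
  have h1 := coeff_eq_zero_of_mem_span (monicPoly_sub_zmonomial_mem ν α) (β := β) (by simpa using h)
  rwa [MvPolynomial.coeff_sub, sub_eq_zero, coeff_zmonomial] at h1

theorem eq_sum_coeff_of_mem_polysUpTo {N : MultiIndex d} {p : MvPolynomial (Fin d) ℂ}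
    (hp : p ∈ polysUpTo N) :
    p = ∑ β : Finset.Iic N, p.coeff (β : MultiIndex d).exp • zmonomial β := by
  rw [Finset.sum_coe_sort (Finset.Iic N) fun β => p.coeff β.exp • zmonomial β]
  induction hp using Submodule.span_induction with
  | mem p hp =>
    obtain ⟨α, hα, rfl⟩ := hp
    simp only [coeff_zmonomial, ite_smul, zero_smul, one_smul]
    rw [Finset.sum_ite_eq, if_pos (Finset.mem_Iic.2 hα)]
  | zero => simp
  | add p q _ _ hp hq =>
    simp only [MvPolynomial.coeff_add, add_smul, Finset.sum_add_distrib]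
    rw [← hp, ← hq]
  | smul c p _ hp =>
    simp only [MvPolynomial.coeff_smul, smul_assoc]
    rw [← Finset.smul_sum, ← hp]

variable (ν) in
omit [IsFiniteMeasure ν] in
theorem monicPoly_mem_polysUpTo {α N : MultiIndex d} (h : α ≤ N) : monicPoly ν α ∈ polysUpTo N := by
  rw [← sub_add_cancel (monicPoly ν α) (zmonomial α)]
  exact Submodule.add_mem _
    (Submodule.span_mono (Set.image_mono fun β hβ => le_trans (le_of_lt hβ) h)
    (monicPoly_sub_zmonomial_mem ν α)) (Submodule.subset_span ⟨α, h, rfl⟩)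

theorem polyNormSq_monicPoly_pos (hv : LinearIndependent ℂ (monoL2 ν)) (α : MultiIndex d) :
    0 < polyNormSq ν (monicPoly ν α) := by
  rw [← norm_sq_polyL2, polyL2_monicPoly]
  exact pow_pos (norm_pos_iff.2 (residual_ne_zero hv (by simp))) 2

theorem inner_orthoPoly (hv : LinearIndependent ℂ (monoL2 ν)) (α β : MultiIndex d) :
    ⟪polyL2 ν (orthoPoly ν α), polyL2 ν (orthoPoly ν β)⟫ = if α = β then 1 else 0 := by
  rw [orthoPoly, orthoPoly, C_mul_eq_smul, C_mul_eq_smul, map_smul, map_smul, inner_smul_left,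
    inner_smul_right]
  split_ifs with h
  · subst h
    have h0 := polyNormSq_monicPoly_pos hv α
    rw [inner_self_eq_norm_sq_to_K]
    have h2 : (‖polyL2 ν (monicPoly ν α)‖ : ℂ) ^ 2 = (polyNormSq ν (monicPoly ν α) : ℂ) := by
      rw [← norm_sq_polyL2]; push_cast; rfl
    simp only [Complex.coe_algebraMap, Complex.conj_ofReal]
    rw [h2]
    norm_cast
    rw [← mul_assoc, ← mul_inv, Real.mul_self_sqrt h0.le, inv_mul_cancel₀ h0.ne']
  · rw [inner_polyL2_monicPoly_of_ne h]; simp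

theorem monicPoly_eq_smul_orthoPoly (hv : LinearIndependent ℂ (monoL2 ν)) (α : MultiIndex d) :
    monicPoly ν α = ((√(polyNormSq ν (monicPoly ν α)) : ℝ) : ℂ) • orthoPoly ν α := by
  have h0 := (Real.sqrt_pos.2 (polyNormSq_monicPoly_pos hv α)).ne'
  rw [orthoPoly, C_mul_eq_smul, smul_smul, ← Complex.ofReal_mul, mul_inv_cancel₀ h0]
  simp

omit [IsFiniteMeasure ν] in
theorem orthoPoly_mem_polysUpTo {α N : MultiIndex d} (h : α ≤ N) : orthoPoly ν α ∈ polysUpTo N := by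
  rw [orthoPoly, C_mul_eq_smul]
  exact Submodule.smul_mem _ _ (monicPoly_mem_polysUpTo ν h)

/-- The Fourier expansion of a polynomial in the orthonormal polynomials. -/
theorem eq_sum_inner_smul_orthoPoly (hv : LinearIndependent ℂ (monoL2 ν)) {N : MultiIndex d}
    {q : MvPolynomial (Fin d) ℂ} (hq : q ∈ polysUpTo N) :
    q = ∑ α ∈ Finset.Iic N, ⟪polyL2 ν (orthoPoly ν α), polyL2 ν q⟫ • orthoPoly ν α := by
  have hmem : q ∈ Submodule.span ℂ (orthoPoly ν '' Set.Iic N) := by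
    refine Submodule.span_le.2 ?_ hq
    rintro _ ⟨α, hα, rfl⟩
    have hmonic : ∀ β ≤ N, monicPoly ν β ∈ Submodule.span ℂ (orthoPoly ν '' Set.Iic N) := by
      intro β hβ
      rw [monicPoly_eq_smul_orthoPoly hv]
      exact Submodule.smul_mem _ _ (Submodule.subset_span ⟨β, hβ, rfl⟩)
    have h1 := hmonic α hα
    rw [monicPoly] at h1
    have h2 := Submodule.add_mem _ h1 (Submodule.sum_mem _ (t := Finset.univ)
      fun (β : Finset.Iio α) _ => Submodule.smul_mem _
        (polyInner ν (zmonomial α) (monicPoly ν β) / polyInner ν (monicPoly ν β) (monicPoly ν β))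
        (hmonic β ((Finset.mem_Iio.1 β.2).le.trans hα)))
    simp only [C_mul_eq_smul, sub_add_cancel] at h2
    exact h2
  induction hmem using Submodule.span_induction with
  | mem p hp =>
    obtain ⟨α, hα, rfl⟩ := hp
    simp only [inner_orthoPoly hv, ite_smul, zero_smul, one_smul]
    rw [Finset.sum_ite_eq', if_pos (Finset.mem_Iic.2 hα)]
  | zero => simp
  | add p q hp' hq' hp hq2 =>
    have hle : Submodule.span ℂ (orthoPoly ν '' Set.Iic N) ≤ polysUpTo N :=
      Submodule.span_le.2 (by rintro _ ⟨α, hα, rfl⟩; exact orthoPoly_mem_polysUpTo hα)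
    simp only [map_add, inner_add_right, add_smul, Finset.sum_add_distrib]
    rw [← hp (hle hp'), ← hq2 (hle hq')]
  | smul c p hp' hp =>
    have hle : Submodule.span ℂ (orthoPoly ν '' Set.Iic N) ≤ polysUpTo N :=
      Submodule.span_le.2 (by rintro _ ⟨α, hα, rfl⟩; exact orthoPoly_mem_polysUpTo hα)
    simp only [map_smul, inner_smul_right, mul_smul]
    rw [← Finset.smul_sum, ← hp (hle hp')]

/-! ### The Christoffel extremal problem -/

theorem one_mem_polysUpTo (N : MultiIndex d) : (1 : MvPolynomial (Fin d) ℂ) ∈ polysUpTo N :=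
  Submodule.subset_span ⟨0, (bot_le : (⊥ : MultiIndex d) ≤ N), zmonomial_zero⟩

variable (ν) in
/-- The value `K_N(z, z) = ∑_{α ⪯ N} |φ_α(z)|²` of the Christoffel--Darboux kernel. -/
def christoffelSum (N : MultiIndex d) (z : EuclideanSpace ℂ (Fin d)) : ℝ :=
  ∑ α ∈ Finset.Iic N, ‖polyEval z (orthoPoly ν α)‖ ^ 2

theorem polyEval_eq_sum (hv : LinearIndependent ℂ (monoL2 ν)) {N : MultiIndex d}
    {q : MvPolynomial (Fin d) ℂ} (hq : q ∈ polysUpTo N) (z : EuclideanSpace ℂ (Fin d)) :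
    polyEval z q = ∑ α ∈ Finset.Iic N, ⟪polyL2 ν (orthoPoly ν α), polyL2 ν q⟫ *
      polyEval z (orthoPoly ν α) := by
  conv_lhs => rw [eq_sum_inner_smul_orthoPoly hv hq]
  simp only [← polyEvalₗ_apply, map_sum, map_smul, smul_eq_mul]

theorem christoffelSum_pos (hv : LinearIndependent ℂ (monoL2 ν)) (N : MultiIndex d)
    (z : EuclideanSpace ℂ (Fin d)) : 0 < christoffelSum ν N z := by
  have hnn : 0 ≤ christoffelSum ν N z := Finset.sum_nonneg fun _ _ => by positivity
  refine hnn.lt_of_ne fun h0 => ?_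
  have h := polyEval_eq_sum hv (one_mem_polysUpTo N) z
  rw [Finset.sum_eq_zero] at h
  · simp [polyEval] at h
  · intro α hα
    have := (Finset.sum_eq_zero_iff_of_nonneg fun _ _ => by positivity).1 h0.symm α hα
    have : polyEval z (orthoPoly ν α) = 0 := by simpa using this
    rw [this, mul_zero]

/-- The extremal polynomial: a multiple of the Christoffel--Darboux kernel, which reproduces the
value at `z`. -/
theorem exists_reproducing (hv : LinearIndependent ℂ (monoL2 ν)) (N : MultiIndex d)
    (z : EuclideanSpace ℂ (Fin d)) : ∃ P ∈ polysUpTo N, polyEval z P = 1 ∧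
      ∀ q ∈ polysUpTo N,
        ⟪polyL2 ν P, polyL2 ν q⟫ = ((christoffelSum ν N z)⁻¹ : ℝ) * polyEval z q := by
  have hS := christoffelSum_pos hv N z
  refine ⟨∑ α ∈ Finset.Iic N, (((christoffelSum ν N z)⁻¹ : ℝ) * conj (polyEval z (orthoPoly ν α))) •
    orthoPoly ν α, Submodule.sum_mem _ fun α hα => Submodule.smul_mem _ _
      (orthoPoly_mem_polysUpTo (Finset.mem_Iic.1 hα)), ?_, fun q hq => ?_⟩
  · simp only [← polyEvalₗ_apply, map_sum, map_smul, smul_eq_mul]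
    have : ∀ α, (((christoffelSum ν N z)⁻¹ : ℝ) : ℂ) * conj (polyEvalₗ z (orthoPoly ν α)) *
        polyEvalₗ z (orthoPoly ν α) =
        (((christoffelSum ν N z)⁻¹ * ‖polyEval z (orthoPoly ν α)‖ ^ 2 : ℝ) : ℂ) := by
      intro α
      rw [mul_assoc, mul_comm (conj _), Complex.mul_conj, Complex.normSq_eq_norm_sq,
        polyEvalₗ_apply]
      push_cast; rfl
    simp_rw [this]
    rw [← Complex.ofReal_sum, ← Finset.mul_sum, ← christoffelSum, inv_mul_cancel₀ hS.ne']
    simp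
  · rw [polyEval_eq_sum hv hq z, map_sum, sum_inner, Finset.mul_sum]
    refine Finset.sum_congr rfl fun α _ => ?_
    rw [map_smul, inner_smul_left, map_mul, Complex.conj_ofReal, Complex.conj_conj]
    ring

/-- Pythagoras: a reproducing polynomial is orthogonal to its differences from other competitors. -/
theorem norm_sq_eq_of_reproducing {N : MultiIndex d} {z : EuclideanSpace ℂ (Fin d)} {l : ℝ}
    {P : MvPolynomial (Fin d) ℂ} (hP : P ∈ polysUpTo N) (hP1 : polyEval z P = 1)
    (h : ∀ q ∈ polysUpTo N, ⟪polyL2 ν P, polyL2 ν q⟫ = (l : ℂ) * polyEval z q)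
    {q : MvPolynomial (Fin d) ℂ} (hq : q ∈ polysUpTo N) (hq1 : polyEval z q = 1) :
    polyNormSq ν q = l + ‖polyL2 ν (q - P)‖ ^ 2 := by
  have hPP : ‖polyL2 ν P‖ ^ 2 = l := by
    have := h P hP
    rw [inner_self_eq_ofReal, hP1, mul_one] at this
    exact Complex.ofReal_injective this
  rw [map_sub, @norm_sub_sq ℂ, ← inner_conj_symm, h q hq, hq1, hPP, norm_sq_polyL2]
  simp
  ring

/-- The extremal problem has a unique solution, and its value is `1 / K_N(z, z)`. -/
theorem existsUnique_minimizer (hv : LinearIndependent ℂ (monoL2 ν)) (n : ℕ)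
    (z : EuclideanSpace ℂ (Fin d)) : ∃! P, IsChristoffelMinimizer ν n z P := by
  obtain ⟨P, hP, hP1, h⟩ := exists_reproducing hv (MultiIndex.last d n) z
  refine ⟨P, ⟨hP, hP1, fun q hq hq1 => ?_⟩, fun Q hQ => ?_⟩
  · rw [norm_sq_eq_of_reproducing hP hP1 h hq hq1, norm_sq_eq_of_reproducing hP hP1 h hP hP1,
      sub_self, map_zero, norm_zero]
    simp only [ne_eq, OfNat.ofNat_ne_zero, not_false_eq_true, zero_pow, add_zero]
    exact le_add_of_nonneg_right (sq_nonneg _)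
  · have h1 := hQ.2.2 P hP hP1
    rw [norm_sq_eq_of_reproducing hP hP1 h hQ.1 hQ.2.1, norm_sq_eq_of_reproducing hP hP1 h hP hP1,
      sub_self, map_zero, norm_zero] at h1
    have h2 : polyL2 ν (Q - P) = 0 := by
      rw [← norm_eq_zero, ← sq_eq_zero_iff]
      exact le_antisymm (by simpa using h1) (sq_nonneg _)
    have h3 := eq_sum_inner_smul_orthoPoly hv (Submodule.sub_mem _ hQ.1 hP)
    rw [h2] at h3
    simpa [sub_eq_zero] using h3

theorem polyNormSq_minimizer (hv : LinearIndependent ℂ (monoL2 ν)) {n : ℕ}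
    {z : EuclideanSpace ℂ (Fin d)} {P : MvPolynomial (Fin d) ℂ}
    (hP : IsChristoffelMinimizer ν n z P) : polyNormSq ν P = christoffelApprox ν n z := by
  obtain ⟨Q, hQ, hQ1, h⟩ := exists_reproducing hv (MultiIndex.last d n) z
  have h1 := hP.2.2 Q hQ hQ1
  rw [norm_sq_eq_of_reproducing hQ hQ1 h hP.1 hP.2.1, norm_sq_eq_of_reproducing hQ hQ1 h hQ hQ1,
      sub_self, map_zero, norm_zero] at h1
  rw [norm_sq_eq_of_reproducing hQ hQ1 h hP.1 hP.2.1, christoffelApprox, christoffelSum]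
  have := sq_nonneg ‖polyL2 ν (P - Q)‖
  linarith

theorem sub_C_polyEval_zero_mem {N : MultiIndex d} {q : MvPolynomial (Fin d) ℂ}
    (hq : q ∈ polysUpTo N) :
    q - polyEval 0 q • (1 : MvPolynomial (Fin d) ℂ) ∈
      Submodule.span ℂ (zmonomial '' Set.Ioc 0 N) := by
  induction hq using Submodule.span_induction with
  | mem p hp =>
    obtain ⟨α, hα, rfl⟩ := hp
    by_cases h : α = 0
    · rw [h, zmonomial_zero]; simp [polyEval]
    · rw [polyEval_zero_zmonomial h, zero_smul, sub_zero]
      exact Submodule.subset_span ⟨α, ⟨bot_lt_iff_ne_bot.2 h, hα⟩, rfl⟩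
  | zero => simp [polyEval]
  | add p q _ _ hp hq =>
    convert Submodule.add_mem _ hp hq using 1
    simp only [← polyEvalₗ_apply, map_add, add_smul]; abel
  | smul c p _ hp =>
    convert Submodule.smul_mem _ c hp using 1
    simp only [← polyEvalₗ_apply, map_smul, smul_sub, smul_assoc]

theorem map_polyL2_span (s : Set (MultiIndex d)) {p : MvPolynomial (Fin d) ℂ}
    (hp : p ∈ Submodule.span ℂ (zmonomial '' s)) :
    polyL2 ν p ∈ Submodule.span ℂ (monoL2 ν '' s) := by
  have := Submodule.mem_map_of_mem (f := polyL2 ν) hp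
  rwa [Submodule.map_span, Set.image_image] at this

/-- The extremal value at the origin is a squared distance, hence a product of factors
`1 - |γ_{0,α}|²`. -/
theorem inv_christoffelSum_zero (hv : LinearIndependent ℂ (monoL2 ν)) [IsProbabilityMeasure ν]
    (N : MultiIndex d) : (christoffelSum ν N 0)⁻¹ =
      ∏ α ∈ Finset.Iic N, (1 - ‖verblunskyCoeff ν 0 α‖ ^ 2) := by
  obtain ⟨P, hP, hP1, h⟩ := exists_reproducing hv N 0
  have hres : polyL2 ν P = spanResidual (monoL2 ν) (Finset.Ioc 0 N) (monoL2 ν 0) := by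
    apply eq_spanResidual
    · have := map_polyL2_span (ν := ν) _ (sub_C_polyEval_zero_mem hP)
      rw [hP1, one_smul, ← zmonomial_zero] at this
      rw [← neg_sub, Finset.coe_Ioc, monoL2, ← map_sub]
      exact Submodule.neg_mem _ this
    · intro α hα
      have hα := Finset.mem_Ioc.1 hα
      rw [← inner_conj_symm, monoL2, h _ (Submodule.subset_span ⟨α, hα.2, rfl⟩),
        polyEval_zero_zmonomial hα.1.ne', mul_zero, map_zero]
  have hPP : ‖polyL2 ν P‖ ^ 2 = (christoffelSum ν N 0)⁻¹ := by
    have := h P hP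
    rw [inner_self_eq_ofReal, hP1, mul_one] at this
    exact Complex.ofReal_injective this
  have h0 : (0 : MultiIndex d) ≤ N := (bot_le : (⊥ : MultiIndex d) ≤ N)
  have hI : Finset.Iic N = insert 0 (Finset.Ioc 0 N) := by
    ext β
    simp only [Finset.mem_Iic, Finset.mem_insert, Finset.mem_Ioc]
    constructor
    · intro hβ
      rcases (bot_le : (⊥ : MultiIndex d) ≤ β).eq_or_lt with h | h
      · exact Or.inl h.symm
      · exact Or.inr ⟨h, hβ⟩
    · rintro (rfl | hβ)
      · exact h0
      · exact hβ.2
  rw [← hPP, hres, norm_sq_residual_Ioc hv h0, norm_sq_monoL2_zero, one_mul, hI,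
    Finset.prod_insert (by simp)]
  have : verblunskyCoeff ν 0 0 = 0 := by rw [verblunskyCoeff, verblunsky, if_neg (lt_irrefl _)]
  rw [this]
  simp [verblunskyCoeff, momentKernel_eq_gramKernel]

end PolyL2

/-! ### Moment determinants and Cholesky factors -/

section Cholesky

open scoped ComplexOrder

/-- A positive definite matrix has a factorisation `G* G` with `G` lower triangular: conjugate the
inverse matrix to a diagonal one by the `LDL` decomposition, and rotate the phases of the rows. -/
theorem exists_isLowerCholesky {n : Type*} [Fintype n] [LinearOrder n] {A : Matrix n n ℂ}
    (hA : A.PosDef) : ∃ G, IsLowerCholesky A G := by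
  classical
  let : LocallyFiniteOrderBot n :=
    { finsetIio := fun a => Finset.univ.filter (· < a)
      finsetIic := fun a => Finset.univ.filter (· ≤ a)
      finset_mem_Iic := by simp
      finset_mem_Iio := by simp }
  have hS : A⁻¹.PosDef := hA.inv
  set L := LDL.lowerInv hS with hL
  have hLu : IsUnit L := isUnit_of_invertible L
  have hLdet : IsUnit L.det := (Matrix.isUnit_iff_isUnit_det _).1 hLu
  have hAdet : IsUnit A.det := (Matrix.isUnit_iff_isUnit_det _).1 hA.isUnit
  set e := LDL.diagEntries hS with he
  have hD : Matrix.diagonal e = L * A⁻¹ * L.conjTranspose := LDL.diag_eq_lowerInv_conj hS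
  have hDpos : (Matrix.diagonal e).PosDef := by
    rw [hD]
    exact hS.mul_mul_conjTranspose_same (Matrix.vecMul_injective_iff_isUnit.2 hLu)
  have hepos : ∀ i, 0 < e i := Matrix.posDef_diagonal_iff.1 hDpos
  have hLtri : ∀ i j, i < j → L i j = 0 := fun i j hij => LDL.lowerInv_triangular hS hij
  have hLdiag : ∀ i, L i i ≠ 0 := by
    have h1 : L.det = ∏ i, L i i := Matrix.det_of_isLowerTriangular L fun i j hij => hLtri i j hij
    have h2 := hLdet.ne_zero
    rw [h1] at h2
    exact fun i => Finset.prod_ne_zero_iff.1 h2 i (Finset.mem_univ i)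
  have hAeq : A = L.conjTranspose * Matrix.diagonal (fun i => (e i)⁻¹) * L := by
    have hinv : Matrix.diagonal (fun i => (e i)⁻¹) * Matrix.diagonal e = 1 := by
      rw [Matrix.diagonal_mul_diagonal, ← Matrix.diagonal_one]
      congr 1
      ext i
      exact inv_mul_cancel₀ (hepos i).ne'
    have h1 : Matrix.diagonal (fun i => (e i)⁻¹) * L * A⁻¹ * L.conjTranspose = 1 := by
      rw [Matrix.mul_assoc, Matrix.mul_assoc, ← Matrix.mul_assoc L, ← hD, hinv]
    have h2 := mul_eq_one_comm.1 h1
    rw [← Matrix.mul_assoc] at h2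
    have h3 : L.conjTranspose * (Matrix.diagonal fun i => (e i)⁻¹) * L * A⁻¹ = 1 := by
      simpa only [Matrix.mul_assoc] using h2
    calc A = (L.conjTranspose * (Matrix.diagonal fun i => (e i)⁻¹) * L * A⁻¹) * A := by
          rw [h3, Matrix.one_mul]
      _ = _ := by rw [Matrix.mul_assoc, Matrix.nonsing_inv_mul _ hAdet, Matrix.mul_one]
  -- the multiplier of the row `i`: it scales by `1 / √e i` and makes the diagonal entry positive
  set u : n → ℂ := fun i => ((√(e i).re)⁻¹ : ℝ) * (conj (L i i) / (‖L i i‖ : ℂ)) with hu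
  have here : ∀ i, 0 < (e i).re ∧ ((e i).re : ℂ) = e i := by
    intro i
    have := Complex.pos_iff.1 (hepos i)
    exact ⟨this.1, Complex.ext (by simp) (by simp [this.2])⟩
  have huu : ∀ i, conj (u i) * u i = (e i)⁻¹ := by
    intro i
    have hn : (‖L i i‖ : ℂ) ≠ 0 := by simpa using hLdiag i
    rw [mul_comm, Complex.mul_conj, Complex.normSq_eq_norm_sq, ← (here i).2]
    simp only [hu, norm_mul, norm_div, Complex.norm_real, RCLike.norm_conj, norm_inv, norm_norm]
    rw [div_self (by simpa using hLdiag i), mul_one, Real.norm_of_nonneg (Real.sqrt_nonneg _),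
      inv_pow, Real.sq_sqrt (here i).1.le]
    push_cast; rfl
  refine ⟨Matrix.diagonal u * L, fun i j hij => ?_, fun i => ?_, ?_⟩
  · rw [Matrix.diagonal_mul, hLtri i j hij, mul_zero]
  · have h1 : (Matrix.diagonal u * L) i i = (((√(e i).re)⁻¹ * ‖L i i‖ : ℝ) : ℂ) := by
      have hn : (‖L i i‖ : ℂ) ≠ 0 := by simpa using hLdiag i
      rw [Matrix.diagonal_mul, hu]
      simp only
      rw [mul_assoc, div_mul_eq_mul_div, mul_comm (conj _), Complex.mul_conj,
        Complex.normSq_eq_norm_sq]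
      push_cast
      field_simp
    rw [h1]
    refine ⟨?_, Complex.ofReal_im _⟩
    rw [Complex.ofReal_re]
    exact mul_pos (inv_pos.2 (Real.sqrt_pos.2 (here i).1)) (norm_pos_iff.2 (hLdiag i))
  · rw [Matrix.conjTranspose_mul, Matrix.diagonal_conjTranspose, hAeq, Matrix.mul_assoc,
      ← Matrix.mul_assoc _ _ L, Matrix.diagonal_mul_diagonal, Matrix.mul_assoc]
    congr 3
    ext i
    exact huu i

end Cholesky

section MomentMatrix

variable {d : ℕ} {ν : Measure (CSphere d)} [IsFiniteMeasure ν]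

local notation "⟪" x ", " y "⟫" => inner ℂ x y

variable (ν) in
/-- The unipotent matrix of coefficients of the monic orthogonal polynomials. -/
def monicMatrix (N : MultiIndex d) : Matrix (Finset.Iic N) (Finset.Iic N) ℂ :=
  Matrix.of fun α β => (monicPoly ν α).coeff (β : MultiIndex d).exp

omit [IsFiniteMeasure ν] in
theorem det_monicMatrix (N : MultiIndex d) : (monicMatrix ν N).det = 1 := by
  rw [Matrix.det_of_isLowerTriangular]
  · refine Finset.prod_eq_one fun α _ => ?_
    rw [monicMatrix, Matrix.of_apply, coeff_monicPoly_of_le ν le_rfl, if_pos rfl]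
  · intro α β hαβ
    have hlt : (α : MultiIndex d) < β := hαβ
    rw [monicMatrix, Matrix.of_apply, coeff_monicPoly_of_le ν hlt.le, if_neg hlt.ne]

/-- Gram--Schmidt diagonalises the moment matrix. -/
theorem monicMatrix_mul_momentMatrix_mul (N : MultiIndex d) :
    monicMatrix ν N * momentMatrix ν N * (monicMatrix ν N).conjTranspose =
      Matrix.diagonal fun α : Finset.Iic N => (polyNormSq ν (monicPoly ν α) : ℂ) := by
  ext α β
  have hexp : ∀ γ : Finset.Iic N, polyL2 ν (monicPoly ν γ) =
      ∑ δ : Finset.Iic N, monicMatrix ν N γ δ • monoL2 ν δ := by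
    intro γ
    conv_lhs => rw [eq_sum_coeff_of_mem_polysUpTo
      (monicPoly_mem_polysUpTo ν (Finset.mem_Iic.1 γ.2))]
    rw [map_sum]
    simp only [map_smul]
    rfl
  have h1 : (monicMatrix ν N * momentMatrix ν N * (monicMatrix ν N).conjTranspose) α β =
      ⟪polyL2 ν (monicPoly ν β), polyL2 ν (monicPoly ν α)⟫ := by
    rw [hexp, hexp, Matrix.mul_apply]
    simp only [Matrix.mul_apply, sum_inner, inner_sum, inner_smul_left, inner_smul_right,
      Matrix.conjTranspose_apply, momentMatrix, momentKernel_eq_gramKernel, gramKernel,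
      Matrix.of_apply, Finset.sum_mul, starRingEnd_apply, Finset.mul_sum]
    rw [Finset.sum_comm]
    refine Finset.sum_congr rfl fun γ _ => Finset.sum_congr rfl fun δ _ => ?_
    ring
  rw [h1]
  by_cases h : α = β
  · subst h
    rw [Matrix.diagonal_apply_eq, inner_self_eq_ofReal, norm_sq_polyL2]
  · rw [Matrix.diagonal_apply_ne _ h, inner_polyL2_monicPoly_of_ne]
    exact fun h' => h (Subtype.ext h'.symm)

theorem momentDet_eq_prod (N : MultiIndex d) :
    momentDet ν N = ∏ α ∈ Finset.Iic N, (polyNormSq ν (monicPoly ν α) : ℂ) := by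
  have h := congrArg Matrix.det (monicMatrix_mul_momentMatrix_mul (ν := ν) N)
  rw [Matrix.det_mul, Matrix.det_mul, Matrix.det_conjTranspose, det_monicMatrix, star_one, one_mul,
    mul_one, Matrix.det_diagonal] at h
  rw [momentDet, h, Finset.prod_coe_sort (Finset.Iic N)
    fun α => (polyNormSq ν (monicPoly ν α) : ℂ)]

/-- Diagonalised by Gram--Schmidt, the inverse of the moment matrix is a sum over the orthonormal
polynomials; its corner entry only sees their constant coefficients. -/
theorem inv_momentMatrix_zero_zero (hv : LinearIndependent ℂ (monoL2 ν)) (N : MultiIndex d)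
    (o : Finset.Iic N) (ho : (o : MultiIndex d) = 0) :
    (momentMatrix ν N)⁻¹ o o = (christoffelSum ν N 0 : ℂ) := by
  set T := monicMatrix ν N with hT
  set D : Finset.Iic N → ℂ := fun α => (polyNormSq ν (monicPoly ν α) : ℂ) with hD
  have hDne : ∀ α, D α ≠ 0 := fun α => by
    simpa [hD] using (polyNormSq_monicPoly_pos hv α).ne'
  have hinv : (momentMatrix ν N)⁻¹ = T.conjTranspose * Matrix.diagonal (fun α => (D α)⁻¹) * T := by
    apply Matrix.inv_eq_left_inv
    have h0 : Matrix.diagonal D * Matrix.diagonal (fun α => (D α)⁻¹) = 1 := by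
      rw [Matrix.diagonal_mul_diagonal, ← Matrix.diagonal_one]
      congr 1
      ext α
      exact mul_inv_cancel₀ (hDne α)
    have h1 : T * (momentMatrix ν N *
        (T.conjTranspose * Matrix.diagonal fun α => (D α)⁻¹)) = 1 := by
      rw [← h0, hD, ← monicMatrix_mul_momentMatrix_mul]
      simp only [Matrix.mul_assoc, hT]
    have h2 := mul_eq_one_comm.1 h1
    rw [Matrix.mul_assoc] at h2
    have h3 := mul_eq_one_comm.1 h2
    simpa only [Matrix.mul_assoc] using h3
  rw [hinv, Matrix.mul_apply]
  simp only [Matrix.mul_diagonal, Matrix.conjTranspose_apply]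
  rw [christoffelSum, Complex.ofReal_sum,
    ← Finset.sum_coe_sort (Finset.Iic N) fun α => ((‖polyEval 0 (orthoPoly ν α)‖ ^ 2 : ℝ) : ℂ)]
  refine Finset.sum_congr rfl fun α _ => ?_
  have h1 : T α o = polyEval 0 (monicPoly ν α) := by
    rw [hT, monicMatrix, Matrix.of_apply, ho]
    change MvPolynomial.coeff 0 _ = _
    have := MvPolynomial.constantCoeff_eq (R := ℂ) (σ := Fin d)
    rw [← this, polyEval]
    exact (congrFun (congrArg DFunLike.coe (MvPolynomial.eval_zero (R := ℂ) (σ := Fin d))) _).symm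
  rw [h1, orthoPoly, polyEval_C_mul, norm_mul, mul_pow]
  rw [Complex.norm_real, Real.norm_of_nonneg (by positivity), inv_pow,
    Real.sq_sqrt (polyNormSq_monicPoly_pos hv α).le, hD, mul_right_comm, mul_comm (star _),
    Complex.star_def, Complex.mul_conj, Complex.normSq_eq_norm_sq]
  push_cast
  ring

open scoped ComplexOrder in
theorem posDef_momentMatrix (hv : LinearIndependent ℂ (monoL2 ν)) (N : MultiIndex d) :
    (momentMatrix ν N).PosDef := by
  have h := (Matrix.posDef_gram_of_linearIndependent (𝕜 := ℂ)
    (hv.comp (fun α : Finset.Iic N => (α : MultiIndex d)) Subtype.val_injective)).transpose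
  have heq : momentMatrix ν N = (Matrix.gram ℂ (monoL2 ν ∘
      fun α : Finset.Iic N => (α : MultiIndex d))).transpose := by
    rw [momentMatrix, momentKernel_eq_gramKernel]
    rfl
  rwa [heq]

open scoped ComplexOrder in
/-- As the Cholesky factor is triangular, `φ^#_N(0) = 1 / G_{00}`, whose square is the corner entry
of the inverse moment matrix. -/
theorem norm_sq_sharpPoly_zero (hv : LinearIndependent ℂ (monoL2 ν)) (N : MultiIndex d) :
    ‖polyEval 0 (sharpPoly ν N)‖ ^ 2 = christoffelSum ν N 0 := by
  have hex := exists_isLowerCholesky (posDef_momentMatrix hv N)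
  set G := lowerCholesky (momentMatrix ν N) with hG
  have hchol : IsLowerCholesky (momentMatrix ν N) G := by
    rw [hG, lowerCholesky, dif_pos hex]
    exact hex.choose_spec
  obtain ⟨htri, hdiag, hmul⟩ := hchol
  set o : Finset.Iic N := ⟨⊥, Finset.mem_Iic.2 bot_le⟩ with ho
  have hGdet : IsUnit G.det := by
    have h1 : IsUnit (momentMatrix ν N).det := (Matrix.isUnit_iff_isUnit_det _).1
      (posDef_momentMatrix hv N).isUnit
    rw [← hmul, Matrix.det_mul] at h1
    exact isUnit_of_mul_isUnit_right h1
  have : Invertible G := Matrix.invertibleOfIsUnitDet G hGdet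
  have hval : polyEval 0 (sharpPoly ν N) = G⁻¹ o o := by
    rw [sharpPoly, polyEval_sum, Finset.sum_eq_single o]
    · rw [polyEval_C_mul]
      have : polyEval 0 (zmonomial (o : MultiIndex d)) = 1 := by
        change polyEval 0 (zmonomial 0) = 1
        rw [zmonomial_zero]; simp [polyEval]
      rw [this, mul_one]
    · intro β _ hβ
      rw [polyEval_C_mul, polyEval_zero_zmonomial, mul_zero]
      exact fun h => hβ (Subtype.ext h)
    · simp
  have hinvtri : ∀ j, j ≠ o → G⁻¹ o j = 0 := by
    intro j hj
    have hb : Matrix.BlockTriangular G OrderDual.toDual := fun i j hij => htri i j hij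
    have hlt : o < j := lt_of_le_of_ne (bot_le : (⊥ : MultiIndex d) ≤ j) hj.symm
    exact Matrix.blockTriangular_inv_of_blockTriangular hb hlt
  have hcorner : (momentMatrix ν N)⁻¹ o o = ((‖G⁻¹ o o‖ ^ 2 : ℝ) : ℂ) := by
    rw [← hmul, Matrix.mul_inv_rev, ← Matrix.conjTranspose_nonsing_inv, Matrix.mul_apply,
      Finset.sum_eq_single o]
    · rw [Matrix.conjTranspose_apply, Complex.star_def, Complex.mul_conj,
        Complex.normSq_eq_norm_sq]
    · intro j _ hj
      rw [hinvtri j hj, zero_mul]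
    · simp
  rw [inv_momentMatrix_zero_zero hv N o rfl] at hcorner
  rw [hval, Complex.ofReal_injective hcorner]

end MomentMatrix

/-! ### The last multi-index of a given length -/

namespace MultiIndex

variable {d : ℕ}

theorem length_last (hd : 0 < d) (n : ℕ) : (last d n).length = n := by
  rw [length, Finset.sum_eq_single (⟨d - 1, by omega⟩ : Fin d)]
  · simp [last]; omega
  · intro i _ hi
    have : (i : ℕ) + 1 ≠ d := fun h => hi (Fin.ext (by simp; omega))
    simp [last, this]
  · simp

/-- `α(n)` is the last multi-index of length at most `n`. -/
theorem le_last_iff (hd : 0 < d) {α : MultiIndex d} {n : ℕ} : α ≤ last d n ↔ α.length ≤ n := by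
  refine ⟨fun h => (length_le_of_le h).trans_eq (length_last hd n), fun h => ?_⟩
  by_contra hlt
  rcases lt_iff.1 (not_le.1 hlt) with h1 | ⟨h1, i, hi, hi2⟩
  · rw [length_last hd] at h1; omega
  · by_cases hid : (i : ℕ) + 1 = d
    · rw [length_last hd] at h1
      have h2 : (last d n).exp i = n := by simp [last, hid]
      have h3 : α.length = α.exp i := by
        rw [length]
        refine Finset.sum_eq_single i (fun j _ hj => ?_) (by simp)
        have hji : j < i := lt_of_le_of_ne (Fin.le_def.2 (by omega)) hj
        rw [← hi j hji]
        have : (j : ℕ) + 1 ≠ d := by have := Fin.lt_def.1 hji; omega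
        simp [last, this]
      omega
    · have hzero : (last d n).exp i = 0 := by simp [last, hid]
      omega

theorem tendsto_Iic_last (hd : 0 < d) :
    Tendsto (fun n => Finset.Iic (last d n)) atTop atTop := by
  refine tendsto_atTop_finset_of_monotone (fun m n h => Finset.Iic_subset_Iic.2 ?_) fun α =>
    ⟨α.length, Finset.mem_Iic.2 ((le_last_iff hd).2 le_rfl)⟩
  rw [le_last_iff hd, length_last hd]; exact h

theorem Iic_prec {α : MultiIndex d} (h : 0 < α) : Finset.Iic α.prec = Finset.Iio α := by
  have hne : (Finset.Iio α).Nonempty := ⟨0, Finset.mem_Iio.2 h⟩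
  rw [prec, dif_pos hne]
  ext β
  rw [Finset.mem_Iic, Finset.mem_Iio]
  constructor
  · intro hβ
    exact hβ.trans_lt (Finset.mem_Iio.1 (Finset.max'_mem _ hne))
  · intro hβ
    exact Finset.le_max' _ _ (Finset.mem_Iio.2 hβ)

/-- Multiplication of `z^α` by the variable `z_i`. -/
def shift (i : Fin d) (α : MultiIndex d) : MultiIndex d := ⟨α.exp + Finsupp.single i 1⟩

theorem length_shift (i : Fin d) (α : MultiIndex d) : (shift i α).length = α.length + 1 := by
  simp [shift, length, Finset.sum_add_distrib, Finsupp.single_apply]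

theorem shift_strictMono (i : Fin d) : StrictMono (shift i) := by
  intro α β h
  rw [lt_iff, length_shift, length_shift]
  rcases lt_iff.1 h with h | ⟨h, j, hj, hj2⟩
  · exact Or.inl (by omega)
  · exact Or.inr ⟨by omega, j, fun k hk => by simp [shift, hj k hk], by simpa [shift] using hj2⟩

theorem shift_last (hd : 0 < d) (n : ℕ) :
    shift ⟨d - 1, by omega⟩ (last d n) = last d (n + 1) := by
  ext i
  simp only [shift, last, Finsupp.add_apply, Finsupp.equivFunOnFinite_symm_apply_apply]
  by_cases h : (i : ℕ) + 1 = d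
  · have : (⟨d - 1, by omega⟩ : Fin d) = i := Fin.ext (by simp; omega)
    simp [h, this]
  · have : (⟨d - 1, by omega⟩ : Fin d) ≠ i := fun h' => h (by rw [← h']; simp; omega)
    simp [h, this]

end MultiIndex

theorem X_mul_zmonomial {d : ℕ} (i : Fin d) (α : MultiIndex d) :
    MvPolynomial.X i * zmonomial α = zmonomial (α.shift i) := by
  rw [zmonomial, zmonomial, MvPolynomial.X, MvPolynomial.monomial_mul, one_mul, add_comm]
  rfl

/-! ### The norms of the monic orthogonal polynomials -/

section MonicNorms

variable {d : ℕ} {ν : Measure (CSphere d)} [IsFiniteMeasure ν]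

/-- The residual has the least norm among the vectors of `x + span`. -/
theorem norm_spanResidual_le {ι H : Type*} [NormedAddCommGroup H] [InnerProductSpace ℂ H]
    (v : ι → H) (s : Finset ι) {x y : H}
    (h : y - x ∈ Submodule.span ℂ (v '' (s : Set ι))) : ‖spanResidual v s x‖ ≤ ‖y‖ := by
  have h1 := Submodule.starProjection_minimal (U := Submodule.span ℂ (v '' (s : Set ι))) x
  rw [spanResidual, h1]
  refine (ciInf_le ⟨0, by rintro _ ⟨w, rfl⟩; exact norm_nonneg _⟩
    (⟨x - y, by rw [← neg_sub]; exact Submodule.neg_mem _ h⟩ :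
      Submodule.span ℂ (v '' (s : Set ι)))).trans_eq ?_
  simp

/-- The monic orthogonal polynomials have the least norm among monic polynomials. -/
theorem polyNormSq_monicPoly_le {α : MultiIndex d} {q : MvPolynomial (Fin d) ℂ}
    (h : q - zmonomial α ∈ Submodule.span ℂ (zmonomial '' Set.Iio α)) :
    polyNormSq ν (monicPoly ν α) ≤ polyNormSq ν q := by
  rw [← norm_sq_polyL2, ← norm_sq_polyL2, polyL2_monicPoly]
  refine pow_le_pow_left₀ (norm_nonneg _) (norm_spanResidual_le _ _ ?_) 2
  have := map_polyL2_span (ν := ν) _ h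
  rwa [map_sub, ← Finset.coe_Iio] at this

theorem integrable_polyEval_sq (ν : Measure (CSphere d)) [IsFiniteMeasure ν]
    (p : MvPolynomial (Fin d) ℂ) :
    Integrable (fun ζ : CSphere d => ‖polyEval (ζ : EuclideanSpace ℂ (Fin d)) p‖ ^ 2) ν :=
  ((continuous_polyEval_sphere p).norm.pow 2).integrable_of_hasCompactSupport
    (HasCompactSupport.of_compactSpace _)

theorem norm_coord_le_one (ζ : CSphere d) (i : Fin d) :
    ‖(ζ : EuclideanSpace ℂ (Fin d)) i‖ ≤ 1 := by
  have h1 : ‖(ζ : EuclideanSpace ℂ (Fin d))‖ = 1 := by simp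
  exact (PiLp.norm_apply_le (ζ : EuclideanSpace ℂ (Fin d)) i).trans h1.le

/-- `z_d Φ_{α(n)}` competes with `Φ_{α(n+1)}`, and multiplication by `z_d` does not increase
norms. -/
theorem antitone_polyNormSq_monicPoly_last (hd : 0 < d) :
    Antitone fun n => polyNormSq ν (monicPoly ν (MultiIndex.last d n)) := by
  refine antitone_nat_of_succ_le fun n => ?_
  set i : Fin d := ⟨d - 1, by omega⟩
  set α := MultiIndex.last d n
  have h1 : polyNormSq ν (monicPoly ν (MultiIndex.last d (n + 1))) ≤
      polyNormSq ν (MvPolynomial.X i * monicPoly ν α) := by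
    apply polyNormSq_monicPoly_le
    rw [← MultiIndex.shift_last hd, ← X_mul_zmonomial, ← mul_sub]
    have h2 := Submodule.mem_map_of_mem (f := LinearMap.mulLeft ℂ (MvPolynomial.X i))
      (monicPoly_sub_zmonomial_mem ν α)
    rw [Submodule.map_span, Set.image_image] at h2
    refine Submodule.span_mono ?_ h2
    rintro _ ⟨β, hβ, rfl⟩
    exact ⟨β.shift i, MultiIndex.shift_strictMono i hβ, (X_mul_zmonomial i β).symm⟩
  refine h1.trans (integral_mono (integrable_polyEval_sq ν _) (integrable_polyEval_sq ν _) ?_)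
  intro ζ
  have : polyEval (ζ : EuclideanSpace ℂ (Fin d)) (MvPolynomial.X i * monicPoly ν α) =
    (ζ : EuclideanSpace ℂ (Fin d)) i * polyEval (ζ : EuclideanSpace ℂ (Fin d)) (monicPoly ν α) := by
    simp [polyEval]
  simp only [this, norm_mul, mul_pow]
  exact mul_le_of_le_one_left (sq_nonneg _) (pow_le_one₀ (norm_nonneg _) (norm_coord_le_one ζ i))

theorem orthoCoeff_self_sq_inv (hv : LinearIndependent ℂ (monoL2 ν)) (α : MultiIndex d) :
    ((orthoCoeff ν α α) ^ 2)⁻¹ = (polyNormSq ν (monicPoly ν α) : ℂ) := by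
  have h0 := (polyNormSq_monicPoly_pos hv α).le
  rw [orthoCoeff, orthoPoly, MvPolynomial.coeff_C_mul, coeff_monicPoly_of_le ν le_rfl, if_pos rfl,
    mul_one, ← Complex.ofReal_pow, inv_pow, Real.sq_sqrt h0]
  push_cast
  rw [inv_inv]

theorem momentDet_div_momentDet_prec (hv : LinearIndependent ℂ (monoL2 ν)) {α : MultiIndex d}
    (hα : 0 < α) : momentDet ν α / momentDet ν α.prec = (polyNormSq ν (monicPoly ν α) : ℂ) := by
  rw [momentDet_eq_prod, momentDet_eq_prod, MultiIndex.Iic_prec hα, ← Finset.Iio_insert,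
    Finset.prod_insert (by simp), mul_div_assoc, div_self, mul_one]
  refine Finset.prod_ne_zero_iff.2 fun β _ => ?_
  simpa using (polyNormSq_monicPoly_pos hv β).ne'

theorem momentKernel_mul_prod (hv : LinearIndependent ℂ (monoL2 ν)) {α : MultiIndex d}
    (hα : 0 < α) : momentKernel ν α α *
      ((∏ β ∈ Finset.Iic α.prec, (1 - ‖verblunskyCoeff ν β α‖ ^ 2) : ℝ) : ℂ) =
      (polyNormSq ν (monicPoly ν α) : ℂ) := by
  rw [← norm_sq_polyL2, polyL2_monicPoly, MultiIndex.Iic_prec hα]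
  have hI : Finset.Iio α = Finset.Ico 0 α := by
    ext β
    simp only [Finset.mem_Iio, Finset.mem_Ico]
    exact ⟨fun h => ⟨(bot_le : (⊥ : MultiIndex d) ≤ β), h⟩, fun h => h.2⟩
  rw [hI, norm_sq_residual_Ico hv hα.le, momentKernel_eq_gramKernel, gramKernel,
    inner_self_eq_ofReal, ← Complex.ofReal_mul]
  simp only [verblunskyCoeff, momentKernel_eq_gramKernel]

/-- The norms of the `Φ_{α(n)}` converge, and with them their expressions by leading coefficients,
moment determinants and Verblunsky coefficients. -/
theorem exists_limit_monic (hd : 0 < d) (hv : LinearIndependent ℂ (monoL2 ν)) : ∃ L : ℝ,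
    Tendsto (fun n => polyNormSq ν (monicPoly ν (MultiIndex.last d n))) atTop (𝓝 L) ∧
    Tendsto (fun n => ((orthoCoeff ν (MultiIndex.last d n) (MultiIndex.last d n)) ^ 2)⁻¹)
      atTop (𝓝 (L : ℂ)) ∧
    Tendsto (fun n => momentDet ν (MultiIndex.last d n) /
      momentDet ν (MultiIndex.last d n).prec) atTop (𝓝 (L : ℂ)) ∧
    Tendsto (fun n => momentKernel ν (MultiIndex.last d n) (MultiIndex.last d n) *
      ((∏ β ∈ Finset.Iic (MultiIndex.last d n).prec,
        (1 - ‖verblunskyCoeff ν β (MultiIndex.last d n)‖ ^ 2) : ℝ) : ℂ)) atTop (𝓝 (L : ℂ)) := by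
  have h1 := tendsto_atTop_ciInf (antitone_polyNormSq_monicPoly_last (ν := ν) hd)
    ⟨0, by rintro _ ⟨n, rfl⟩; exact (polyNormSq_monicPoly_pos hv _).le⟩
  have h2 := (Complex.continuous_ofReal.tendsto _).comp h1
  have hpos : ∀ n, 0 < n → (0 : MultiIndex d) < MultiIndex.last d n := fun n hn =>
    MultiIndex.lt_iff.2 (Or.inl (by rwa [MultiIndex.length_zero, MultiIndex.length_last hd]))
  refine ⟨_, h1, ?_, ?_, ?_⟩
  · exact h2.congr fun n => (orthoCoeff_self_sq_inv hv _).symm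
  · refine h2.congr' ?_
    filter_upwards [eventually_gt_atTop 0] with n hn
    exact (momentDet_div_momentDet_prec hv (hpos n hn)).symm
  · refine h2.congr' ?_
    filter_upwards [eventually_gt_atTop 0] with n hn
    exact (momentKernel_mul_prod hv (hpos n hn)).symm

end MonicNorms

/-! ### The Christoffel function at the origin -/

section ChristoffelAtOrigin

variable {d : ℕ} {ν : Measure (CSphere d)} [IsFiniteMeasure ν]

theorem exists_mem_polysUpTo_last (hd : 0 < d) (q : MvPolynomial (Fin d) ℂ) :
    ∃ n, q ∈ polysUpTo (MultiIndex.last d n) := by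
  have hmono : ∀ {m n : ℕ}, m ≤ n →
      polysUpTo (MultiIndex.last d m) ≤ polysUpTo (MultiIndex.last d n) := fun h =>
    Submodule.span_mono (Set.image_mono (Set.Iic_subset_Iic.2
      ((MultiIndex.le_last_iff hd).2 (by rwa [MultiIndex.length_last hd]))))
  induction q using MvPolynomial.induction_on' with
  | monomial u a =>
    refine ⟨(⟨u⟩ : MultiIndex d).length, ?_⟩
    have : MvPolynomial.monomial u a = a • zmonomial (⟨u⟩ : MultiIndex d) := by
      simp [zmonomial, MvPolynomial.smul_monomial]
    rw [this]
    exact Submodule.smul_mem _ _ (Submodule.subset_span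
      ⟨⟨u⟩, (MultiIndex.le_last_iff hd).2 le_rfl, rfl⟩)
  | add p q hp hq =>
    obtain ⟨m, hm⟩ := hp
    obtain ⟨n, hn⟩ := hq
    exact ⟨max m n, Submodule.add_mem _ (hmono (le_max_left _ _) hm)
      (hmono (le_max_right _ _) hn)⟩

theorem christoffelValues_nonneg (ν : Measure (CSphere d)) (z : EuclideanSpace ℂ (Fin d)) :
    ∀ x ∈ christoffelValues ν z, 0 ≤ x := by
  rintro _ ⟨q, -, rfl⟩
  exact integral_nonneg fun _ => by positivity

theorem christoffelValues_nonempty (ν : Measure (CSphere d)) (z : EuclideanSpace ℂ (Fin d)) :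
    (christoffelValues ν z).Nonempty :=
  ⟨_, 1, by simp [polyEval], rfl⟩

theorem isGLB_sInf_christoffelValues (ν : Measure (CSphere d)) (z : EuclideanSpace ℂ (Fin d)) :
    IsGLB (christoffelValues ν z) (sInf (christoffelValues ν z)) :=
  isGLB_csInf (christoffelValues_nonempty ν z) ⟨0, christoffelValues_nonneg ν z⟩

/-- The Christoffel approximates decrease to the infimum of the extremal problem over all
polynomials. -/
theorem tendsto_christoffelApprox (hd : 0 < d) (hv : LinearIndependent ℂ (monoL2 ν))
    (z : EuclideanSpace ℂ (Fin d)) :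
    Tendsto (fun n => christoffelApprox ν n z) atTop (𝓝 (sInf (christoffelValues ν z))) := by
  have hle : ∀ n, ∀ q ∈ polysUpTo (MultiIndex.last d n), polyEval z q = 1 →
      christoffelApprox ν n z ≤ polyNormSq ν q := by
    intro n q hq hq1
    obtain ⟨P, hP, -⟩ := existsUnique_minimizer hv n z
    rw [← polyNormSq_minimizer hv hP]
    exact hP.2.2 q hq hq1
  have hmem : ∀ n, christoffelApprox ν n z ∈ christoffelValues ν z := by
    intro n
    obtain ⟨P, hP, -⟩ := existsUnique_minimizer hv n z
    exact ⟨P, hP.2.1, polyNormSq_minimizer hv hP⟩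
  have hglb := isGLB_sInf_christoffelValues ν z
  have hanti : Antitone fun n => christoffelApprox ν n z := by
    intro m n h
    obtain ⟨P, hP, -⟩ := existsUnique_minimizer hv m z
    change christoffelApprox ν n z ≤ christoffelApprox ν m z
    rw [← polyNormSq_minimizer hv hP]
    refine hle n P (Submodule.span_mono (Set.image_mono (Set.Iic_subset_Iic.2 ?_)) hP.1) hP.2.1
    exact (MultiIndex.le_last_iff hd).2 (by rwa [MultiIndex.length_last hd])
  refine tendsto_atTop_isGLB hanti ⟨?_, fun x hx => hglb.2 ?_⟩
  · rintro _ ⟨n, rfl⟩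
    exact hglb.1 (hmem n)
  · rintro _ ⟨q, hq1, rfl⟩
    obtain ⟨n, hn⟩ := exists_mem_polysUpTo_last hd q
    exact (hx ⟨n, rfl⟩).trans (hle n q hn hq1)

/-- The product converges unconditionally, as its factors lie in `[0, 1]`, so its value is found
along the initial segments up to `α(n)`. -/
theorem hasProd_verblunsky (hd : 0 < d) [IsProbabilityMeasure ν]
    (hv : LinearIndependent ℂ (monoL2 ν)) :
    HasProd (fun α => 1 - ‖verblunskyCoeff ν 0 α‖ ^ 2) (sInf (christoffelValues ν 0)) := by
  have hpos : ∀ α, 0 ≤ 1 - ‖verblunskyCoeff ν 0 α‖ ^ 2 := fun α => by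
    rw [verblunskyCoeff, momentKernel_eq_gramKernel]
    exact (norm_verblunsky_lt_one hv 0 α).le
  have hanti : Antitone fun s : Finset (MultiIndex d) =>
      ∏ α ∈ s, (1 - ‖verblunskyCoeff ν 0 α‖ ^ 2) := by
    classical
    intro s t h
    simp only
    rw [← Finset.prod_sdiff h]
    refine mul_le_of_le_one_left (Finset.prod_nonneg fun α _ => hpos α)
      (Finset.prod_le_one (fun α _ => hpos α) fun α _ => ?_)
    have := sq_nonneg ‖verblunskyCoeff ν 0 α‖
    linarith
  have h1 := tendsto_atTop_ciInf hanti
    ⟨0, by rintro _ ⟨s, rfl⟩; exact Finset.prod_nonneg fun α _ => hpos α⟩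
  have h2 := h1.comp (MultiIndex.tendsto_Iic_last hd)
  have h3 := (tendsto_christoffelApprox hd hv 0).congr fun n =>
    inv_christoffelSum_zero hv (MultiIndex.last d n)
  rw [tendsto_nhds_unique h3 h2]
  exact h1

end ChristoffelAtOrigin

/-! ### The normalised measure of the sphere -/

section SphereMeasure

variable {d : ℕ}

local notation "𝔼" => EuclideanSpace ℂ (Fin d)

instance isFiniteMeasure_sphereMeasure : IsFiniteMeasure (sphereMeasure d) := by
  unfold sphereMeasure; infer_instance

theorem isProbabilityMeasure_sphereMeasure (hd : 0 < d) :
    IsProbabilityMeasure (sphereMeasure d) := by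
  have : Nonempty (Fin d) := ⟨⟨0, hd⟩⟩
  have hne : (volume : Measure 𝔼).toSphere Set.univ ≠ 0 := by
    rw [Ne, Measure.measure_univ_eq_zero]
    exact Measure.toSphere_ne_zero _
  refine ⟨?_⟩
  rw [sphereMeasure, Measure.smul_apply, smul_eq_mul,
    ENNReal.inv_mul_cancel hne (measure_ne_top _ _)]

theorem sphereMeasure_absolutelyContinuous :
    sphereMeasure d ≪ (volume : Measure 𝔼).toSphere :=
  Measure.smul_absolutelyContinuous

/-- The rotation `ζ ↦ e^{iθ} ζ` of the sphere. -/
def sphereRotate (θ : ℝ) (ζ : CSphere d) : CSphere d :=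
  ⟨circleMap 0 1 θ • (ζ : 𝔼), by simp [norm_smul]⟩

theorem continuous_sphereRotate :
    Continuous fun x : ℝ × CSphere d => sphereRotate x.1 x.2 := by
  unfold sphereRotate
  refine Continuous.subtype_mk ?_ _
  exact ((continuous_circleMap 0 1).comp continuous_fst).smul
    (continuous_subtype_val.comp continuous_snd)

theorem continuous_sphereRotate_right (θ : ℝ) : Continuous (sphereRotate (d := d) θ) :=
  Continuous.subtype_mk (continuous_subtype_val.const_smul (circleMap 0 1 θ)) _

theorem continuous_sphereRotate_left (ζ : CSphere d) : Continuous fun θ => sphereRotate θ ζ :=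
  Continuous.subtype_mk ((continuous_circleMap 0 1).smul continuous_const) _

/-- Multiplication by `e^{iθ}` as a real-linear isometry. -/
def rotateIsometry (d : ℕ) (θ : ℝ) :
    EuclideanSpace ℂ (Fin d) ≃ₗᵢ[ℝ] EuclideanSpace ℂ (Fin d) where
  toLinearEquiv := (LinearEquiv.smulOfNeZero ℂ (EuclideanSpace ℂ (Fin d)) (circleMap 0 1 θ)
    (by simp [circleMap])).restrictScalars ℝ
  norm_map' z := by
    change ‖circleMap 0 1 θ • z‖ = ‖z‖
    simp [norm_smul]

theorem measurePreserving_sphereRotate (θ : ℝ) :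
    MeasurePreserving (sphereRotate θ) (sphereMeasure d) (sphereMeasure d) := by
  have hmeas := (continuous_sphereRotate_right (d := d) θ).measurable
  refine ⟨hmeas, ?_⟩
  have key : (volume : Measure 𝔼).toSphere.map (sphereRotate θ) =
      (volume : Measure 𝔼).toSphere := by
    ext s hs
    rw [Measure.map_apply hmeas hs, Measure.toSphere_apply' _ hs,
      Measure.toSphere_apply' _ (hmeas hs)]
    congr 1
    have hpre := (rotateIsometry d θ).measurePreserving.measure_preimage_emb
      (rotateIsometry d θ).toHomeomorph.measurableEmbedding
      (Set.Ioo (0 : ℝ) 1 • ((↑) '' s : Set 𝔼))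
    rw [← hpre]
    congr 1
    ext z
    simp only [Set.mem_smul, Set.mem_image, Set.mem_preimage]
    constructor
    · rintro ⟨r, hr, _, ⟨ζ, hζ, rfl⟩, rfl⟩
      refine ⟨r, hr, _, ⟨_, hζ, rfl⟩, ?_⟩
      rw [map_smul]
      rfl
    · rintro ⟨r, hr, _, ⟨ζ, hζ, rfl⟩, h⟩
      refine ⟨r, hr, (rotateIsometry d θ).symm ζ, ⟨⟨(rotateIsometry d θ).symm ζ, ?_⟩, ?_, rfl⟩, ?_⟩
      · simp
      · convert hζ
        exact Subtype.ext ((rotateIsometry d θ).apply_symm_apply _)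
      · rw [← map_smul, h, LinearIsometryEquiv.symm_apply_apply]
  rw [sphereMeasure, Measure.map_smul, key]

/-- The restriction of a polynomial to the complex line `t ↦ z + t v`. -/
def linePoly (z v : 𝔼) (p : MvPolynomial (Fin d) ℂ) : Polynomial ℂ :=
  MvPolynomial.aeval (fun i => Polynomial.C (z i) + Polynomial.X * Polynomial.C (v i)) p

theorem eval_linePoly (z v : 𝔼) (p : MvPolynomial (Fin d) ℂ) (t : ℂ) :
    (linePoly z v p).eval t = polyEval (z + t • v) p := by
  rw [linePoly]
  induction p using MvPolynomial.induction_on with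
  | C a => simp [polyEval]
  | add p q hp hq => rw [map_add, Polynomial.eval_add, hp, hq]; simp [polyEval]
  | mul_X p i hp =>
    rw [map_mul, Polynomial.eval_mul, hp]
    simp only [polyEval, MvPolynomial.aeval_X, Polynomial.eval_add, Polynomial.eval_C,
      Polynomial.eval_mul, Polynomial.eval_X, map_mul, MvPolynomial.eval_X]
    rfl

theorem continuous_polyEval (p : MvPolynomial (Fin d) ℂ) :
    Continuous fun z : 𝔼 => polyEval z p := by
  induction p using MvPolynomial.induction_on with
  | C a => simpa [polyEval] using continuous_const
  | add p q hp hq => exact (hp.add hq).congr fun z => by simp [polyEval]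
  | mul_X p i hp =>
    have : Continuous fun z : 𝔼 => z i := by fun_prop
    exact (hp.mul this).congr fun z => by simp [polyEval]

/-- The zero set of a non-zero polynomial is a null set: it meets each ray from a
point outside it in finitely many points. -/
theorem volume_polyEval_eq_zero {p : MvPolynomial (Fin d) ℂ} (hp : p ≠ 0) :
    (volume : Measure 𝔼) {z | polyEval z p = 0} = 0 := by
  obtain ⟨x, hx⟩ : ∃ x : 𝔼, polyEval x p ≠ 0 := by
    by_contra! h
    refine hp (MvPolynomial.funext fun y => ?_)
    rw [map_zero]
    exact h (WithLp.toLp 2 y)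
  have hmeas : MeasurableSet {z : 𝔼 | polyEval (x + z) p = 0} :=
    (isClosed_singleton.preimage ((continuous_polyEval p).comp
      (continuous_const.add continuous_id))).measurableSet
  have h1 : (volume : Measure 𝔼) {z | polyEval (x + z) p = 0} = 0 := by
    set N : Set 𝔼 := {z | polyEval (x + z) p = 0} with hN
    set S : Set (Metric.sphere (0 : 𝔼) 1 × Set.Ioi (0 : ℝ)) :=
      {y | polyEval (x + (y.2 : ℝ) • (y.1 : 𝔼)) p = 0} with hS
    have hSc : Continuous fun y : Metric.sphere (0 : 𝔼) 1 × Set.Ioi (0 : ℝ) =>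
        x + (y.2 : ℝ) • (y.1 : 𝔼) := by fun_prop
    have hSm : MeasurableSet S :=
      (isClosed_singleton.preimage ((continuous_polyEval p).comp hSc)).measurableSet
    have hpre : homeomorphUnitSphereProd 𝔼 ⁻¹' S = Subtype.val ⁻¹' N := by
      ext z
      have : (z : 𝔼) = ((homeomorphUnitSphereProd 𝔼 z).2 : ℝ) •
          ((homeomorphUnitSphereProd 𝔼 z).1 : 𝔼) := by
        rw [← homeomorphUnitSphereProd_symm_apply_coe, Homeomorph.symm_apply_apply]
      simp only [Set.mem_preimage, hS, hN, Set.mem_ofPred_eq]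
      rw [this, ← this]
    have h2 := (Measure.measurePreserving_homeomorphUnitSphereProd
      (volume : Measure 𝔼)).measure_preimage hSm.nullMeasurableSet
    -- on the ray through `ζ` the zeros are real roots of a non-zero polynomial in one variable
    have h3 : ((volume : Measure 𝔼).toSphere.prod
        (Measure.volumeIoiPow (Module.finrank ℝ 𝔼 - 1))) S = 0 := by
      rw [Measure.measure_prod_null hSm]
      refine Eventually.of_forall fun ζ => ?_
      refine (withDensity_absolutelyContinuous _ _ : Measure.volumeIoiPow _ ≪ _) ?_
      rw [comap_subtype_coe_apply measurableSet_Ioi]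
      refine Set.Finite.measure_zero ?_ _
      have hne : linePoly x (ζ : 𝔼) p ≠ 0 := by
        intro h0
        have := eval_linePoly x (ζ : 𝔼) p 0
        rw [h0, zero_smul, add_zero, Polynomial.eval_zero] at this
        exact hx this.symm
      refine Set.Finite.of_finite_image (f := ((↑) : ℝ → ℂ)) ?_ Complex.ofReal_injective.injOn
      refine ((linePoly x (ζ : 𝔼) p).rootSet_finite ℂ).subset ?_
      rintro _ ⟨_, ⟨r, hr, rfl⟩, rfl⟩
      rw [Polynomial.mem_rootSet]
      refine ⟨hne, ?_⟩
      rw [Polynomial.coe_aeval_eq_eval, eval_linePoly]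
      rw [Complex.coe_smul]
      exact hr
    rw [hpre, h3, comap_subtype_coe_apply (measurableSet_singleton _).compl,
      Subtype.image_preimage_coe, Set.inter_comm, ← Set.sdiff_eq] at h2
    rwa [Set.sdiff_singleton_eq_self] at h2
    rw [hN, Set.mem_ofPred_eq, add_zero]
    exact hx
  have h2 := measure_preimage_add (volume : Measure 𝔼) x {z | polyEval z p = 0}
  rw [← h2]
  exact h1

theorem volume_circleMap_eval_eq_zero {g : Polynomial ℂ} (hg : g ≠ 0) :
    volume {θ ∈ Set.Ioc 0 (2 * Real.pi) | g.eval (circleMap 0 1 θ) = 0} = 0 := by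
  refine Set.Finite.measure_zero ?_ _
  refine Set.Finite.of_finite_image (f := circleMap 0 1) ?_ ?_
  · refine (g.rootSet_finite ℂ).subset ?_
    rintro _ ⟨θ, hθ, rfl⟩
    rw [Polynomial.mem_rootSet]
    exact ⟨hg, by rw [Polynomial.coe_aeval_eq_eval]; exact hθ.2⟩
  · refine (injOn_circleMap_of_abs_sub_le one_ne_zero (a := 0) (b := 2 * Real.pi) ?_).mono ?_
    · rw [zero_sub, abs_neg, abs_of_pos Real.two_pi_pos]
    · rw [Set.uIoc_of_le Real.two_pi_pos.le]
      exact fun θ hθ => hθ.1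

/-- For almost every point `ζ` of the sphere, a given non-zero polynomial does not vanish
identically on the complex line through `ζ`. -/
theorem ae_linePoly_ne_zero {p : MvPolynomial (Fin d) ℂ} (hp : p ≠ 0) :
    ∀ᵐ ζ : CSphere d ∂sphereMeasure d, linePoly 0 (ζ : 𝔼) p ≠ 0 := by
  apply sphereMeasure_absolutelyContinuous.ae_le
  set B : Set (CSphere d) := {ζ | ∀ t : ℂ, polyEval (t • (ζ : 𝔼)) p = 0} with hB
  have hBm : MeasurableSet B := by
    rw [hB, Set.ofPred_forall]
    refine (isClosed_iInter fun t => isClosed_singleton.preimage ((continuous_polyEval p).comp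
      (?_ : Continuous fun ζ : CSphere d => t • (ζ : 𝔼)))).measurableSet
    fun_prop
  have hB0 : (volume : Measure 𝔼).toSphere B = 0 := by
    rw [Measure.toSphere_apply' _ hBm]
    refine mul_eq_zero_of_right _ (measure_mono_null ?_ (volume_polyEval_eq_zero hp))
    intro z hz
    obtain ⟨r, -, _, ⟨ζ, hζ, rfl⟩, rfl⟩ := Set.mem_smul.1 hz
    have := hζ r
    rwa [Complex.coe_smul] at this
  filter_upwards [measure_eq_zero_iff_ae_notMem.1 hB0] with ζ hζ h0
  refine hζ fun t => ?_
  have := eval_linePoly 0 (ζ : 𝔼) p t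
  rw [h0, zero_add, Polynomial.eval_zero] at this
  exact this.symm

theorem polyEval_sphereRotate (p : MvPolynomial (Fin d) ℂ) (θ : ℝ) (ζ : CSphere d) :
    polyEval (sphereRotate θ ζ : 𝔼) p = (linePoly 0 (ζ : 𝔼) p).eval (circleMap 0 1 θ) := by
  rw [eval_linePoly, zero_add]; rfl

/-- A non-zero polynomial vanishes almost nowhere on the sphere: by Fubini's theorem for the
rotations `e^{iθ}`, as it has finitely many zeros on almost every circle `e^{iθ} ζ`. -/
theorem ae_polyEval_ne_zero {p : MvPolynomial (Fin d) ℂ} (hp : p ≠ 0) :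
    ∀ᵐ ζ : CSphere d ∂sphereMeasure d, polyEval (ζ : 𝔼) p ≠ 0 := by
  set I := Set.Ioc 0 (2 * Real.pi) with hI
  set S : Set (CSphere d × ℝ) := {x | polyEval (sphereRotate x.2 x.1 : 𝔼) p = 0} with hS
  have hSm : MeasurableSet S := (isClosed_singleton.preimage ((continuous_polyEval_sphere p).comp
    (continuous_sphereRotate.comp continuous_swap))).measurableSet
  have h1 : ((sphereMeasure d).prod (volume.restrict I)) S = 0 := by
    rw [Measure.measure_prod_null hSm]
    filter_upwards [ae_linePoly_ne_zero hp] with ζ hζ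
    rw [Measure.restrict_apply (measurable_prodMk_left hSm)]
    refine measure_mono_null ?_ (volume_circleMap_eval_eq_zero hζ)
    rintro θ ⟨h1, h2⟩
    refine ⟨h2, ?_⟩
    rw [← polyEval_sphereRotate]
    exact h1
  have h2 : ((volume.restrict I).prod (sphereMeasure d)) (Prod.swap ⁻¹' S) = 0 := by
    rw [← Measure.prod_swap, Measure.map_apply measurable_swap (measurable_swap hSm)]
    simpa [← Set.preimage_comp] using h1
  have h3 := Measure.measure_ae_null_of_prod_null h2
  have hIne : volume.restrict I ≠ 0 := by
    rw [Ne, Measure.restrict_eq_zero, hI, Real.volume_Ioc]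
    simp [Real.pi_pos]
  have : (ae (volume.restrict I)).NeBot := ae_neBot.2 hIne
  obtain ⟨θ, hθ⟩ := h3.exists
  have hZm : MeasurableSet {ζ : CSphere d | polyEval (ζ : 𝔼) p = 0} :=
    (isClosed_singleton.preimage (continuous_polyEval_sphere p)).measurableSet
  rw [ae_iff]
  simp only [not_not]
  rw [← (measurePreserving_sphereRotate θ).measure_preimage hZm.nullMeasurableSet]
  exact hθ

/-- Averaging over the circles `θ ↦ e^{iθ} ζ`. -/
theorem integral_sphereMeasure_nonneg_of_circle {F : CSphere d → ℝ} (hF : Continuous F)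
    (h : ∀ ζ, 0 ≤ ∫ θ in 0..2 * Real.pi, F (sphereRotate θ ζ)) :
    0 ≤ ∫ ζ, F ζ ∂sphereMeasure d := by
  have hint : Integrable (Function.uncurry fun (ζ : CSphere d) (θ : ℝ) => F (sphereRotate θ ζ))
      ((sphereMeasure d).prod (volume.restrict (Set.Ioc 0 (2 * Real.pi)))) := by
    obtain ⟨C, hC⟩ := isCompact_univ.exists_bound_of_continuousOn hF.continuousOn
    refine Integrable.of_bound (C := C) ?_ (Eventually.of_forall fun x => hC _ (Set.mem_univ _))
    exact (hF.comp (continuous_sphereRotate.comp continuous_swap)).aestronglyMeasurable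
  have h1 := integral_integral_swap hint
  have h2 : ∀ θ : ℝ, ∫ ζ, F (sphereRotate θ ζ) ∂sphereMeasure d = ∫ ζ, F ζ ∂sphereMeasure d := by
    intro θ
    have := integral_map (μ := sphereMeasure d) (measurePreserving_sphereRotate θ).aemeasurable
      (hF.aestronglyMeasurable (μ := (sphereMeasure d).map (sphereRotate θ)))
    rw [(measurePreserving_sphereRotate θ).map_eq] at this
    exact this.symm
  simp only [h2, integral_const, smul_eq_mul] at h1
  have h3 : 0 ≤ ∫ ζ : CSphere d, (∫ θ in Set.Ioc 0 (2 * Real.pi), F (sphereRotate θ ζ))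
      ∂sphereMeasure d := by
    refine integral_nonneg fun ζ => ?_
    have := h ζ
    rwa [intervalIntegral.integral_of_le Real.two_pi_pos.le] at this
  rw [h1] at h3
  have hpos : 0 < (volume.restrict (Set.Ioc 0 (2 * Real.pi))).real Set.univ := by
    simp [Real.pi_pos]
  exact nonneg_of_mul_nonneg_right h3 hpos

/-- Jensen's inequality `∫ log |q|² dσ ≥ log |q(0)|²`, regularised by `ε`. On each circle `e^{iθ} ζ`
it says that the Mahler measure of a polynomial is at least the modulus of its constant term. -/
theorem integral_log_polyEval_nonneg {q : MvPolynomial (Fin d) ℂ} (hq : polyEval 0 q = 1)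
    {ε : ℝ} (hε : 0 < ε) :
    0 ≤ ∫ ζ : CSphere d, Real.log (‖polyEval (ζ : 𝔼) q‖ ^ 2 + ε) ∂sphereMeasure d := by
  have hcont : Continuous fun ζ : CSphere d => Real.log (‖polyEval (ζ : 𝔼) q‖ ^ 2 + ε) :=
    (((continuous_polyEval_sphere q).norm.pow 2).add continuous_const).log fun ζ =>
      (add_pos_of_nonneg_of_pos (sq_nonneg _) hε).ne'
  refine integral_sphereMeasure_nonneg_of_circle hcont fun ζ => ?_
  set g := linePoly 0 (ζ : 𝔼) q with hg
  have hg0 : g.coeff 0 = 1 := by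
    rw [Polynomial.coeff_zero_eq_eval_zero, hg, eval_linePoly, zero_smul, add_zero, hq]
  have hgne : g ≠ 0 := by
    intro h
    rw [h, Polynomial.coeff_zero] at hg0
    exact zero_ne_one hg0
  have h1 : 1 ≤ g.mahlerMeasure := by
    simpa [hg0] using g.norm_coeff_le_choose_mul_mahlerMeasure 0
  have h2 : 0 ≤ ∫ θ in 0..2 * Real.pi, Real.log ‖g.eval (circleMap 0 1 θ)‖ := by
    rw [Polynomial.mahlerMeasure_def_of_ne_zero hgne, Real.one_le_exp_iff] at h1
    exact nonneg_of_mul_nonneg_right h1 (inv_pos.2 Real.two_pi_pos)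
  have h3 : 0 ≤ ∫ θ in 0..2 * Real.pi, 2 * Real.log ‖g.eval (circleMap 0 1 θ)‖ := by
    rw [intervalIntegral.integral_const_mul]
    positivity
  refine h3.trans ?_
  rw [intervalIntegral.integral_of_le Real.two_pi_pos.le,
    intervalIntegral.integral_of_le Real.two_pi_pos.le]
  refine integral_mono_ae ?_ ?_ ?_
  · exact (g.intervalIntegrable_mahlerMeasure.const_mul 2).1
  · exact (hcont.comp (continuous_sphereRotate_left ζ)).integrableOn_Ioc
  · rw [EventuallyLE, ae_restrict_iff' measurableSet_Ioc]
    have hnull := measure_eq_zero_iff_ae_notMem.1 (volume_circleMap_eval_eq_zero hgne)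
    filter_upwards [hnull] with θ hθ hmem
    have hne : g.eval (circleMap 0 1 θ) ≠ 0 := fun h => hθ ⟨hmem, h⟩
    rw [polyEval_sphereRotate, ← hg]
    have hpos : 0 < ‖g.eval (circleMap 0 1 θ)‖ := norm_pos_iff.2 hne
    calc 2 * Real.log ‖g.eval (circleMap 0 1 θ)‖
        = Real.log (‖g.eval (circleMap 0 1 θ)‖ ^ 2) := by rw [Real.log_pow]; norm_num
      _ ≤ _ := Real.log_le_log (by positivity) (by linarith)

/-- A non-zero measure with a density is non-trivial, as it does not charge the zero sets of
polynomials. -/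
theorem isNontrivialMeasure_withDensity {w : CSphere d → ℝ≥0∞}
    [IsFiniteMeasure ((sphereMeasure d).withDensity w)]
    (h : (sphereMeasure d).withDensity w ≠ 0) :
    IsNontrivialMeasure ((sphereMeasure d).withDensity w) := by
  apply isNontrivialMeasure_of_forall_ae_eq_zero
  intro p hp
  by_contra hp0
  have h1 := (withDensity_absolutelyContinuous (sphereMeasure d) w).ae_le (ae_polyEval_ne_zero hp0)
  have : (ae ((sphereMeasure d).withDensity w)).NeBot := ae_neBot.2 h
  obtain ⟨ζ, hζ, hζ'⟩ := (hp.and h1).exists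
  exact hζ' hζ

end SphereMeasure

/-! ### Discrete singular parts do not change the Christoffel function -/

section Discrete

variable {d : ℕ}

local notation "𝔼" => EuclideanSpace ℂ (Fin d)

theorem polyEval_mul (z : 𝔼) (p q : MvPolynomial (Fin d) ℂ) :
    polyEval z (p * q) = polyEval z p * polyEval z q := by simp [polyEval]

/-- The polynomial `(1 + ⟨z, ξ⟩) / 2`, which peaks at the point `ξ` of the sphere. -/
def peakPoly (ξ : CSphere d) : MvPolynomial (Fin d) ℂ :=
  MvPolynomial.C (1 / 2) *
    (1 + ∑ i, MvPolynomial.C (conj ((ξ : 𝔼) i)) * MvPolynomial.X i)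

theorem polyEval_peakPoly (ξ : CSphere d) (z : 𝔼) :
    polyEval z (peakPoly ξ) = 1 / 2 * (1 + inner ℂ (ξ : 𝔼) z) := by
  simp [peakPoly, polyEval, PiLp.inner_apply, mul_comm]

theorem norm_one_add_lt_two {w : ℂ} (hw : ‖w‖ ≤ 1) (hw1 : w ≠ 1) : ‖1 + w‖ < 2 := by
  refine lt_of_le_of_ne ((norm_add_le _ _).trans (by norm_num; linarith)) fun h => hw1 ?_
  have h1 : ‖1 + w‖ ^ 2 = 1 + 2 * w.re + ‖w‖ ^ 2 := by
    rw [← Complex.normSq_eq_norm_sq, ← Complex.normSq_eq_norm_sq, Complex.normSq_apply,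
      Complex.normSq_apply]
    simp; ring
  have h2 : ‖w‖ ^ 2 = w.re * w.re + w.im * w.im := by
    rw [← Complex.normSq_eq_norm_sq, Complex.normSq_apply]
  have h3 := (Complex.re_le_norm w).trans hw
  have h4 : ‖w‖ ^ 2 ≤ 1 := pow_le_one₀ (norm_nonneg _) hw
  rw [h] at h1
  have hre : w.re = 1 := by linarith
  have him : w.im = 0 := by
    rw [hre] at h2
    exact mul_self_eq_zero.1 (le_antisymm (by linarith) (mul_self_nonneg _))
  exact Complex.ext (by simp [hre]) (by simp [him])

theorem norm_inner_sphere_le (ξ ζ : CSphere d) : ‖inner ℂ (ξ : 𝔼) (ζ : 𝔼)‖ ≤ 1 := by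
  have := norm_inner_le_norm (𝕜 := ℂ) (ξ : 𝔼) (ζ : 𝔼)
  simpa using this

theorem norm_polyEval_peakPoly_le (ξ ζ : CSphere d) : ‖polyEval (ζ : 𝔼) (peakPoly ξ)‖ ≤ 1 := by
  rw [polyEval_peakPoly, norm_mul]
  have h1 := norm_add_le (1 : ℂ) (inner ℂ (ξ : 𝔼) (ζ : 𝔼))
  have h2 := norm_inner_sphere_le ξ ζ
  norm_num at h1 ⊢
  linarith

theorem norm_polyEval_peakPoly_lt {ξ ζ : CSphere d} (h : ζ ≠ ξ) :
    ‖polyEval (ζ : 𝔼) (peakPoly ξ)‖ < 1 := by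
  rw [polyEval_peakPoly, norm_mul]
  have h1 : inner ℂ (ξ : 𝔼) (ζ : 𝔼) ≠ 1 := by
    rw [Ne, inner_eq_one_iff_of_norm_eq_one (by simp) (by simp)]
    exact fun h' => h (Subtype.ext h'.symm)
  have h2 := norm_one_add_lt_two (norm_inner_sphere_le ξ ζ) h1
  norm_num
  linarith

theorem polyEval_peakPoly_self (ξ : CSphere d) : polyEval (ξ : 𝔼) (peakPoly ξ) = 1 := by
  rw [polyEval_peakPoly, (inner_eq_one_iff_of_norm_eq_one (by simp) (by simp)).2 rfl]
  norm_num

/-- A polynomial which vanishes on the finite set `F`, takes the value `1` at the origin and tends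
to `1` on the rest of the sphere as `m → ∞`, boundedly. -/
def cutoffPoly (F : Finset (CSphere d)) (m : ℕ) : MvPolynomial (Fin d) ℂ :=
  ∏ ξ ∈ F, (MvPolynomial.C ((1 - (1 / 2) ^ (m + 1))⁻¹) * (1 - peakPoly ξ ^ (m + 1)))

theorem polyEval_cutoffPoly (F : Finset (CSphere d)) (m : ℕ) (z : 𝔼) :
    polyEval z (cutoffPoly F m) =
      ∏ ξ ∈ F, ((1 - (1 / 2) ^ (m + 1))⁻¹ * (1 - polyEval z (peakPoly ξ) ^ (m + 1))) := by
  simp [cutoffPoly, polyEval, map_prod]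

theorem one_sub_half_pow_ne_zero (m : ℕ) : (1 - (1 / 2) ^ (m + 1) : ℂ) ≠ 0 := by
  intro h
  rw [sub_eq_zero] at h
  have h1 := congrArg norm h
  rw [norm_one, norm_pow] at h1
  have h2 : ‖(1 / 2 : ℂ)‖ ^ (m + 1) < 1 :=
    pow_lt_one₀ (norm_nonneg _) (by norm_num) (Nat.succ_ne_zero m)
  exact h2.ne h1.symm

theorem polyEval_cutoffPoly_zero (F : Finset (CSphere d)) (m : ℕ) :
    polyEval 0 (cutoffPoly F m) = 1 := by
  rw [polyEval_cutoffPoly]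
  refine Finset.prod_eq_one fun ξ _ => ?_
  rw [polyEval_peakPoly, inner_zero_right, add_zero, mul_one,
    inv_mul_cancel₀ (one_sub_half_pow_ne_zero m)]

theorem polyEval_cutoffPoly_of_mem {F : Finset (CSphere d)} {ζ : CSphere d} (h : ζ ∈ F) (m : ℕ) :
    polyEval (ζ : 𝔼) (cutoffPoly F m) = 0 := by
  rw [polyEval_cutoffPoly]
  exact Finset.prod_eq_zero h (by rw [polyEval_peakPoly_self]; simp)

/-- Each factor is bounded by `2 · 2`: the normalisation is at most `1 / (1 - 1/2)`. -/
theorem norm_polyEval_cutoffPoly_le (F : Finset (CSphere d)) (m : ℕ) (ζ : CSphere d) :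
    ‖polyEval (ζ : 𝔼) (cutoffPoly F m)‖ ≤ 4 ^ F.card := by
  rw [polyEval_cutoffPoly, norm_prod, ← Finset.prod_const]
  refine Finset.prod_le_prod (fun _ _ => norm_nonneg _) fun ξ _ => ?_
  rw [norm_mul, norm_inv]
  have h1 : 1 / 2 ≤ ‖(1 - (1 / 2) ^ (m + 1) : ℂ)‖ := by
    have h2 := norm_sub_norm_le (1 : ℂ) ((1 / 2) ^ (m + 1))
    rw [norm_one, norm_pow] at h2
    have h3 : ‖(1 / 2 : ℂ)‖ ^ (m + 1) ≤ ‖(1 / 2 : ℂ)‖ :=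
      pow_le_of_le_one (norm_nonneg _) (by norm_num) (Nat.succ_ne_zero m)
    have h4 : ‖(1 / 2 : ℂ)‖ = 1 / 2 := by norm_num
    linarith
  have h2 : ‖1 - polyEval (ζ : 𝔼) (peakPoly ξ) ^ (m + 1)‖ ≤ 2 := by
    have h3 := norm_sub_le (1 : ℂ) (polyEval (ζ : 𝔼) (peakPoly ξ) ^ (m + 1))
    rw [norm_one, norm_pow] at h3
    have h4 := pow_le_one₀ (n := m + 1) (norm_nonneg _) (norm_polyEval_peakPoly_le ξ ζ)
    linarith
  have h3 : ‖(1 - (1 / 2) ^ (m + 1) : ℂ)‖⁻¹ ≤ 2 := by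
    have := inv_anti₀ (by norm_num : (0 : ℝ) < 1 / 2) h1
    norm_num at this ⊢
    exact this
  calc _ ≤ (2 : ℝ) * 2 := mul_le_mul h3 h2 (norm_nonneg _) (by norm_num)
    _ = 4 := by norm_num

theorem tendsto_polyEval_cutoffPoly {F : Finset (CSphere d)} {ζ : CSphere d} (h : ζ ∉ F) :
    Tendsto (fun m => polyEval (ζ : 𝔼) (cutoffPoly F m)) atTop (𝓝 1) := by
  have hpow : ∀ {x : ℂ}, ‖x‖ < 1 → Tendsto (fun m : ℕ => 1 - x ^ (m + 1)) atTop (𝓝 1) := by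
    intro x hx
    simpa using ((tendsto_pow_atTop_nhds_zero_of_norm_lt_one hx).comp
      (tendsto_add_atTop_nat 1)).const_sub 1
  have hhalf := (hpow (x := 1 / 2) (by norm_num)).inv₀ one_ne_zero
  have hfac : ∀ ξ ∈ F, Tendsto (fun m : ℕ => (1 - (1 / 2 : ℂ) ^ (m + 1))⁻¹ *
      (1 - polyEval (ζ : 𝔼) (peakPoly ξ) ^ (m + 1))) atTop (𝓝 1) := by
    intro ξ hξ
    have hne : ζ ≠ ξ := fun h' => h (h' ▸ hξ)
    simpa using hhalf.mul (hpow (norm_polyEval_peakPoly_lt hne))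
  have := tendsto_finsetProd F hfac
  rw [Finset.prod_const_one] at this
  exact this.congr fun m => (polyEval_cutoffPoly F m _).symm

/-- Finitely many points may be discarded in the extremal problem. -/
theorem sInf_christoffelValues_le_indicator (μ : Measure (CSphere d)) [IsFiniteMeasure μ]
    (F : Finset (CSphere d)) {q : MvPolynomial (Fin d) ℂ} (hq : polyEval 0 q = 1) :
    sInf (christoffelValues μ 0) ≤
      ∫ ζ, (F : Set (CSphere d))ᶜ.indicator
        (fun ζ : CSphere d => ‖polyEval (ζ : 𝔼) q‖ ^ 2) ζ ∂μ := by
  have hlim : Tendsto (fun m => polyNormSq μ (cutoffPoly F m * q)) atTop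
      (𝓝 (∫ ζ, (F : Set (CSphere d))ᶜ.indicator
        (fun ζ : CSphere d => ‖polyEval (ζ : 𝔼) q‖ ^ 2) ζ ∂μ)) := by
    refine tendsto_integral_of_dominated_convergence
      (fun ζ : CSphere d => (4 ^ F.card) ^ 2 * ‖polyEval (ζ : 𝔼) q‖ ^ 2) (fun m => ?_)
      ((integrable_polyEval_sq μ q).const_mul _) (fun m => Eventually.of_forall fun ζ => ?_)
      (Eventually.of_forall fun ζ => ?_)
    · exact (integrable_polyEval_sq μ _).aestronglyMeasurable
    · rw [Real.norm_of_nonneg (by positivity), polyEval_mul, norm_mul, mul_pow]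
      have := norm_polyEval_cutoffPoly_le F m ζ
      gcongr
    · by_cases h : ζ ∈ F
      · rw [Set.indicator_of_notMem (by simpa using h)]
        refine tendsto_const_nhds.congr fun m => ?_
        rw [polyEval_mul, polyEval_cutoffPoly_of_mem h]
        simp
      · rw [Set.indicator_of_mem (by simpa using h)]
        have h1 := ((tendsto_polyEval_cutoffPoly h).mul_const (polyEval (ζ : 𝔼) q)).norm.pow 2
        simpa only [polyEval_mul, one_mul] using h1
  refine ge_of_tendsto' hlim fun m => (isGLB_sInf_christoffelValues μ 0).1 ⟨_, ?_, rfl⟩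
  rw [polyEval_mul, polyEval_cutoffPoly_zero, hq, one_mul]

theorem acPart_eq (μ : Measure (CSphere d)) [IsFiniteMeasure μ] :
    acPart μ = (sphereMeasure d).withDensity (μ.rnDeriv (sphereMeasure d)) := by
  refine withDensity_congr_ae ?_
  filter_upwards [μ.rnDeriv_lt_top (sphereMeasure d)] with ζ hζ
  exact ENNReal.ofReal_toReal hζ.ne

instance isFiniteMeasure_acPart (μ : Measure (CSphere d)) [IsFiniteMeasure μ] :
    IsFiniteMeasure (acPart μ) := by
  rw [acPart_eq]; infer_instance

theorem singPart_add_acPart (μ : Measure (CSphere d)) [IsFiniteMeasure μ] :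
    singPart μ + acPart μ = μ := by
  rw [acPart_eq, singPart]
  have := Measure.haveLebesgueDecomposition_of_sigmaFinite μ (sphereMeasure d)
  exact (μ.haveLebesgueDecomposition_add (sphereMeasure d)).symm

theorem acPart_le (μ : Measure (CSphere d)) [IsFiniteMeasure μ] : acPart μ ≤ μ := by
  conv_rhs => rw [← singPart_add_acPart μ]
  exact Measure.le_add_left le_rfl

theorem polyNormSq_acPart_le (μ : Measure (CSphere d)) [IsFiniteMeasure μ]
    (q : MvPolynomial (Fin d) ℂ) : polyNormSq (acPart μ) q ≤ polyNormSq μ q :=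
  integral_mono_measure (acPart_le μ) (Eventually.of_forall fun _ => by positivity)
    (integrable_polyEval_sq μ q)

/-- A discrete singular part does not contribute to the infimum of the extremal problem. -/
theorem sInf_christoffelValues_acPart (μ : Measure (CSphere d)) [IsFiniteMeasure μ]
    [Nonempty (CSphere d)] (h : IsDiscreteMeasure (singPart μ)) :
    sInf (christoffelValues (acPart μ) 0) = sInf (christoffelValues μ 0) := by
  refine le_antisymm ?_ ?_
  · refine le_csInf (christoffelValues_nonempty μ 0) ?_
    rintro _ ⟨q, hq, rfl⟩
    exact ((isGLB_sInf_christoffelValues (acPart μ) 0).1 ⟨q, hq, rfl⟩).trans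
      (polyNormSq_acPart_le μ q)
  · refine le_csInf (christoffelValues_nonempty _ 0) ?_
    rintro _ ⟨q, hq, rfl⟩
    obtain ⟨S, hS, hS0⟩ := h
    obtain ⟨e, he⟩ := Set.countable_iff_exists_subset_range.1 hS
    classical
    set F : ℕ → Finset (CSphere d) := fun n => (Finset.range n).image e with hF
    set u : CSphere d → ℝ := fun ζ => ‖polyEval (ζ : 𝔼) q‖ ^ 2 with hu
    have hfin : IsFiniteMeasure (singPart μ) := by rw [singPart]; infer_instance
    have hint : ∀ (ν : Measure (CSphere d)) [IsFiniteMeasure ν], Integrable u ν :=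
      fun ν _ => integrable_polyEval_sq ν q
    have hFm : ∀ n, MeasurableSet ((F n : Set (CSphere d))ᶜ) := fun n =>
      (F n).measurableSet.compl
    have hlim : Tendsto (fun n => ∫ ζ, (F n : Set (CSphere d))ᶜ.indicator u ζ ∂singPart μ) atTop
        (𝓝 (∫ ζ, (0 : ℝ) ∂singPart μ)) := by
      refine tendsto_integral_of_dominated_convergence u
        (fun n => ((hint _).indicator (hFm n)).aestronglyMeasurable) (hint _)
        (fun n => Eventually.of_forall fun ζ => ?_) ?_
      · refine (norm_indicator_le_norm_self _ _).trans_eq ?_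
        rw [Real.norm_of_nonneg (by positivity)]
      · have hS1 : ∀ᵐ ζ ∂singPart μ, ζ ∈ S := by
          rw [ae_iff]; exact hS0
        filter_upwards [hS1] with ζ hζ
        obtain ⟨k, rfl⟩ := he hζ
        refine tendsto_const_nhds.congr' ?_
        filter_upwards [eventually_gt_atTop k] with n hn
        rw [Set.indicator_of_notMem]
        rw [Set.notMem_compl_iff]
        exact Finset.mem_coe.2 (Finset.mem_image_of_mem e (Finset.mem_range.2 hn))
    have hle : ∀ n, sInf (christoffelValues μ 0) ≤
        ∫ ζ, (F n : Set (CSphere d))ᶜ.indicator u ζ ∂singPart μ + polyNormSq (acPart μ) q := by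
      intro n
      refine (sInf_christoffelValues_le_indicator μ (F n) hq).trans ?_
      conv_lhs => rw [← singPart_add_acPart μ]
      rw [integral_add_measure ((hint _).indicator (hFm n)) ((hint _).indicator (hFm n))]
      gcongr
      refine integral_mono ((hint _).indicator (hFm n)) (hint _) fun ζ => ?_
      exact Set.indicator_le_self' (fun _ _ => by positivity) ζ
    have := ge_of_tendsto' (hlim.add_const (polyNormSq (acPart μ) q)) hle
    simpa using this

theorem polyNormSq_zero_measure (q : MvPolynomial (Fin d) ℂ) : polyNormSq 0 q = 0 := by
  simp [polyNormSq]

theorem acPart_eq_zero_or_linearIndependent (μ : Measure (CSphere d)) [IsFiniteMeasure μ] :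
    acPart μ = 0 ∨ LinearIndependent ℂ (monoL2 (acPart μ)) := by
  refine or_iff_not_imp_left.2 fun h => linearIndependent_monoL2 ?_
  have : IsFiniteMeasure ((sphereMeasure d).withDensity
      fun ζ => ENNReal.ofReal (density μ ζ)) := isFiniteMeasure_acPart μ
  exact isNontrivialMeasure_withDensity h

theorem sInf_christoffelValues_zero_measure (z : 𝔼) :
    sInf (christoffelValues (0 : Measure (CSphere d)) z) = 0 := by
  refine le_antisymm ((isGLB_sInf_christoffelValues 0 z).1 ⟨1, by simp [polyEval], ?_⟩)
    (le_csInf (christoffelValues_nonempty _ z) (christoffelValues_nonneg _ z))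
  exact polyNormSq_zero_measure _

theorem tendsto_christoffelApprox_acPart (hd : 0 < d) (μ : Measure (CSphere d)) [IsFiniteMeasure μ]
    (z : 𝔼) : Tendsto (fun n => christoffelApprox (acPart μ) n z) atTop
      (𝓝 (sInf (christoffelValues (acPart μ) z))) := by
  rcases acPart_eq_zero_or_linearIndependent μ with h | h
  · rw [h, sInf_christoffelValues_zero_measure]
    refine tendsto_const_nhds.congr fun n => ?_
    simp [christoffelApprox, orthoPoly, polyNormSq_zero_measure, polyEval]
  · exact tendsto_christoffelApprox hd h z

theorem exists_minimizer_acPart (μ : Measure (CSphere d)) [IsFiniteMeasure μ] (n : ℕ) (z : 𝔼) :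
    ∃ P, IsChristoffelMinimizer (acPart μ) n z P := by
  rcases acPart_eq_zero_or_linearIndependent μ with h | h
  · rw [h]
    refine ⟨1, one_mem_polysUpTo _, by simp [polyEval], fun q _ _ => ?_⟩
    rw [polyNormSq_zero_measure, polyNormSq_zero_measure]
  · exact (existsUnique_minimizer h n z).exists

theorem tendsto_polyNormSq_minimizer_acPart (hd : 0 < d) (μ : Measure (CSphere d))
    [IsFiniteMeasure μ] {z : 𝔼} {P : ℕ → MvPolynomial (Fin d) ℂ}
    (hP : ∀ n, IsChristoffelMinimizer (acPart μ) n z (P n)) :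
    Tendsto (fun n => polyNormSq (acPart μ) (P n)) atTop
      (𝓝 (sInf (christoffelValues (acPart μ) z))) := by
  rcases acPart_eq_zero_or_linearIndependent μ with h | h
  · rw [h, sInf_christoffelValues_zero_measure]
    simp_rw [polyNormSq_zero_measure]
    exact tendsto_const_nhds
  · exact (tendsto_christoffelApprox hd h z).congr fun n => (polyNormSq_minimizer h (hP n)).symm

/-- The mass which the extremal polynomials of `μ` give to the absolutely continuous part. -/
theorem tendsto_polyNormSq_acPart_minimizer (hd : 0 < d) {μ : Measure (CSphere d)}
    [IsFiniteMeasure μ] [Nonempty (CSphere d)] (hv : LinearIndependent ℂ (monoL2 μ))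
    (h : IsDiscreteMeasure (singPart μ)) {P : ℕ → MvPolynomial (Fin d) ℂ}
    (hP : ∀ n, IsChristoffelMinimizer μ n 0 (P n)) :
    Tendsto (fun n => polyNormSq (acPart μ) (P n)) atTop (𝓝 (sInf (christoffelValues μ 0))) := by
  refine tendsto_of_tendsto_of_tendsto_of_le_of_le tendsto_const_nhds
    (tendsto_christoffelApprox hd hv 0) (fun n => ?_) fun n => ?_
  · rw [← sInf_christoffelValues_acPart μ h]
    exact (isGLB_sInf_christoffelValues (acPart μ) 0).1 ⟨P n, (hP n).2.1, rfl⟩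
  · rw [← polyNormSq_minimizer hv (hP n)]
    exact polyNormSq_acPart_le μ _

end Discrete

/-! ### The lower bound by the entropy -/

section Entropy

variable {d : ℕ}

local notation "𝔼" => EuclideanSpace ℂ (Fin d)

theorem density_nonneg (μ : Measure (CSphere d)) (ζ : CSphere d) : 0 ≤ density μ ζ :=
  ENNReal.toReal_nonneg

theorem measurable_density (μ : Measure (CSphere d)) : Measurable (density μ) :=
  (μ.measurable_rnDeriv _).ennreal_toReal

theorem integrable_density (μ : Measure (CSphere d)) [IsFiniteMeasure μ] :
    Integrable (density μ) (sphereMeasure d) := Measure.integrable_toReal_rnDeriv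

theorem polyNormSq_acPart (μ : Measure (CSphere d)) (q : MvPolynomial (Fin d) ℂ) :
    polyNormSq (acPart μ) q =
      ∫ ζ : CSphere d, density μ ζ * ‖polyEval (ζ : 𝔼) q‖ ^ 2 ∂sphereMeasure d := by
  rw [polyNormSq, acPart]
  have := integral_withDensity_eq_integral_toReal_smul (μ := sphereMeasure d)
    (f := fun ζ => ENNReal.ofReal (density μ ζ)) (measurable_density μ).ennreal_ofReal
    (Eventually.of_forall fun ζ => ENNReal.ofReal_lt_top)
    (fun ζ : CSphere d => ‖polyEval (ζ : 𝔼) q‖ ^ 2)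
  rw [this]
  simp only [ENNReal.toReal_ofReal (density_nonneg μ _), smul_eq_mul]

/-- Szegő's lower bound: the inequality of the arithmetic and geometric means for `|q|² w`, and
Jensen's inequality `∫ log |q|² dσ ≥ log |q(0)|²`. -/
theorem szegoEntropy_le (hd : 0 < d) (μ : Measure (CSphere d)) [IsFiniteMeasure μ]
    {q : MvPolynomial (Fin d) ℂ} (hq : polyEval 0 q = 1) :
    szegoEntropy (density μ) ≤ polyNormSq (acPart μ) q := by
  have := isProbabilityMeasure_sphereMeasure hd
  have hnn : 0 ≤ polyNormSq (acPart μ) q := integral_nonneg fun _ => by positivity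
  rw [szegoEntropy]
  split_ifs with hw
  swap
  · exact hnn
  obtain ⟨hpos, hlog⟩ := hw
  set A := ∫ ζ, Real.log (density μ ζ) ∂sphereMeasure d with hA
  set u : CSphere d → ℝ := fun ζ => ‖polyEval (ζ : 𝔼) q‖ ^ 2 with hu
  have hucont : Continuous u := (continuous_polyEval_sphere q).norm.pow 2
  have hwu : Integrable (fun ζ => density μ ζ * u ζ) (sphereMeasure d) := by
    obtain ⟨C, hC⟩ := isCompact_univ.exists_bound_of_continuousOn hucont.continuousOn
    exact (integrable_density μ).mul_bdd (c := C) hucont.aestronglyMeasurable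
      (Eventually.of_forall fun ζ => hC ζ (Set.mem_univ _))
  have key : ∀ ε > 0, Real.exp A ≤ polyNormSq (acPart μ) q +
      ε * ∫ ζ, density μ ζ ∂sphereMeasure d := by
    intro ε hε
    have hlogu : Integrable (fun ζ => Real.log (u ζ + ε)) (sphereMeasure d) := by
      refine Continuous.integrable_of_hasCompactSupport ?_ (HasCompactSupport.of_compactSpace _)
      exact (hucont.add continuous_const).log fun ζ =>
        (add_pos_of_nonneg_of_pos (sq_nonneg _) hε).ne'
    have h1 : ∫ ζ, Real.exp A * (1 + Real.log (u ζ + ε) + Real.log (density μ ζ) - A)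
        ∂sphereMeasure d ≤ ∫ ζ, (density μ ζ * u ζ + ε * density μ ζ) ∂sphereMeasure d := by
      refine integral_mono_ae ?_ (hwu.add ((integrable_density μ).const_mul ε)) ?_
      · exact ((((integrable_const 1).add hlogu).add hlog).sub (integrable_const A)).const_mul _
      · filter_upwards [hpos] with ζ hζ
        have hu0 : 0 < u ζ + ε := add_pos_of_nonneg_of_pos (sq_nonneg _) hε
        have ht : 0 < (u ζ + ε) * density μ ζ := mul_pos hu0 hζ
        -- `log x ≤ x - 1` for the quotient of `(|q|² + ε) w` by the geometric mean `exp A` of `w`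
        have h2 := Real.log_le_sub_one_of_pos (div_pos ht (Real.exp_pos A))
        rw [Real.log_div ht.ne' (Real.exp_pos A).ne', Real.log_mul hu0.ne' hζ.ne', Real.log_exp,
          le_sub_iff_add_le, le_div_iff₀ (Real.exp_pos A)] at h2
        linarith
    have hi1 : Integrable (fun ζ => 1 + Real.log (u ζ + ε)) (sphereMeasure d) :=
      (integrable_const 1).add hlogu
    have hi2 : Integrable (fun ζ => 1 + Real.log (u ζ + ε) + Real.log (density μ ζ))
      (sphereMeasure d) := hi1.add hlog
    rw [integral_const_mul, integral_sub hi2 (integrable_const A), integral_add hi1 hlog,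
      integral_add (integrable_const 1) hlogu, integral_add hwu
      ((integrable_density μ).const_mul ε), integral_const_mul, ← polyNormSq_acPart] at h1
    simp only [integral_const, probReal_univ, one_smul, ← hA] at h1
    have h2 := integral_log_polyEval_nonneg hq hε
    refine le_trans ?_ h1
    refine le_mul_of_one_le_right (Real.exp_pos A).le ?_
    linarith
  have hlim : Tendsto (fun ε : ℝ => polyNormSq (acPart μ) q +
      ε * ∫ ζ, density μ ζ ∂sphereMeasure d) (𝓝[>] 0)
      (𝓝 (polyNormSq (acPart μ) q + 0 * ∫ ζ, density μ ζ ∂sphereMeasure d)) :=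
    ((tendsto_id.mul_const _).const_add _).mono_left nhdsWithin_le_nhds
  rw [zero_mul, add_zero] at hlim
  exact ge_of_tendsto hlim (eventually_mem_nhdsWithin.mono key)

end Entropy

/-! ### Holomorphic functions of several variables -/

section Holomorphic

variable {E : Type*} [NormedAddCommGroup E] [NormedSpace ℂ E] [FiniteDimensional ℂ E]

/-- Directional derivatives of holomorphic functions are holomorphic: differentiate the Cauchy
integral for the derivative along a complex line. -/
theorem differentiableAt_fderiv_apply {f : E → ℂ} {U : Set E} (hU : IsOpen U)
    (hf : DifferentiableOn ℂ f U) {z₀ : E} (hz₀ : z₀ ∈ U) (v : E) :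
    DifferentiableAt ℂ (fun z => fderiv ℂ f z v) z₀ := by
  borelize E
  have : ProperSpace E := FiniteDimensional.proper ℂ E
  obtain ⟨R, hR, hRU⟩ := Metric.isOpen_iff.1 hU z₀ hz₀
  set ρ := R / 4 with hρ
  have hρ0 : 0 < ρ := by positivity
  have hsub : Metric.closedBall z₀ (3 * ρ) ⊆ U :=
    (Metric.closedBall_subset_ball (by rw [hρ]; linarith)).trans hRU
  obtain ⟨C, hC⟩ := (isCompact_closedBall z₀ (3 * ρ)).exists_bound_of_continuousOn
    (hf.continuousOn.mono hsub)
  have hbound : ∀ w ∈ Metric.closedBall z₀ (2 * ρ), ‖fderiv ℂ f w‖ ≤ 2 * C / ρ := by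
    intro w hw
    have hb : Metric.ball w ρ ⊆ Metric.closedBall z₀ (3 * ρ) := by
      refine Metric.ball_subset_closedBall.trans (Metric.closedBall_subset_closedBall' ?_)
      have := Metric.mem_closedBall.1 hw
      linarith
    refine Complex.norm_fderiv_le_div_of_mapsTo_ball (hf.mono (hb.trans hsub)) ?_ hρ0
    intro x hx
    have h1 := hC x (hb hx)
    have h2 := hC w (hb (Metric.mem_ball_self hρ0))
    rw [mem_closedBall_iff_norm]
    exact (norm_sub_le _ _).trans (by linarith)
  set s : ℝ := ρ / (‖v‖ + 1) with hs
  have hs0 : 0 < s := by positivity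
  have hsv : s * ‖v‖ ≤ ρ := by
    rw [hs, div_mul_eq_mul_div, div_le_iff₀ (by positivity)]
    nlinarith [norm_nonneg v]
  set c : ℝ → ℂ := circleMap 0 s with hc
  have hcn : ∀ θ, ‖c θ‖ = s := fun θ => by simp [hc, abs_of_pos hs0]
  have hc0 : ∀ θ, c θ ≠ 0 := fun θ => norm_ne_zero_iff.1 (by rw [hcn]; exact hs0.ne')
  have hcc : Continuous c := continuous_circleMap 0 s
  have hmem : ∀ z ∈ Metric.ball z₀ ρ, ∀ t : ℂ, ‖t‖ ≤ s →
      z + t • v ∈ Metric.closedBall z₀ (2 * ρ) := by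
    intro z hz t ht
    rw [mem_closedBall_iff_norm, add_sub_right_comm]
    refine (norm_add_le _ _).trans ?_
    rw [norm_smul]
    have h1 := mem_ball_iff_norm.1 hz
    have h2 := mul_le_mul_of_nonneg_right ht (norm_nonneg v)
    linarith
  have hsub2 : Metric.closedBall z₀ (2 * ρ) ⊆ U :=
    (Metric.closedBall_subset_closedBall (by linarith)).trans hsub
  set k : ℝ → ℂ := fun θ => (2 * Real.pi * Complex.I : ℂ)⁻¹ * (deriv (circleMap 0 s) θ *
    ((c θ) ^ 2)⁻¹) with hk
  have hkc : Continuous k := by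
    refine continuous_const.mul (Continuous.mul ?_
      ((hcc.pow 2).inv₀ fun θ => pow_ne_zero 2 (hc0 θ)))
    have hder : deriv (circleMap 0 s) = fun θ => circleMap 0 s θ * Complex.I := by
      ext θ
      simp [deriv_circleMap]
    rw [hder]
    exact hcc.mul continuous_const
  -- the Cauchy integral
  have hcauchy : ∀ z ∈ Metric.ball z₀ ρ,
      fderiv ℂ f z v = ∫ θ in 0..2 * Real.pi, k θ * f (z + c θ • v) := by
    intro z hz
    have hline : ∀ t : ℂ, HasDerivAt (fun t : ℂ => z + t • v) v t := fun t => by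
      simpa using ((hasDerivAt_id t).smul_const v).const_add z
    set V : Set ℂ := (fun t : ℂ => z + t • v) ⁻¹' U with hV
    have hVo : IsOpen V := hU.preimage (by fun_prop)
    have hfV : DifferentiableOn ℂ (fun t : ℂ => f (z + t • v)) V := fun t ht =>
      ((hf.differentiableAt (hU.mem_nhds ht)).comp t
        (hline t).differentiableAt).differentiableWithinAt
    have hball : Metric.closedBall (0 : ℂ) s ⊆ V := fun t ht =>
      hsub2 (hmem z hz t (by simpa using ht))
    have h1 := Complex.two_pi_I_inv_smul_circleIntegral_sub_sq_inv_smul_of_differentiable hVo hball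
      hfV (Metric.mem_ball_self hs0)
    have h2 : deriv (fun t : ℂ => f (z + t • v)) 0 = fderiv ℂ f z v := by
      have hz' : z + (0 : ℂ) • v ∈ U := hball (Metric.mem_closedBall_self hs0.le)
      have h3 := ((hf.differentiableAt (hU.mem_nhds hz')).hasFDerivAt.comp_hasDerivAt (0 : ℂ)
        (hline 0)).deriv
      rw [zero_smul, add_zero] at h3
      exact h3
    rw [← h2, ← h1, circleIntegral, smul_eq_mul, ← intervalIntegral.integral_const_mul]
    refine intervalIntegral.integral_congr fun θ _ => ?_
    simp only [hk, hc, sub_zero, smul_eq_mul]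
    ring
  have hcont : ∀ z ∈ Metric.ball z₀ ρ, Continuous fun θ => k θ * f (z + c θ • v) := by
    intro z hz
    refine hkc.mul (hf.continuousOn.comp_continuous (by fun_prop) fun θ => ?_)
    exact hsub2 (hmem z hz _ (hcn θ).le)
  have hder : HasFDerivAt (fun z => ∫ θ in 0..2 * Real.pi, k θ * f (z + c θ • v))
      (∫ θ in 0..2 * Real.pi, k θ • fderiv ℂ f (z₀ + c θ • v)) z₀ := by
    refine intervalIntegral.hasFDerivAt_integral_of_dominated_of_fderiv_le
      (F' := fun z θ => k θ • fderiv ℂ f (z + c θ • v)) (s := Metric.ball z₀ ρ)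
      (bound := fun θ => ‖k θ‖ * (2 * C / ρ)) (Metric.ball_mem_nhds z₀ hρ0) ?_ ?_ ?_ ?_ ?_ ?_
    · filter_upwards [Metric.ball_mem_nhds z₀ hρ0] with z hz
      exact (hcont z hz).aestronglyMeasurable
    · exact (hcont z₀ (Metric.mem_ball_self hρ0)).intervalIntegrable _ _
    · refine hkc.aestronglyMeasurable.smul (Measurable.aestronglyMeasurable ?_)
      exact (measurable_fderiv ℂ f).comp (by fun_prop : Continuous fun θ => z₀ + c θ • v).measurable
    · refine Eventually.of_forall fun θ _ z hz => ?_
      rw [norm_smul]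
      exact mul_le_mul_of_nonneg_left (hbound _ (hmem z hz _ (hcn θ).le)) (norm_nonneg _)
    · exact (hkc.norm.mul continuous_const).intervalIntegrable _ _
    · refine Eventually.of_forall fun θ _ z hz => ?_
      have h1 := (hf.differentiableAt (hU.mem_nhds (hsub2 (hmem z hz _ (hcn θ).le)))).hasFDerivAt
      have h2 := (h1.comp z ((hasFDerivAt_id z).add_const (c θ • v))).const_mul (k θ)
      exact h2
  refine hder.differentiableAt.congr_of_eventuallyEq ?_
  filter_upwards [Metric.ball_mem_nhds z₀ hρ0] with z hz
  exact hcauchy z hz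

/-- Holomorphic functions of several variables are smooth. -/
theorem contDiffOn_of_differentiableOn_complex {U : Set E} (hU : IsOpen U) (n : ℕ) :
    ∀ {f : E → ℂ}, DifferentiableOn ℂ f U → ContDiffOn ℂ n f U := by
  induction n with
  | zero => exact fun hf => contDiffOn_zero.2 hf.continuousOn
  | succ n ih =>
    intro f hf
    push_cast
    rw [contDiffOn_succ_iff_fderiv_of_isOpen hU]
    refine ⟨hf, by simp, contDiffOn_clm_apply.2 fun v => ih fun z hz => ?_⟩
    exact (differentiableAt_fderiv_apply hU hf hz v).differentiableWithinAt

end Holomorphic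

/-! ### Dilates and radial limits of bounded holomorphic functions -/

section Taylor

variable {d : ℕ}

local notation "𝔼" => EuclideanSpace ℂ (Fin d)

/-- The restriction of a multilinear form to the diagonal is a polynomial. -/
theorem exists_polyEval_eq_multilinear {k : ℕ}
    (M : ContinuousMultilinearMap ℂ (fun _ : Fin k => 𝔼) ℂ) :
    ∃ p : MvPolynomial (Fin d) ℂ, ∀ z, polyEval z p = M fun _ => z := by
  set e : Fin d → 𝔼 := fun i => EuclideanSpace.basisFun (Fin d) ℂ i with he
  refine ⟨∑ r : Fin k → Fin d, MvPolynomial.C (M fun i => e (r i)) * ∏ i, MvPolynomial.X (r i),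
    fun z => ?_⟩
  have hz : z = ∑ j, z j • e j := by
    simpa [he] using ((EuclideanSpace.basisFun (Fin d) ℂ).sum_repr z).symm
  have h1 : (M fun _ => z) = M fun _ : Fin k => ∑ j, z j • e j := by rw [← hz]
  rw [h1, M.map_sum (g := fun _ j => z j • e j), polyEval_sum]
  refine Finset.sum_congr rfl fun r _ => ?_
  rw [M.map_smul_univ (fun i => z (r i)) fun i => e (r i), polyEval_C_mul, smul_eq_mul, mul_comm]
  simp [polyEval, map_prod]

variable {f : EuclideanSpace ℂ (Fin d) → ℂ}

/-- The homogeneous terms of the Taylor series of a holomorphic function are polynomials. -/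
theorem exists_polyEval_eq_iteratedDeriv (hf : DifferentiableOn ℂ f (Metric.ball 0 1)) (k : ℕ) :
    ∃ p : MvPolynomial (Fin d) ℂ, ∀ z : 𝔼,
      polyEval z p = iteratedDeriv k (fun t : ℂ => f (t • z)) 0 := by
  obtain ⟨p, hp⟩ := exists_polyEval_eq_multilinear (iteratedFDeriv ℂ k f 0)
  refine ⟨p, fun z => ?_⟩
  rw [hp]
  set g : ℂ →L[ℂ] 𝔼 := ContinuousLinearMap.toSpanSingleton ℂ z with hg
  set U : Set (𝔼) := Metric.ball 0 1 with hU
  have hUo : IsOpen U := Metric.isOpen_ball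
  have hVo : IsOpen (g ⁻¹' U) := hUo.preimage g.continuous
  have h0 : (0 : 𝔼) ∈ U := Metric.mem_ball_self one_pos
  have h0' : g 0 ∈ U := by rw [map_zero]; exact h0
  have h1 := g.iteratedFDerivWithin_comp_right (contDiffOn_of_differentiableOn_complex hUo k hf)
    hUo.uniqueDiffOn hVo.uniqueDiffOn h0' (i := k) le_rfl
  rw [iteratedFDerivWithin_of_isOpen k hVo (by exact h0'), map_zero,
    iteratedFDerivWithin_of_isOpen k hUo h0] at h1
  have h2 : (fun t : ℂ => f (t • z)) = f ∘ g := rfl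
  rw [iteratedDeriv_eq_iteratedFDeriv, h2, h1]
  simp [hg]

/-- A bounded holomorphic function, restricted to a smaller concentric sphere, is a uniform limit of
polynomials with the same value at the centre. -/
theorem exists_tendstoUniformly_polyEval (hf : DifferentiableOn ℂ f (Metric.ball 0 1)) {C : ℝ}
    (hC : ∀ z ∈ Metric.ball (0 : 𝔼) 1, ‖f z‖ ≤ C) {r : ℝ} (hr0 : 0 < r) (hr1 : r < 1) :
    ∃ Q : ℕ → MvPolynomial (Fin d) ℂ, (∀ N, polyEval 0 (Q (N + 1)) = f 0) ∧
      ∃ a : ℕ → ℝ, Tendsto a atTop (𝓝 0) ∧ ∀ N, ∀ ζ : CSphere d,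
        ‖polyEval (ζ : 𝔼) (Q N) - f (r • (ζ : 𝔼))‖ ≤ a N := by
  choose p hp using exists_polyEval_eq_iteratedDeriv hf
  set R : ℝ := (1 + r) / 2 with hR
  have hrR : r < R := by rw [hR]; linarith
  have hR1 : R < 1 := by rw [hR]; linarith
  have hR0 : 0 < R := hr0.trans hrR
  have hq : r / R < 1 := (div_lt_one hR0).2 hrR
  refine ⟨fun N => ∑ k ∈ Finset.range N, MvPolynomial.C ((k.factorial : ℂ)⁻¹ * (r : ℂ) ^ k) * p k,
    fun N => ?_, fun N => C * (r / R) ^ N / (1 - r / R), ?_, fun N ζ => ?_⟩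
  · rw [polyEval_sum, Finset.sum_eq_single 0]
    · rw [polyEval_C_mul, hp]; simp
    · intro k _ hk
      rw [polyEval_C_mul, hp]
      simp only [smul_zero]
      rw [iteratedDeriv_const, if_neg hk, mul_zero]
    · simp
  · have h1 := tendsto_pow_atTop_nhds_zero_of_lt_one (by positivity : 0 ≤ r / R) hq
    simpa using (h1.const_mul C).div_const (1 - r / R)
  · set g : ℂ → ℂ := fun t => f (t • (ζ : 𝔼)) with hg
    have hball : ∀ t ∈ Metric.ball (0 : ℂ) 1, t • (ζ : 𝔼) ∈ Metric.ball (0 : 𝔼) 1 := by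
      intro t ht
      rw [mem_ball_zero_iff] at ht ⊢
      rw [norm_smul]
      simpa using ht
    have hgd : DifferentiableOn ℂ g (Metric.ball 0 1) :=
      hf.comp (by fun_prop) hball
    have hsum := Complex.hasSum_taylorSeries_on_ball hgd (z := (r : ℂ))
      (by rw [mem_ball_zero_iff, Complex.norm_real, Real.norm_of_nonneg hr0.le]; exact hr1)
    have hlim := hsum.tendsto_sum_nat
    -- Cauchy's estimate on the circle of radius `R`, which lies between `r` and `1`
    have hterm : ∀ k : ℕ, ‖(k.factorial : ℂ)⁻¹ • ((r : ℂ) - 0) ^ k • iteratedDeriv k g 0‖ ≤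
        C * (r / R) ^ k := by
      intro k
      have h1 := Complex.norm_iteratedDeriv_le_of_forall_mem_sphere_norm_le (C := C) k hR0
        (hgd.diffContOnCl_ball (Metric.closedBall_subset_ball hR1)) (fun t ht => hC _ (hball t ?_))
      · rw [norm_smul, norm_smul, sub_zero, norm_inv, norm_pow, Complex.norm_real,
          Real.norm_of_nonneg hr0.le, Complex.norm_natCast]
        have hk : (0 : ℝ) < k.factorial := by exact_mod_cast k.factorial_pos
        calc (k.factorial : ℝ)⁻¹ * (r ^ k * ‖iteratedDeriv k g 0‖)
            ≤ (k.factorial : ℝ)⁻¹ * (r ^ k * (k.factorial * C / R ^ k)) := by gcongr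
          _ = ((k.factorial : ℝ)⁻¹ * k.factorial) * (C * (r ^ k / R ^ k)) := by
              simp only [div_eq_mul_inv]; generalize (R ^ k)⁻¹ = x; ring
          _ = C * (r / R) ^ k := by rw [inv_mul_cancel₀ hk.ne', one_mul, div_pow r R]
      · rw [mem_sphere_zero_iff_norm] at ht
        rw [mem_ball_zero_iff, ht]
        exact hR1
    have hdist := dist_le_of_le_geometric_of_tendsto (r / R) C hq (fun n => ?_) hlim N
    · rw [dist_eq_norm] at hdist
      have e1 : polyEval (ζ : 𝔼) (∑ k ∈ Finset.range N,
          MvPolynomial.C ((k.factorial : ℂ)⁻¹ * (r : ℂ) ^ k) * p k) = ∑ k ∈ Finset.range N,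
            (k.factorial : ℂ)⁻¹ • ((r : ℂ) - 0) ^ k • iteratedDeriv k g 0 := by
        rw [polyEval_sum]
        refine Finset.sum_congr rfl fun k _ => ?_
        rw [polyEval_C_mul, hp, smul_eq_mul, smul_eq_mul, sub_zero, mul_assoc]
      have e2 : f (r • (ζ : 𝔼)) = g r := by
        simp only [hg, Complex.coe_smul]
      rw [e1, e2]
      exact hdist
    · rw [dist_eq_norm, Finset.sum_range_succ, sub_add_cancel_left, norm_neg]
      exact hterm n

/-- Dilates of bounded holomorphic functions are admissible in the extremal problem. -/
theorem sInf_christoffelValues_le_dilate (ν : Measure (CSphere d)) [IsFiniteMeasure ν]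
    (hf : DifferentiableOn ℂ f (Metric.ball 0 1)) {C : ℝ}
    (hC : ∀ z ∈ Metric.ball (0 : 𝔼) 1, ‖f z‖ ≤ C) (hf0 : f 0 = 1) {r : ℝ} (hr0 : 0 < r)
    (hr1 : r < 1) :
    sInf (christoffelValues ν 0) ≤ ∫ ζ : CSphere d, ‖f (r • (ζ : 𝔼))‖ ^ 2 ∂ν := by
  obtain ⟨Q, hQ0, a, ha, hQ⟩ := exists_tendstoUniformly_polyEval hf hC hr0 hr1
  have hmem : ∀ ζ : CSphere d, r • (ζ : 𝔼) ∈ Metric.ball (0 : 𝔼) 1 := by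
    intro ζ
    rw [mem_ball_zero_iff, norm_smul, Real.norm_of_nonneg hr0.le]
    simpa using hr1
  obtain ⟨B, hB⟩ := ha.norm.bddAbove_range
  have hlim : Tendsto (fun N => polyNormSq ν (Q N)) atTop
      (𝓝 (∫ ζ : CSphere d, ‖f (r • (ζ : 𝔼))‖ ^ 2 ∂ν)) := by
    refine tendsto_integral_of_dominated_convergence (fun _ => (C + B) ^ 2)
      (fun N => (integrable_polyEval_sq ν _).aestronglyMeasurable) (integrable_const _)
      (fun N => Eventually.of_forall fun ζ => ?_) (Eventually.of_forall fun ζ => ?_)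
    · rw [Real.norm_of_nonneg (by positivity)]
      refine pow_le_pow_left₀ (norm_nonneg _) ?_ 2
      have h1 := hQ N ζ
      have h2 := hC _ (hmem ζ)
      have h3 : ‖a N‖ ≤ B := hB ⟨N, rfl⟩
      have h4 := Real.le_norm_self (a N)
      have h5 := norm_sub_norm_le (polyEval (ζ : 𝔼) (Q N)) (f (r • (ζ : 𝔼)))
      linarith
    · refine (Tendsto.norm ?_).pow 2
      rw [tendsto_iff_norm_sub_tendsto_zero]
      exact squeeze_zero (fun _ => norm_nonneg _) (fun N => hQ N ζ) ha
  refine ge_of_tendsto' (hlim.comp (tendsto_add_atTop_nat 1)) fun N =>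
    (isGLB_sInf_christoffelValues ν 0).1 ⟨Q (N + 1), ?_, rfl⟩
  rw [hQ0, hf0]

/-- The boundary value dominates the upper limit along the radius: a radius is eventually
contained in each Korányi region. Where there is no `K`-limit, the boundary value is that upper
limit by convention. -/
theorem limsup_norm_radial_le_boundaryValue (f : 𝔼 → ℂ) (ζ : CSphere d) :
    limsup (fun r : ℝ => ‖f (r • (ζ : 𝔼))‖) (𝓝[<] 1) ≤ ‖boundaryValue f ζ‖ := by
  rw [boundaryValue]
  split_ifs with h
  · have hL := h.choose_spec
    set L := h.choose
    -- for the aperture `2` the condition on `r ζ` reads `1 - r < 1 - r²`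
    have h1 := hL 2 (by norm_num)
    have h2 : Tendsto (fun r : ℝ => r • (ζ : 𝔼)) (𝓝[<] 1) (𝓝[koranyiRegion 2 ζ] (ζ : 𝔼)) := by
      refine tendsto_nhdsWithin_iff.2 ⟨?_, ?_⟩
      · have : Tendsto (fun r : ℝ => r • (ζ : 𝔼)) (𝓝 1) (𝓝 ((1 : ℝ) • (ζ : 𝔼))) :=
          (by fun_prop : Continuous fun r : ℝ => r • (ζ : 𝔼)).tendsto 1
        rw [one_smul] at this
        exact this.mono_left nhdsWithin_le_nhds
      · have hIoo : Set.Ioo (0 : ℝ) 1 ∈ 𝓝[<] (1 : ℝ) := Ioo_mem_nhdsLT one_pos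
        filter_upwards [hIoo] with r hr
        have hn : ‖r • (ζ : 𝔼)‖ = r := by
          rw [norm_smul, Real.norm_of_nonneg hr.1.le]; simp
        refine ⟨by rw [hn]; exact hr.2, ?_⟩
        have hi : inner ℂ (ζ : 𝔼) (r • (ζ : 𝔼)) = (r : ℂ) := by
          rw [← Complex.coe_smul, inner_smul_right, inner_self_eq_norm_sq_to_K]
          simp
        rw [hn, hi, ← Complex.ofReal_one, ← Complex.ofReal_sub, Complex.norm_real,
          Real.norm_of_nonneg (by linarith [hr.2])]
        nlinarith [hr.1, hr.2]
    exact (h1.comp h2).norm.limsup_eq.le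
  · rw [Complex.norm_real]
    exact Real.le_norm_self _

/-- Fatou's lemma along the radii: the extremal value is at most `∫ |f|² w dσ` for bounded
holomorphic `f` with `f(0) = 1`. -/
theorem ofReal_sInf_christoffelValues_le_lintegral (μ : Measure (CSphere d)) [IsFiniteMeasure μ]
    (hf : IsHInfinity f) (hf0 : f 0 = 1) :
    ENNReal.ofReal (sInf (christoffelValues (acPart μ) 0)) ≤
      ∫⁻ ζ, ‖boundaryValue f ζ‖ₑ ^ 2 * ENNReal.ofReal (density μ ζ) ∂sphereMeasure d := by
  obtain ⟨hfd, C, hC⟩ := hf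
  set r : ℕ → ℝ := fun n => 1 - 1 / ((n : ℝ) + 2) with hr
  have hr0 : ∀ n, 0 < r n := fun n => by
    have h2 : (1 : ℝ) < (n : ℝ) + 2 := by have := n.cast_nonneg (α := ℝ); linarith
    have := (div_lt_one (by linarith)).2 h2
    simp only [hr]; linarith
  have hr1 : ∀ n, r n < 1 := fun n => by
    have : (0 : ℝ) < 1 / ((n : ℝ) + 2) := by positivity
    simp only [hr]; linarith
  have hrlim : Tendsto r atTop (𝓝[<] 1) := by
    refine tendsto_nhdsWithin_iff.2 ⟨?_, Eventually.of_forall hr1⟩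
    have h1 : Tendsto (fun n : ℕ => (1 : ℝ) / ((n : ℝ) + 2)) atTop (𝓝 0) :=
      tendsto_const_nhds.div_atTop (tendsto_atTop_add_const_right _ _ tendsto_natCast_atTop_atTop)
    simpa [hr] using h1.const_sub 1
  have hmem : ∀ (s : ℝ), 0 < s → s < 1 → ∀ ζ : CSphere d, s • (ζ : 𝔼) ∈ Metric.ball (0 : 𝔼) 1 := by
    intro s hs0 hs1 ζ
    rw [mem_ball_zero_iff, norm_smul, Real.norm_of_nonneg hs0.le]
    simpa using hs1
  have hcont : ∀ n, Continuous fun ζ : CSphere d => f (r n • (ζ : 𝔼)) := fun n =>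
    hfd.continuousOn.comp_continuous (by fun_prop) fun ζ => hmem _ (hr0 n) (hr1 n) ζ
  have hwm : Measurable fun ζ => ENNReal.ofReal (density μ ζ) :=
    (measurable_density μ).ennreal_ofReal
  set F : ℕ → CSphere d → ℝ≥0∞ := fun n ζ =>
    ‖f (r n • (ζ : 𝔼))‖ₑ ^ 2 * ENNReal.ofReal (density μ ζ) with hF
  have hFm : ∀ n, Measurable (F n) := fun n =>
    ((hcont n).measurable.enorm.pow_const 2).mul hwm
  have hle : ∀ n, ENNReal.ofReal (sInf (christoffelValues (acPart μ) 0)) ≤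
      ∫⁻ ζ, F n ζ ∂sphereMeasure d := by
    intro n
    have h1 := sInf_christoffelValues_le_dilate (acPart μ) hfd hC hf0 (hr0 n) (hr1 n)
    refine (ENNReal.ofReal_le_ofReal h1).trans_eq ?_
    rw [ofReal_integral_eq_lintegral_ofReal ?_ (Eventually.of_forall fun _ => by positivity),
      acPart, lintegral_withDensity_eq_lintegral_mul _ hwm ?_]
    · refine lintegral_congr fun ζ => ?_
      rw [Pi.mul_apply, mul_comm, ENNReal.ofReal_pow (norm_nonneg _), ofReal_norm]
    · exact ((hcont n).norm.pow 2).measurable.ennreal_ofReal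
    · exact ((hcont n).norm.pow 2).integrable_of_hasCompactSupport
        (HasCompactSupport.of_compactSpace _)
  have hbound : ∀ n, F n ≤ᵐ[sphereMeasure d]
      fun ζ => ENNReal.ofReal C ^ 2 * ENNReal.ofReal (density μ ζ) := by
    intro n
    refine Eventually.of_forall fun ζ => ?_
    simp only [hF]
    gcongr
    rw [← ofReal_norm]
    exact ENNReal.ofReal_le_ofReal (hC _ (hmem _ (hr0 n) (hr1 n) ζ))
  have hfin : ∫⁻ ζ, ENNReal.ofReal C ^ 2 * ENNReal.ofReal (density μ ζ) ∂sphereMeasure d ≠ ⊤ := by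
    rw [lintegral_const_mul _ hwm]
    refine ENNReal.mul_ne_top (ENNReal.pow_ne_top ENNReal.ofReal_ne_top) ?_
    exact (integrable_density μ).lintegral_lt_top.ne
  have hfatou := limsup_lintegral_le _ hFm hbound hfin
  have hpoint : ∀ ζ, limsup (fun n => F n ζ) atTop ≤
      ‖boundaryValue f ζ‖ₑ ^ 2 * ENNReal.ofReal (density μ ζ) := by
    intro ζ
    have h1 := limsup_norm_radial_le_boundaryValue f ζ
    have h2 : ∀ ε > 0, ∀ᶠ n in atTop, ‖f (r n • (ζ : 𝔼))‖ < ‖boundaryValue f ζ‖ + ε := by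
      intro ε hε
      refine hrlim.eventually
        (eventually_lt_of_limsup_lt (h1.trans_lt (lt_add_of_pos_right _ hε)) ?_)
      refine ⟨C, eventually_map.2 ?_⟩
      have hIoo : Set.Ioo (0 : ℝ) 1 ∈ 𝓝[<] (1 : ℝ) := Ioo_mem_nhdsLT one_pos
      filter_upwards [hIoo] with s hs
      exact hC _ (hmem s hs.1 hs.2 ζ)
    have h3 : ∀ ε > 0, limsup (fun n => F n ζ) atTop ≤
        ENNReal.ofReal ((‖boundaryValue f ζ‖ + ε) ^ 2 * density μ ζ) := by
      intro ε hε
      refine limsup_le_of_le (by isBoundedDefault) ?_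
      filter_upwards [h2 ε hε] with n hn
      simp only [hF]
      rw [← ofReal_norm, ← ENNReal.ofReal_pow (norm_nonneg _),
        ← ENNReal.ofReal_mul (by positivity)]
      refine ENNReal.ofReal_le_ofReal (mul_le_mul_of_nonneg_right ?_ (density_nonneg μ ζ))
      exact pow_le_pow_left₀ (norm_nonneg _) hn.le 2
    have h4 : Tendsto (fun ε : ℝ => ENNReal.ofReal ((‖boundaryValue f ζ‖ + ε) ^ 2 * density μ ζ))
        (𝓝[>] 0) (𝓝 (ENNReal.ofReal ((‖boundaryValue f ζ‖ + 0) ^ 2 * density μ ζ))) := by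
      refine Tendsto.mono_left ?_ nhdsWithin_le_nhds
      exact (ENNReal.continuous_ofReal.comp
        (by fun_prop : Continuous fun ε : ℝ =>
          (‖boundaryValue f ζ‖ + ε) ^ 2 * density μ ζ)).tendsto 0
    have h5 := ge_of_tendsto h4 (eventually_mem_nhdsWithin.mono h3)
    rwa [add_zero, ENNReal.ofReal_mul (by positivity), ENNReal.ofReal_pow (norm_nonneg _),
      ofReal_norm] at h5
  refine le_trans ?_ (hfatou.trans (lintegral_mono hpoint))
  exact le_limsup_of_frequently_le (Frequently.of_forall hle)

/-- If the infimum of `∫ |f|² w dσ` over bounded holomorphic functions reaches Szegő's lower bound,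
so does the extremal problem for polynomials. -/
theorem sInf_christoffelValues_eq_szegoEntropy (hd : 0 < d) (μ : Measure (CSphere d))
    [IsFiniteMeasure μ] (h : ∃ f : EuclideanSpace ℂ (Fin d) → ℂ, IsHInfinity f ∧ f 0 = 1 ∧
      ∫⁻ ζ, ‖boundaryValue f ζ‖ₑ ^ 2 * ENNReal.ofReal (density μ ζ) ∂sphereMeasure d ≤
        ENNReal.ofReal (szegoEntropy (density μ))) :
    sInf (christoffelValues (acPart μ) 0) = szegoEntropy (density μ) := by
  obtain ⟨f, hf, hf0, hle⟩ := h
  refine le_antisymm ?_ ?_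
  · have h1 := (ofReal_sInf_christoffelValues_le_lintegral μ hf hf0).trans hle
    refine (ENNReal.ofReal_le_ofReal_iff ?_).1 h1
    rw [szegoEntropy]
    split_ifs
    · exact (Real.exp_pos _).le
    · exact le_rfl
  · refine le_csInf (christoffelValues_nonempty _ 0) ?_
    rintro _ ⟨q, hq, rfl⟩
    exact szegoEntropy_le hd μ hq

end Taylor

/-! ### The surface measure in several variables -/

section Surface

variable {d : ℕ}

theorem isNontrivialMeasure_sphereMeasure (hd : 0 < d) : IsNontrivialMeasure (sphereMeasure d) := by
  have := isProbabilityMeasure_sphereMeasure hd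
  refine isNontrivialMeasure_of_forall_ae_eq_zero fun p hp => ?_
  by_contra hp0
  obtain ⟨ζ, hζ, hζ'⟩ := (hp.and (ae_polyEval_ne_zero hp0)).exists
  exact hζ' hζ

/-- By Jensen's inequality the constant `1` solves the extremal problem for the surface measure. -/
theorem one_le_polyNormSq_sphereMeasure (hd : 0 < d) {q : MvPolynomial (Fin d) ℂ}
    (hq : polyEval 0 q = 1) : 1 ≤ polyNormSq (sphereMeasure d) q := by
  have := isProbabilityMeasure_sphereMeasure hd
  refine le_of_forall_pos_le_add fun ε hε => ?_
  have hint := integrable_polyEval_sq (sphereMeasure d) q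
  have h1 : ∫ ζ : CSphere d, Real.log (‖polyEval (ζ : EuclideanSpace ℂ (Fin d)) q‖ ^ 2 + ε)
      ∂sphereMeasure d ≤ ∫ ζ : CSphere d,
        (‖polyEval (ζ : EuclideanSpace ℂ (Fin d)) q‖ ^ 2 + (ε - 1)) ∂sphereMeasure d := by
    refine integral_mono (Continuous.integrable_of_hasCompactSupport ?_
      (HasCompactSupport.of_compactSpace _)) (hint.add (integrable_const _)) fun ζ => ?_
    · exact (((continuous_polyEval_sphere q).norm.pow 2).add continuous_const).log fun ζ =>
        (add_pos_of_nonneg_of_pos (sq_nonneg _) hε).ne'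
    · have := Real.log_le_sub_one_of_pos (add_pos_of_nonneg_of_pos
        (sq_nonneg ‖polyEval (ζ : EuclideanSpace ℂ (Fin d)) q‖) hε)
      simp only
      linarith
  rw [integral_add hint (integrable_const _), integral_const, probReal_univ, one_smul] at h1
  have h2 := integral_log_polyEval_nonneg hq hε
  rw [polyNormSq]
  linarith

/-- In several variables the coordinate `z_d` has modulus less than `1` almost everywhere on the
sphere, hence `‖Φ_{α(n)}‖² ≤ ∫ |z_d|^{2n} dσ → 0`. -/
theorem tendsto_polyNormSq_monicPoly_sphereMeasure (hd : 1 < d) :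
    Tendsto (fun n => polyNormSq (sphereMeasure d)
      (monicPoly (sphereMeasure d) (MultiIndex.last d n))) atTop (𝓝 0) := by
  set i₀ : Fin d := ⟨0, by omega⟩ with hi₀
  set i₁ : Fin d := ⟨d - 1, by omega⟩ with hi₁
  have hne : i₀ ≠ i₁ := by
    rw [Ne, Fin.ext_iff]
    simp only [hi₀, hi₁]
    omega
  have hev : ∀ n, ∀ ζ : CSphere d, ‖polyEval (ζ : EuclideanSpace ℂ (Fin d))
      (zmonomial (MultiIndex.last d n))‖ ^ 2 =
        (‖(ζ : EuclideanSpace ℂ (Fin d)) i₁‖ ^ 2) ^ n := by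
    intro n ζ
    rw [polyEval_zmonomial, Finset.prod_eq_single i₁]
    · have : (MultiIndex.last d n).exp i₁ = n := by
        change (if d - 1 + 1 = d then n else 0) = n
        rw [if_pos (by omega)]
      rw [this, norm_pow, ← pow_mul, ← pow_mul, mul_comm]
    · intro i _ hi
      have : (MultiIndex.last d n).exp i = 0 := by
        change (if i.val + 1 = d then n else 0) = 0
        rw [if_neg]
        intro h
        exact hi (Fin.ext (by simp only [hi₁]; omega))
      rw [this, pow_zero]
    · exact fun h => absurd (Finset.mem_univ _) h
  have hlt : ∀ᵐ ζ : CSphere d ∂sphereMeasure d,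
      ‖(ζ : EuclideanSpace ℂ (Fin d)) i₁‖ ^ 2 < 1 := by
    filter_upwards [ae_polyEval_ne_zero (MvPolynomial.X_ne_zero (R := ℂ) i₀)] with ζ hζ
    rw [polyEval, MvPolynomial.eval_X] at hζ
    have h1 : ∑ i, ‖(ζ : EuclideanSpace ℂ (Fin d)) i‖ ^ 2 = 1 := by
      rw [← EuclideanSpace.norm_sq_eq, norm_eq_of_mem_sphere, one_pow]
    have h2 := Finset.add_le_sum (f := fun i => ‖(ζ : EuclideanSpace ℂ (Fin d)) i‖ ^ 2)
      (fun i _ => sq_nonneg _) (Finset.mem_univ i₀) (Finset.mem_univ i₁) hne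
    have h3 : 0 < ‖(ζ : EuclideanSpace ℂ (Fin d)) i₀‖ ^ 2 := by positivity
    simp only [h1] at h2
    linarith
  have hlim : Tendsto (fun n => polyNormSq (sphereMeasure d) (zmonomial (MultiIndex.last d n)))
      atTop (𝓝 (∫ _ : CSphere d, (0 : ℝ) ∂sphereMeasure d)) := by
    refine tendsto_integral_of_dominated_convergence (fun _ => 1)
      (fun n => (integrable_polyEval_sq _ _).aestronglyMeasurable) (integrable_const _)
      (fun n => Eventually.of_forall fun ζ => ?_) ?_
    · rw [hev, Real.norm_of_nonneg (by positivity)]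
      exact pow_le_one₀ (by positivity) (pow_le_one₀ (norm_nonneg _) (norm_coord_le_one ζ i₁))
    · filter_upwards [hlt] with ζ hζ
      simp only [hev]
      exact tendsto_pow_atTop_nhds_zero_of_lt_one (by positivity) hζ
  rw [integral_zero] at hlim
  refine squeeze_zero (fun n => integral_nonneg fun _ => by positivity) (fun n => ?_) hlim
  exact polyNormSq_monicPoly_le (by rw [sub_self]; exact zero_mem _)

end Surface

end

theorem mainTheorem1 (d : ℕ) (hd : 0 < d) :
    (∀ μ : Measure (CSphere d), IsProbabilityMeasure μ → IsNontrivialMeasure μ →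
      -- the first list
      (∃ L : ℝ,
        Tendsto (fun n => polyNormSq μ (monicPoly μ (MultiIndex.last d n))) atTop (𝓝 L) ∧
        Tendsto (fun n => ((orthoCoeff μ (MultiIndex.last d n) (MultiIndex.last d n)) ^ 2)⁻¹)
          atTop (𝓝 (L : ℂ)) ∧
        Tendsto (fun n => momentDet μ (MultiIndex.last d n) /
          momentDet μ (MultiIndex.last d n).prec) atTop (𝓝 (L : ℂ)) ∧
        Tendsto (fun n => momentKernel μ (MultiIndex.last d n) (MultiIndex.last d n) *
          ((∏ β ∈ Finset.Iic (MultiIndex.last d n).prec,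
            (1 - ‖verblunskyCoeff μ β (MultiIndex.last d n)‖ ^ 2) : ℝ) : ℂ))
          atTop (𝓝 (L : ℂ))) ∧
      -- the second list
      (∀ n, ∃! P, IsChristoffelMinimizer μ n 0 P) ∧
      (∃ L : ℝ,
        HasProd (fun α => 1 - ‖verblunskyCoeff μ 0 α‖ ^ 2) L ∧
        Tendsto (fun n => (‖polyEval 0 (sharpPoly μ (MultiIndex.last d n))‖ ^ 2)⁻¹)
          atTop (𝓝 L) ∧
        Tendsto (fun n => (∑ α ∈ Finset.Iic (MultiIndex.last d n),
          ‖polyEval 0 (orthoPoly μ α)‖ ^ 2)⁻¹) atTop (𝓝 L) ∧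
        (christoffelFunction μ 0 = L ∧ IsGLB (christoffelValues μ 0) L) ∧
        -- the singular part is discrete
        (IsDiscreteMeasure (singPart μ) →
          (Tendsto (fun n => christoffelApprox (acPart μ) n 0) atTop (𝓝 L) ∧
            christoffelFunction (acPart μ) 0 = L ∧ IsGLB (christoffelValues (acPart μ) 0) L) ∧
          (∀ P : ℕ → MvPolynomial (Fin d) ℂ, (∀ n, IsChristoffelMinimizer μ n 0 (P n)) →
            Tendsto (fun n => polyNormSq (acPart μ) (P n)) atTop (𝓝 L)) ∧
          ((∀ n, ∃ P, IsChristoffelMinimizer (acPart μ) n 0 P) ∧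
            ∀ P : ℕ → MvPolynomial (Fin d) ℂ,
              (∀ n, IsChristoffelMinimizer (acPart μ) n 0 (P n)) →
              Tendsto (fun n => polyNormSq (acPart μ) (P n)) atTop (𝓝 L)) ∧
          -- the additional hypothesis on the weight
          ((∃ f : EuclideanSpace ℂ (Fin d) → ℂ, IsHInfinity f ∧ f 0 = 1 ∧
              ∫⁻ ζ, ‖boundaryValue f ζ‖ₑ ^ 2 * ENNReal.ofReal (density μ ζ) ∂sphereMeasure d ≤
                ENNReal.ofReal (szegoEntropy (density μ))) →
            L = szegoEntropy (density μ))))) ∧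
    -- in several variables the two lists are distinct quantities
    (1 < d → ∃ μ : Measure (CSphere d), IsProbabilityMeasure μ ∧ IsNontrivialMeasure μ ∧
      ∃ L₁ L₂ : ℝ, L₁ ≠ L₂ ∧
        Tendsto (fun n => polyNormSq μ (monicPoly μ (MultiIndex.last d n))) atTop (𝓝 L₁) ∧
        HasProd (fun α => 1 - ‖verblunskyCoeff μ 0 α‖ ^ 2) L₂) := by
  refine ⟨fun μ hμ hnt => ?_, fun h => ?_⟩
  · have hv := linearIndependent_monoL2 hnt
    have hne : Nonempty (CSphere d) := nonempty_of_isProbabilityMeasure μ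
    have hlim := tendsto_christoffelApprox hd hv 0
    refine ⟨exists_limit_monic hd hv, fun n => existsUnique_minimizer hv n 0,
      sInf (christoffelValues μ 0), hasProd_verblunsky hd hv, ?_, hlim,
      ⟨hlim.limUnder_eq, isGLB_sInf_christoffelValues μ 0⟩, fun hdisc => ?_⟩
    · simp only [norm_sq_sharpPoly_zero hv]
      exact hlim
    have hac := sInf_christoffelValues_acPart μ hdisc
    have hlim' := tendsto_christoffelApprox_acPart hd μ 0
    refine ⟨?_, fun P hP => tendsto_polyNormSq_acPart_minimizer hd hv hdisc hP,
      ⟨fun n => exists_minimizer_acPart μ n 0, fun P hP => ?_⟩, fun hf => ?_⟩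
    · rw [← hac]
      exact ⟨hlim', hlim'.limUnder_eq, isGLB_sInf_christoffelValues _ 0⟩
    · rw [← hac]
      exact tendsto_polyNormSq_minimizer_acPart hd μ hP
    · rw [← hac]
      exact sInf_christoffelValues_eq_szegoEntropy hd μ hf
  · have hp := isProbabilityMeasure_sphereMeasure hd
    have hnt := isNontrivialMeasure_sphereMeasure hd
    refine ⟨sphereMeasure d, hp, hnt, 0, sInf (christoffelValues (sphereMeasure d) 0), ?_,
      tendsto_polyNormSq_monicPoly_sphereMeasure h,
      hasProd_verblunsky hd (linearIndependent_monoL2 hnt)⟩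
    refine (one_pos.trans_le (le_csInf (christoffelValues_nonempty _ 0) ?_)).ne
    rintro _ ⟨q, hq, rfl⟩
    exact one_le_polyNormSq_sphereMeasure hd hq
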